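/- Let $V$ be a finite-dimensional real vector space and $\Delta$ a fan in $V$, i.e. a finite set of strictly convex polyhedral cones (not necessarily rational) that contains every face of each of its members and any two members of which meet in a common face. For $\sigma\in\Delta$ let $V_\sigma$ be the linear span of $\sigma$ and $A_\sigma=S(V_\sigma^*)$, graded so that $V_\sigma^*$ has degree $2$. Write $\tau\le\sigma$ if $\tau$ is a face of $\sigma$, and $\tau<_1\sigma$ if $\tau$ is a facet (a face of codimension one). The open subsets of $\Delta$ are the subfans. A sheaf $\mathcal F$ of graded $\mathcal A$-modules on $\Delta$ is given by $\mathbb Z$-graded $A_\sigma$-modules $F_\sigma$ ($\sigma\in\Delta$) and functorial restriction maps $F_\sigma\to F_\tau$ ($\tau\le\sigma$) of degree $0$ that are linear along the restriction $A_\sigma\to A_\tau$; its sections over a subfan $\Lambda$ are the compatible families in $\prod_{\sigma\in\Lambda}F_\sigma$. It is *perverse* if it is flabby (every section over a subfan extends to $\Delta$) and each $F_\sigma$ is a finitely generated free $A_\sigma$-module. Let $F_{(\sigma,\partial\sigma)}\subset F_\sigma$ be the submodule of the elements whose restriction to every proper face of $\sigma$ is zero. Let $\mathcal F$ be a perverse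 sheaf and fix an orientation of $V_\sigma$ for each $\sigma\in\Delta$. The dual $D\mathcal F$ has $$(D\mathcal F)_\sigma=\operatorname{Hom}_{A_\sigma}(F_{(\sigma,\partial\sigma)},A_\sigma)\otimes_{\mathbb R}\det V_\sigma^*,$$ where $\det V_\sigma^*$ is placed in degree $2\dim\sigma$. For a facet $\tau<_1\sigma$ and a linear form $h$ on $V_\sigma$ with kernel $V_\tau$, let $\varphi_h(f)(g)=f(h\hat g)|_{\tau}$ for $f\in\operatorname{Hom}(F_{(\sigma,\partial\sigma)},A_\sigma)$ and $g\in F_{(\tau,\partial\tau)}$, where $\hat g\in F_\sigma$ is any extension of the section over $\partial\sigma$ that is $g$ on $\tau$ and zero on the proper faces of $\sigma$ not contained in $\tau$; and let $\psi_h:\det V_\sigma^*\to\det V_\tau^*$, $h\wedge\eta\mapsto\eta|_{V_\tau}$. The restriction map $(D\mathcal F)_\sigma\to(D\mathcal F)_\tau$ is $\varepsilon^\sigma_\tau\cdot\varphi_h\otimes\psi_h$, where $\varepsilon^\sigma_\tau=\pm1$ is $1$ if and only if the chosen orientation of $\sigma$ induces that of $\tau$ (by contraction with a vector pointing from $\tau$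 into $\sigma$); this does not depend on $h$. For an arbitrary face $\tau\le\sigma$ the restriction map is the composition of these maps along a chain $\tau=\tau_0<_1\tau_1<_1\dots<_1\tau_r=\sigma$. **Theorem.** Such a chain exists for all $\tau\le\sigma$ in $\Delta$, the restriction map does not depend on its choice, and $D\mathcal F$ is again a perverse sheaf: with these restriction maps it is a sheaf of graded $\mathcal A$-modules, it is flabby, and each $(D\mathcal F)_\sigma$ is a finitely generated free $A_\sigma$-module. -/

import Mathlib

open scoped TensorProduct

noncomputable section

namespace FanDuality

universe u w

/-! ### Polynomial algebras and determinants of linear subspaces -/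

section LinearAlgebra

variable {V : Type u} [AddCommGroup V] [Module ℝ V]

/-- The algebra `S(U^*)` of real polynomials on the linear subspace `U`. -/
abbrev Poly (U : Submodule ℝ V) : Type u := SymmetricAlgebra ℝ (Module.Dual ℝ U)

/-- The grading of `S(U^*)` for which the linear forms have degree `2`: the component of degree
`2m` is spanned by the products of `m` linear forms, the other components are zero. -/
def polyGr (U : Submodule ℝ V) (k : ℤ) : Submodule ℝ (Poly U) :=
  ⨆ (m : ℕ) (_ : 2 * (m : ℤ) = k), (LinearMap.range (SymmetricAlgebra.ι ℝ (Module.Dual ℝ U))) ^ m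

/-- Restriction of polynomials from `U` to a smaller subspace `U'`. -/
def polyRes {U' U : Submodule ℝ V} (h : U' ≤ U) : Poly U →ₐ[ℝ] Poly U' :=
  SymmetricAlgebra.lift
    (SymmetricAlgebra.ι ℝ (Module.Dual ℝ U') ∘ₗ (Submodule.inclusion h).dualMap)

theorem polyRes_ι {U' U : Submodule ℝ V} (h : U' ≤ U) (l : Module.Dual ℝ U) :
    polyRes h (SymmetricAlgebra.ι ℝ _ l) =
      SymmetricAlgebra.ι ℝ _ ((Submodule.inclusion h).dualMap l) := by
  simp [polyRes]

theorem polyRes_self {U : Submodule ℝ V} (h : U ≤ U) (a : Poly U) : polyRes h a = a := by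
  have : polyRes h = AlgHom.id ℝ (Poly U) := by
    apply SymmetricAlgebra.algHom_ext
    exact LinearMap.ext fun l => polyRes_ι h l
  rw [this]; rfl

theorem polyRes_polyRes {U'' U' U : Submodule ℝ V} (h : U' ≤ U) (h' : U'' ≤ U') (a : Poly U) :
    polyRes h' (polyRes h a) = polyRes (h'.trans h) a := by
  have : (polyRes h').comp (polyRes h) = polyRes (h'.trans h) := by
    apply SymmetricAlgebra.algHom_ext
    refine LinearMap.ext fun l => ?_
    change polyRes h' (polyRes h (SymmetricAlgebra.ι ℝ _ l)) =
      polyRes (h'.trans h) (SymmetricAlgebra.ι ℝ _ l)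
    rw [polyRes_ι, polyRes_ι, polyRes_ι]
    rfl
  rw [← this]; rfl

theorem polyRes_surjective {U' U : Submodule ℝ V} (h : U' ≤ U) :
    Function.Surjective (polyRes h) := by
  intro b
  induction b using SymmetricAlgebra.induction with
  | algebraMap r => exact ⟨algebraMap ℝ _ r, AlgHom.commutes _ r⟩
  | ι l =>
    obtain ⟨m, hm⟩ := LinearMap.dualMap_surjective_of_injective
      (Submodule.inclusion_injective h) l
    exact ⟨SymmetricAlgebra.ι ℝ _ m, by rw [polyRes_ι, hm]⟩
  | mul a b ha hb =>
    obtain ⟨a, rfl⟩ := ha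
    obtain ⟨b, rfl⟩ := hb
    exact ⟨a * b, map_mul _ _ _⟩
  | add a b ha hb =>
    obtain ⟨a, rfl⟩ := ha
    obtain ⟨b, rfl⟩ := hb
    exact ⟨a + b, map_add _ _ _⟩

/-- `det U^*`, the line of top-degree alternating forms on `U`. -/
abbrev DetDual (U : Submodule ℝ V) : Type u :=
  U [⋀^Fin (Module.finrank ℝ U)]→ₗ[ℝ] ℝ

/-- The contraction `det U^* → det U'^*`, `ω ↦ ω(n, ·, …, ·)|_{U'}`, for a subspace `U'` of
codimension one. If `h` is a linear form on `U` with kernel `U'` and `h n = 1`, this is the map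
sending `h ∧ η` to `η|_{U'}`; it depends on `h` only. -/
def contract {U' U : Submodule ℝ V} (h : U' ≤ U)
    (hd : Module.finrank ℝ U' + 1 = Module.finrank ℝ U) (n : U) :
    DetDual U →ₗ[ℝ] DetDual U' where
  toFun ω := (AlternatingMap.curryLeft (ω.domDomCongr (finCongr hd.symm)) n).compLinearMap
    (Submodule.inclusion h)
  map_add' ω ω' := by ext v; rfl
  map_smul' c ω := by ext v; rfl

end LinearAlgebra

/-! ### Fans -/

/-- A fan in `V`: a finite set of strictly convex polyhedral cones, closed under passing to faces,
any two of which meet in a common face. -/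
structure Fan (V : Type u) [AddCommGroup V] [Module ℝ V] where
  cones : Set (PointedCone ℝ V)
  finite : cones.Finite
  polyhedral : ∀ σ ∈ cones, σ.FG
  strictlyConvex : ∀ σ ∈ cones, (σ : ConvexCone ℝ V).Salient
  face_mem : ∀ σ ∈ cones, ∀ τ : PointedCone ℝ V, τ.IsFaceOf σ → τ ∈ cones
  inf_isFaceOf : ∀ σ ∈ cones, ∀ τ ∈ cones, (σ ⊓ τ).IsFaceOf σ

section Cones

variable {V : Type u} [AddCommGroup V] [Module ℝ V] {Δ : Fan V}

/-- The cones of a fan, ordered by inclusion, which is the same as the face relation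
(`Fan.Cone.le_iff_isFaceOf`). The subfans are the lower sets; they are the open subsets. -/
abbrev Fan.Cone (Δ : Fan V) : Type u := {σ : PointedCone ℝ V // σ ∈ Δ.cones}

theorem Fan.Cone.isFaceOf {τ σ : Δ.Cone} (h : τ ≤ σ) : τ.1.IsFaceOf σ.1 := by
  have := Δ.inf_isFaceOf σ.1 σ.2 τ.1 τ.2
  rwa [inf_eq_right.mpr (show τ.1 ≤ σ.1 from h)] at this

theorem Fan.Cone.le_iff_isFaceOf {τ σ : Δ.Cone} : τ ≤ σ ↔ τ.1.IsFaceOf σ.1 :=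
  ⟨fun h => Fan.Cone.isFaceOf h, fun h => h.le⟩

/-- The linear span `V_σ` of a cone. -/
def Fan.Cone.lin (σ : Δ.Cone) : Submodule ℝ V := Submodule.span ℝ (σ.1 : Set V)

theorem Fan.Cone.lin_mono {τ σ : Δ.Cone} (h : τ ≤ σ) : τ.lin ≤ σ.lin :=
  Submodule.span_mono h

theorem Fan.Cone.subset_lin (σ : Δ.Cone) {x : V} (hx : x ∈ σ.1) : x ∈ σ.lin :=
  Submodule.subset_span hx

theorem Fan.Cone.mem_of_mem_lin {τ σ : Δ.Cone} (h : τ ≤ σ) {x : V} (hx : x ∈ σ.1)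
    (hx' : x ∈ τ.lin) : x ∈ τ.1 := by
  have key : ∀ y ∈ τ.lin, ∃ a ∈ τ.1, ∃ b ∈ τ.1, y = a - b := by
    intro y hy
    induction hy using Submodule.span_induction with
    | mem y hy => exact ⟨y, hy, 0, zero_mem _, by simp⟩
    | zero => exact ⟨0, zero_mem _, 0, zero_mem _, by simp⟩
    | add y z _ _ h1 h2 =>
      obtain ⟨a, ha, b, hb, rfl⟩ := h1
      obtain ⟨c, hc, d, hd, rfl⟩ := h2
      exact ⟨a + c, add_mem ha hc, b + d, add_mem hb hd, by abel⟩
    | smul r y _ h1 =>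
      obtain ⟨a, ha, b, hb, rfl⟩ := h1
      rcases le_total 0 r with hr | hr
      · exact ⟨r • a, PointedCone.smul_mem τ.1 hr ha, r • b, PointedCone.smul_mem τ.1 hr hb, smul_sub _ _ _⟩
      · refine ⟨(-r) • b, PointedCone.smul_mem τ.1 (by linarith) hb, (-r) • a,
          PointedCone.smul_mem τ.1 (by linarith) ha, ?_⟩
        module
  obtain ⟨a, ha, b, hb, rfl⟩ := key x hx'
  exact (Fan.Cone.isFaceOf h).mem_of_add_mem_left hx (h hb) (by simpa using ha)

/-- `τ` is a facet (a face of codimension one) of `σ`. -/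
structure IsFacet (τ σ : Δ.Cone) : Prop where
  le : τ ≤ σ
  finrank_eq : Module.finrank ℝ τ.lin + 1 = Module.finrank ℝ σ.lin

theorem Fan.Cone.finrank_lt [FiniteDimensional ℝ V] {τ σ : Δ.Cone} (h : τ < σ) :
    Module.finrank ℝ τ.lin < Module.finrank ℝ σ.lin := by
  refine Submodule.finrank_lt_finrank_of_lt (lt_of_le_of_ne (Fan.Cone.lin_mono h.le) ?_)
  intro he
  refine h.not_ge fun x hx => Fan.Cone.mem_of_mem_lin h.le hx ?_
  rw [he]
  exact σ.subset_lin hx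

theorem IsFacet.lt {τ σ : Δ.Cone} (hτ : IsFacet τ σ) : τ < σ := by
  refine lt_of_le_of_ne hτ.le ?_
  rintro rfl
  have := hτ.finrank_eq
  omega

theorem IsFacet.eq_of_le_of_lt [FiniteDimensional ℝ V] {τ σ γ : Δ.Cone} (hτ : IsFacet τ σ)
    (h1 : τ ≤ γ) (h2 : γ < σ) : γ = τ := by
  by_contra hne
  have h3 := Fan.Cone.finrank_lt (lt_of_le_of_ne h1 (Ne.symm hne))
  have h4 := Fan.Cone.finrank_lt h2
  have := hτ.finrank_eq
  omega

/-- A linear form `h` on `V_σ` with kernel `V_τ`, for a facet `τ` of `σ`, together with a vector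
`n` of `σ` with `h n = 1`. -/
structure FacetNormal (τ σ : Δ.Cone) where
  form : Module.Dual ℝ σ.lin
  vec : σ.lin
  ker_form : ∀ v : σ.lin, form v = 0 ↔ (v : V) ∈ τ.lin
  vec_mem : (vec : V) ∈ σ.1
  form_vec : form vec = 1

theorem IsFacet.nonempty_facetNormal [FiniteDimensional ℝ V] {τ σ : Δ.Cone}
    (hτ : IsFacet τ σ) : Nonempty (FacetNormal τ σ) := by
  obtain ⟨n, hnσ, hnτ⟩ : ∃ n ∈ σ.1, n ∉ τ.1 := by
    by_contra! hc
    exact hτ.lt.not_ge hc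
  have hn : n ∉ τ.lin := fun hn => hnτ (Fan.Cone.mem_of_mem_lin hτ.le hnσ hn)
  let W : Submodule ℝ σ.lin := τ.lin.comap σ.lin.subtype
  let n' : σ.lin := ⟨n, σ.subset_lin hnσ⟩
  have hn' : n' ∉ W := hn
  obtain ⟨f, hf, hfW⟩ := Submodule.exists_le_ker_of_notMem hn'
  have hfin : Module.finrank ℝ W = Module.finrank ℝ τ.lin :=
    (Submodule.comapSubtypeEquivOfLe (Fan.Cone.lin_mono hτ.le)).finrank_eq
  have hker : W = LinearMap.ker f := by
    apply Submodule.eq_of_le_of_finrank_le hfW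
    have h1 := LinearMap.finrank_range_add_finrank_ker f
    have h2 : 0 < Module.finrank ℝ (LinearMap.range f) := by
      rw [Module.finrank_pos_iff]
      refine ⟨⟨⟨f n', n', rfl⟩, 0, fun h => hf (congrArg Subtype.val h)⟩⟩
    have := hτ.finrank_eq
    omega
  refine ⟨⟨(f n')⁻¹ • f, n', fun v => ?_, hnσ, ?_⟩⟩
  · have : f v = 0 ↔ v ∈ W := by rw [hker]; rfl
    rw [LinearMap.smul_apply, smul_eq_mul, mul_eq_zero, or_iff_right (inv_ne_zero hf), this]
    rfl
  · simp [hf]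

/-- A choice of an orientation of each cone (that is, of its linear span). -/
abbrev ConeOrientations (Δ : Fan V) : Type u :=
  ∀ σ : Δ.Cone, Orientation ℝ σ.lin (Fin (Module.finrank ℝ σ.lin))

open Classical in
/-- The transition coefficient `±1` of a facet `τ` of `σ`: it is `1` if the orientation of `σ`
induces that of `τ`, in the sense that contracting a form positive on `σ` with a vector pointing
from `τ` into `σ` gives a form that is positive on `τ`. -/
def transitionSign (o : ConeOrientations Δ) {τ σ : Δ.Cone} (hτ : IsFacet τ σ)
    (N : FacetNormal τ σ) : ℝ :=
  if ∃ (ω : DetDual σ.lin) (h : ω ≠ 0)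
      (h' : contract (Fan.Cone.lin_mono hτ.le) hτ.finrank_eq N.vec ω ≠ 0),
      rayOfNeZero ℝ ω h = o σ ∧ rayOfNeZero ℝ _ h' = o τ
  then 1 else -1

/-- Descending chains of cones from `σ` to `τ`, each cone being a facet of the preceding one. -/
inductive FacetChain (Δ : Fan V) : Δ.Cone → Δ.Cone → Type u
  | refl (σ : Δ.Cone) : FacetChain Δ σ σ
  | step {σ τ γ : Δ.Cone} (h : IsFacet τ σ) (c : FacetChain Δ τ γ) : FacetChain Δ σ γ

theorem FacetChain.le {σ τ : Δ.Cone} (c : FacetChain Δ σ τ) : τ ≤ σ := by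
  induction c with
  | refl σ => exact le_rfl
  | step h _ ih => exact ih.trans h.le

end Cones

/-! ### Sheaves of graded modules on a fan -/

/-- A family of modules `M σ` over the polynomial algebras `A_σ = S(V_σ^*)`, with a family of
subgroups `gr σ k` (the prospective homogeneous components), and with restriction maps `M σ → M τ`
for `τ ≤ σ` that are linear along `A_σ → A_τ`. It is a sheaf of graded modules on the fan space if
it satisfies `IsGradedSheaf` below. -/
structure ConeSystem {V : Type u} [AddCommGroup V] [Module ℝ V] (Δ : Fan V) where
  M : Δ.Cone → Type w
  [addCommGroup : ∀ σ, AddCommGroup (M σ)]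
  [module : ∀ σ, Module (Poly σ.lin) (M σ)]
  gr : ∀ σ, ℤ → AddSubgroup (M σ)
  res : ∀ {τ σ : Δ.Cone}, τ ≤ σ → M σ →+ M τ
  res_smul : ∀ {τ σ : Δ.Cone} (h : τ ≤ σ) (a : Poly σ.lin) (x : M σ),
    res h (a • x) = polyRes (Fan.Cone.lin_mono h) a • res h x

attribute [instance] ConeSystem.addCommGroup ConeSystem.module

namespace ConeSystem

variable {V : Type u} [AddCommGroup V] [Module ℝ V] {Δ : Fan V}

/-- The system is a sheaf of graded modules over the sheaf of piecewise polynomial functions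
(given through its sections on the affine fans `⟨σ⟩`). -/
structure IsGradedSheaf (F : ConeSystem.{u, w} Δ) : Prop where
  res_self : ∀ (σ : Δ.Cone) (x : F.M σ), F.res (le_refl σ) x = x
  res_res : ∀ {γ τ σ : Δ.Cone} (h : τ ≤ σ) (h' : γ ≤ τ) (x : F.M σ),
    F.res h' (F.res h x) = F.res (h'.trans h) x
  isInternal : ∀ σ, DirectSum.IsInternal (F.gr σ)
  smul_mem : ∀ (σ : Δ.Cone) (i j : ℤ) (a : Poly σ.lin) (x : F.M σ),
    a ∈ polyGr σ.lin i → x ∈ F.gr σ j → a • x ∈ F.gr σ (i + j)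
  res_mem : ∀ {τ σ : Δ.Cone} (h : τ ≤ σ) (i : ℤ) (x : F.M σ),
    x ∈ F.gr σ i → F.res h x ∈ F.gr τ i

/-- The sections over a subfan `Λ`. -/
def Sections (F : ConeSystem.{u, w} Δ) (Λ : LowerSet Δ.Cone) : Type (max u w) :=
  {s : ∀ σ : Λ, F.M σ.1 // ∀ (σ τ : Λ) (h : τ.1 ≤ σ.1), F.res h (s σ) = s τ}

/-- Restriction of sections to a smaller subfan. -/
def Sections.restrict {F : ConeSystem.{u, w} Δ} {Λ' Λ : LowerSet Δ.Cone} (h : Λ' ≤ Λ)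
    (s : F.Sections Λ) : F.Sections Λ' :=
  ⟨fun σ => s.1 ⟨σ.1, h σ.2⟩, fun σ τ hτ => s.2 ⟨σ.1, h σ.2⟩ ⟨τ.1, h τ.2⟩ hτ⟩

/-- Flabbiness: every section over a subfan extends to the whole fan. -/
def IsFlabby (F : ConeSystem.{u, w} Δ) : Prop :=
  ∀ Λ : LowerSet Δ.Cone,
    Function.Surjective (Sections.restrict (le_top : Λ ≤ ⊤) : F.Sections ⊤ → F.Sections Λ)

/-- A perverse sheaf: a flabby sheaf of graded modules whose modules of sections on the affine fans
are finitely generated and free. -/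
structure IsPerverse (F : ConeSystem.{u, w} Δ) : Prop where
  isGradedSheaf : F.IsGradedSheaf
  isFlabby : F.IsFlabby
  finite : ∀ σ, Module.Finite (Poly σ.lin) (F.M σ)
  free : ∀ σ, Module.Free (Poly σ.lin) (F.M σ)

/-- The submodule `F_(σ, ∂σ)` of the sections on `⟨σ⟩` that vanish on the boundary. -/
def relSections (F : ConeSystem.{u, w} Δ) (σ : Δ.Cone) : Submodule (Poly σ.lin) (F.M σ) where
  carrier := {x | ∀ (τ : Δ.Cone) (h : τ < σ), F.res h.le x = 0}
  zero_mem' := fun τ h => map_zero _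
  add_mem' := fun {x y} hx hy τ h => by rw [map_add, hx τ h, hy τ h, add_zero]
  smul_mem' := fun a x hx τ h => by rw [F.res_smul, hx τ h, smul_zero]

/-! ### The dual sheaf -/

/-- `ĝ`, a section over `⟨σ⟩`, extends the trivial extension to `∂σ` of the section `g`
over `⟨τ⟩`. -/
structure IsExtension (F : ConeSystem.{u, w} Δ) {τ σ : Δ.Cone} (h : τ ≤ σ) (g : F.M τ)
    (g' : F.M σ) : Prop where
  res_eq : F.res h g' = g
  res_eq_zero : ∀ (γ : Δ.Cone) (hγ : γ < σ), ¬ γ ≤ τ → F.res hγ.le g' = 0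

theorem exists_isExtension [FiniteDimensional ℝ V] {F : ConeSystem.{u, w} Δ}
    (hF : F.IsPerverse) {τ σ : Δ.Cone} (hτ : IsFacet τ σ) (g : F.relSections τ) :
    ∃ g' : F.M σ, F.IsExtension hτ.le g.1 g' := by
  classical
  have hS := hF.isGradedSheaf
  let s : F.Sections (LowerSet.Iio σ) :=
    ⟨fun γ => if h : γ.1 ≤ τ then F.res h g.1 else 0, by
      rintro ⟨γ, hγ⟩ ⟨γ', hγ'⟩ h
      by_cases h1 : γ ≤ τ
      · simp only [dif_pos h1, dif_pos (le_trans h h1), hS.res_res]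
      · simp only [dif_neg h1, map_zero]
        by_cases h2 : γ' ≤ τ
        · rw [dif_pos h2]
          have h3 : γ' < τ := by
            refine lt_of_le_of_ne h2 ?_
            rintro rfl
            exact h1 (hτ.eq_of_le_of_lt h hγ).le
          exact (g.2 γ' h3).symm
        · rw [dif_neg h2]⟩
  obtain ⟨t, ht⟩ := hF.isFlabby _ s
  have key : ∀ (γ : Δ.Cone) (hγ : γ < σ),
      F.res hγ.le (t.1 ⟨σ, trivial⟩) = if h : γ ≤ τ then F.res h g.1 else 0 := by
    intro γ hγ
    rw [t.2 ⟨σ, trivial⟩ ⟨γ, trivial⟩ hγ.le]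
    exact congrFun (congrArg Subtype.val ht) ⟨γ, hγ⟩
  refine ⟨t.1 ⟨σ, trivial⟩, ?_, ?_⟩
  · rw [key τ hτ.lt, dif_pos le_rfl, hS.res_self]
  · intro γ hγ h
    rw [key γ hγ, dif_neg h]

theorem form_smul_mem {F : ConeSystem.{u, w} Δ} {τ σ : Δ.Cone}
    (hτ : IsFacet τ σ) (N : FacetNormal τ σ) {g : F.M τ} {g' : F.M σ}
    (hg : F.IsExtension hτ.le g g') :
    SymmetricAlgebra.ι ℝ (Module.Dual ℝ σ.lin) N.form • g' ∈ F.relSections σ := by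
  intro γ hγ
  rw [F.res_smul]
  by_cases h : γ ≤ τ
  · have : (Submodule.inclusion (Fan.Cone.lin_mono hγ.le)).dualMap N.form = 0 := by
      ext v
      exact (N.ker_form _).mpr (Fan.Cone.lin_mono h v.2)
    rw [polyRes_ι, this, map_zero, zero_smul]
  · rw [hg.res_eq_zero γ hγ h, smul_zero]

theorem polyRes_form {τ σ : Δ.Cone} (hτ : τ ≤ σ) (N : FacetNormal τ σ) :
    polyRes (Fan.Cone.lin_mono hτ) (SymmetricAlgebra.ι ℝ (Module.Dual ℝ σ.lin) N.form) = 0 := by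
  have : (Submodule.inclusion (Fan.Cone.lin_mono hτ)).dualMap N.form = 0 := by
    ext v
    exact (N.ker_form _).mpr v.2
  rw [polyRes_ι, this, map_zero]

/-- `Hom(F_(σ, ∂σ), A_σ)`. -/
abbrev HomRel (F : ConeSystem.{u, w} Δ) (σ : Δ.Cone) : Type (max u w) :=
  F.relSections σ →ₗ[Poly σ.lin] Poly σ.lin

/-- The value `f(h ĝ)|_τ` does not depend on the extension `ĝ` of `g`. -/
theorem value_unique {F : ConeSystem.{u, w} Δ} (hF : F.IsPerverse) {τ σ : Δ.Cone}
    (hτ : IsFacet τ σ) (N : FacetNormal τ σ) (f : F.HomRel σ) {g : F.M τ} {g' g'' : F.M σ}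
    (hg' : F.IsExtension hτ.le g g') (hg'' : F.IsExtension hτ.le g g'') :
    polyRes (Fan.Cone.lin_mono hτ.le) (f ⟨_, form_smul_mem hτ N hg'⟩) =
      polyRes (Fan.Cone.lin_mono hτ.le) (f ⟨_, form_smul_mem hτ N hg''⟩) := by
  have hd : g' - g'' ∈ F.relSections σ := by
    intro γ hγ
    rw [map_sub]
    by_cases h : γ ≤ τ
    · rw [← hF.isGradedSheaf.res_res hτ.le h, ← hF.isGradedSheaf.res_res hτ.le h, hg'.res_eq,
        hg''.res_eq, sub_self]
    · rw [hg'.res_eq_zero γ hγ h, hg''.res_eq_zero γ hγ h, sub_self]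
  have he : (⟨_, form_smul_mem hτ N hg'⟩ : F.relSections σ) =
      ⟨_, form_smul_mem hτ N hg''⟩ +
        SymmetricAlgebra.ι ℝ (Module.Dual ℝ σ.lin) N.form • ⟨g' - g'', hd⟩ := by
    apply Subtype.ext
    simp only [Submodule.coe_add, Submodule.coe_smul, smul_sub]
    abel
  rw [he, map_add, map_smul, map_add, smul_eq_mul, map_mul, polyRes_form hτ.le N, zero_mul,
    add_zero]

variable [FiniteDimensional ℝ V]

/-- The map `φ_h : Hom(F_(σ, ∂σ), A_σ) → Hom(F_(τ, ∂τ), A_τ)`, for a facet `τ` of `σ` and a linear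
form `h` on `V_σ` with kernel `V_τ`: `φ_h(f)` sends `g` to `f(h ĝ)|_τ`, where `ĝ` extends the
trivial extension of `g` to `∂σ`. -/
def phi {F : ConeSystem.{u, w} Δ} (hF : F.IsPerverse) {τ σ : Δ.Cone}
    (hτ : IsFacet τ σ) (N : FacetNormal τ σ) : F.HomRel σ →ₗ[ℝ] F.HomRel τ where
  toFun f :=
    { toFun := fun g => polyRes (Fan.Cone.lin_mono hτ.le)
        (f ⟨_, form_smul_mem hτ N (exists_isExtension hF hτ g).choose_spec⟩)
      map_add' := fun g₁ g₂ => by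
        have e₁ := (exists_isExtension hF hτ g₁).choose_spec
        have e₂ := (exists_isExtension hF hτ g₂).choose_spec
        have e : F.IsExtension hτ.le (g₁ + g₂).1
            ((exists_isExtension hF hτ g₁).choose + (exists_isExtension hF hτ g₂).choose) :=
          ⟨by rw [map_add, e₁.res_eq, e₂.res_eq]; rfl, fun γ hγ h => by
            rw [map_add, e₁.res_eq_zero γ hγ h, e₂.res_eq_zero γ hγ h, add_zero]⟩
        rw [value_unique hF hτ N f (exists_isExtension hF hτ (g₁ + g₂)).choose_spec e,
          ← map_add, ← map_add]
        congr 2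
        apply Subtype.ext
        exact (smul_add _ _ _).trans rfl
      map_smul' := fun a g => by
        obtain ⟨b, rfl⟩ := polyRes_surjective (Fan.Cone.lin_mono hτ.le) a
        have e₁ := (exists_isExtension hF hτ g).choose_spec
        have e : F.IsExtension hτ.le
            (polyRes (Fan.Cone.lin_mono hτ.le) b • g).1 (b • (exists_isExtension hF hτ g).choose) :=
          ⟨by rw [F.res_smul, e₁.res_eq]; rfl, fun γ hγ h => by
            rw [F.res_smul, e₁.res_eq_zero γ hγ h, smul_zero]⟩
        rw [value_unique hF hτ N f (exists_isExtension hF hτ _).choose_spec e,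
          RingHom.id_apply, smul_eq_mul, ← map_mul, ← smul_eq_mul, ← map_smul]
        congr 2
        apply Subtype.ext
        exact smul_comm _ _ _ }
  map_add' f₁ f₂ := by
    ext g
    exact map_add (polyRes (Fan.Cone.lin_mono hτ.le)) _ _
  map_smul' c f := by
    ext g
    exact map_smul (polyRes (Fan.Cone.lin_mono hτ.le)) c _

/-- `(DF)_σ = Hom(F_(σ, ∂σ), A_σ) ⊗ det V_σ^*`. -/
abbrev DualStalk (F : ConeSystem.{u, w} Δ) (σ : Δ.Cone) : Type (max u w) :=
  F.HomRel σ ⊗[ℝ] DetDual σ.lin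

/-- The homomorphisms `F_(σ, ∂σ) → A_σ` of degree `j`. -/
def homGr (F : ConeSystem.{u, w} Δ) (σ : Δ.Cone) (j : ℤ) : Set (F.HomRel σ) :=
  {f | ∀ (i : ℤ) (x : F.relSections σ), x.1 ∈ F.gr σ i → f x ∈ polyGr σ.lin (i + j)}

/-- The grading of `(DF)_σ`: the line `det V_σ^*` has degree `2 dim σ`. -/
def dualGr (F : ConeSystem.{u, w} Δ) (σ : Δ.Cone) (k : ℤ) : AddSubgroup (F.DualStalk σ) :=
  AddSubgroup.closure {z | ∃ f ∈ F.homGr σ (k - 2 * (Module.finrank ℝ σ.lin : ℤ)),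
    ∃ ω : DetDual σ.lin, z = f ⊗ₜ[ℝ] ω}

/-- The restriction map `(DF)_σ → (DF)_τ` to a facet `τ` of `σ`: the transition coefficient times
the map `φ_h ⊗ ψ_h`, with `ψ_h (h ∧ η) = η|_τ`, where `h` is any linear form on `V_σ` with kernel
`V_τ`. -/
def dualFacetRes {F : ConeSystem.{u, w} Δ} (hF : F.IsPerverse) (o : ConeOrientations Δ)
    {τ σ : Δ.Cone} (hτ : IsFacet τ σ) : F.DualStalk σ →ₗ[ℝ] F.DualStalk τ :=
  let N : FacetNormal τ σ := hτ.nonempty_facetNormal.some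
  transitionSign o hτ N •
    TensorProduct.map (phi hF hτ N) (contract (Fan.Cone.lin_mono hτ.le) hτ.finrank_eq N.vec)

theorem dualFacetRes_smul {F : ConeSystem.{u, w} Δ} (hF : F.IsPerverse)
    (o : ConeOrientations Δ) {τ σ : Δ.Cone} (hτ : IsFacet τ σ) (a : Poly σ.lin)
    (x : F.DualStalk σ) :
    dualFacetRes hF o hτ (a • x) =
      polyRes (Fan.Cone.lin_mono hτ.le) a • dualFacetRes hF o hτ x := by
  induction x using TensorProduct.induction_on with
  | zero => simp
  | add x y hx hy => rw [smul_add, map_add, hx, hy, map_add, smul_add]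
  | tmul f ω =>
    have key : ∀ N : FacetNormal τ σ, phi hF hτ N (a • f) =
        polyRes (Fan.Cone.lin_mono hτ.le) a • phi hF hτ N f := fun N => by
      ext g
      exact map_mul (polyRes (Fan.Cone.lin_mono hτ.le)) _ _
    simp only [dualFacetRes, LinearMap.smul_apply, TensorProduct.smul_tmul', TensorProduct.map_tmul,
      key]
    rw [smul_comm]

/-- The composition of the restriction maps along a chain of facets. -/
def dualChainRes {F : ConeSystem.{u, w} Δ} (hF : F.IsPerverse) (o : ConeOrientations Δ) :
    {σ τ : Δ.Cone} → FacetChain Δ σ τ → (F.DualStalk σ →ₗ[ℝ] F.DualStalk τ)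
  | _, _, .refl _ => LinearMap.id
  | _, _, .step h c => dualChainRes hF o c ∘ₗ dualFacetRes hF o h

theorem dualChainRes_smul {F : ConeSystem.{u, w} Δ} (hF : F.IsPerverse)
    (o : ConeOrientations Δ) {σ τ : Δ.Cone} (c : FacetChain Δ σ τ) (a : Poly σ.lin)
    (x : F.DualStalk σ) :
    dualChainRes hF o c (a • x) =
      polyRes (Fan.Cone.lin_mono c.le) a • dualChainRes hF o c x := by
  induction c with
  | refl σ => rw [polyRes_self]; rfl
  | step h c ih =>
    simp only [dualChainRes, LinearMap.comp_apply]
    rw [dualFacetRes_smul, ih, polyRes_polyRes]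

open Classical in
/-- The dual sheaf `DF` of a perverse sheaf `F`, for given orientations of the cones. For `τ ≤ σ`
the restriction map is the composition of the facet restriction maps along a chain of facets from
`σ` to `τ` (such a chain always exists). -/
def dual {F : ConeSystem.{u, w} Δ} (hF : F.IsPerverse) (o : ConeOrientations Δ) :
    ConeSystem.{u, max u w} Δ where
  M := F.DualStalk
  gr := F.dualGr
  res {τ σ} _ := if hc : Nonempty (FacetChain Δ σ τ) then
    (dualChainRes hF o hc.some).toAddMonoidHom else 0
  res_smul {τ σ} h a x := by
    by_cases hc : Nonempty (FacetChain Δ σ τ)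
    · simp only [dif_pos hc]
      exact dualChainRes_smul hF o hc.some a x
    · simp only [dif_neg hc, AddMonoidHom.zero_apply, smul_zero]

end ConeSystem

end FanDuality

end

open scoped TensorProduct

noncomputable section

namespace FanDuality

universe u w

/-! ### Convex geometry of the cones of a fan -/

section Halfspaces

variable {V : Type u} [AddCommGroup V] [Module ℝ V]

/-! Everything is reduced to facets, and the facets are handled by line shellings. A generic line
crosses the hyperplanes of the facets of `σ` in some order, and each facet `τ` meets its
predecessors in the part of `∂τ` visible from a point of `V_τ` (`IsVisible.exists_isShelling`).
Visible parts of boundaries can therefore be treated by induction on the dimension, the whole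
boundary being one of them.

Freeness. Let `F_S` be the sections over `⟨σ⟩` vanishing on a set `S` of facets. If `S` consists of
the predecessors of `τ`, flabbiness gives an exact sequence `0 → F_{S ∪ τ} → F_S → N → 0`, where `N`
is the module of sections over `⟨τ⟩` that vanish on a visible part of `∂τ`. By induction `N` is
projective over `A_τ = A_σ/(h)`, so it has projective dimension at most one over `A_σ`, and `F_{S ∪
τ}` is projective whenever `F_S` is (`finite_projective_ker_of_quotient`). Hence `F_(σ, ∂σ)` is
finitely generated projective. A graded Nakayama argument gives it a homogeneous basis
(`exists_homogeneous_basis`), whence the freeness and the grading of the dual stalks.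

Independence of the chain. Positive volume forms identify `(DF)_σ` with `Hom(F_(σ, ∂σ), A_σ)` and
turn the restriction to a facet into a positive multiple of `φ_h`. For the two facets between `σ`
and a face `η` of codimension two, both compositions send `f` to a multiple of `g ↦ f(h h' ĝ)|_η`.
The two contractions of volume forms anticommute up to positive factors, and the transition signs
compensate exactly this sign (`facetRes_comm`). Shellings connect any two chains by such exchanges
(`dualChainRes_eq`).

Flabbiness. It suffices to extend a section over `∂σ` to `σ`, that is, to find a functional with
given restrictions to the facets. Facets are corrected one at a time in descending shelling order.
The correction at `τ` comes from the connecting map of the sequence above, and it does not disturb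
the facets that come later (`exists_functional_facet`, `exists_functional_of_compatible`). -/

theorem fourierMotzkin {ι : Type*} (L : Finset ι) (a b : ι → ℝ)
    (h1 : ∀ i ∈ L, 0 ≤ b i → 0 ≤ a i)
    (h2 : ∀ i ∈ L, ∀ j ∈ L, 0 < b i → b j < 0 → 0 ≤ b i * a j - b j * a i) :
    ∃ t : ℝ, 0 ≤ t ∧ ∀ i ∈ L, 0 ≤ a i - t * b i := by
  classical
  -- The conditions with `b j < 0` bound `t` from below by `a j / b j`; the least admissible `t` is
  -- the maximum of these bounds and `0`.
  obtain ⟨t, ht, hmax⟩ := Finset.exists_max_image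
    (insert 0 ((L.filter fun j => b j < 0).image fun j => a j / b j)) id ⟨0, by simp⟩
  have h0 : 0 ≤ t := hmax 0 (by simp)
  have hlow : ∀ j ∈ L, b j < 0 → a j / b j ≤ t := fun j hj hb =>
    hmax (a j / b j) (Finset.mem_insert_of_mem
      (Finset.mem_image_of_mem (fun j => a j / b j) (by simp [hj, hb])))
  refine ⟨t, h0, fun i hi => ?_⟩
  rcases lt_trichotomy (b i) 0 with hb | hb | hb
  · have := hlow i hi hb
    rw [div_le_iff_of_neg hb] at this
    linarith
  · have := h1 i hi hb.ge
    rw [hb]; linarith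
  · rcases Finset.mem_insert.mp ht with rfl | ht
    · have := h1 i hi hb.le
      simpa using this
    · obtain ⟨j, hj, rfl⟩ := Finset.mem_image.mp ht
      simp only [Finset.mem_filter] at hj
      have h := h2 i hi j hj.1 hb hj.2
      have h3 : b j * (a i - a j / b j * b i) ≤ 0 := by
        have : b j * (a i - a j / b j * b i) = b j * a i - b i * a j := by
          field_simp [hj.2.ne]
        linarith
      by_contra hneg
      push Not at hneg
      have := mul_pos_of_neg_of_neg hj.2 hneg
      linarith

/-- A finitely generated cone in a finite-dimensional space is a finite intersection of
half-spaces. -/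
theorem exists_halfspaces_of_fg [FiniteDimensional ℝ V] {C : PointedCone ℝ V} (hC : C.FG) :
    ∃ L : Finset (Module.Dual ℝ V), ∀ x, x ∈ C ↔ ∀ l ∈ L, 0 ≤ l x := by
  classical
  obtain ⟨S, rfl⟩ := hC
  induction S using Finset.induction_on with
  | empty =>
    let b := Module.finBasis ℝ V
    refine ⟨Finset.univ.image b.coord ∪ Finset.univ.image fun i => -b.coord i, fun x => ?_⟩
    simp only [Finset.coe_empty, Submodule.span_empty, Submodule.mem_bot]
    constructor
    · rintro rfl
      simp
    · intro h
      refine b.ext_elem fun i => ?_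
      have h1 := h (b.coord i) (Finset.mem_union_left _ (Finset.mem_image_of_mem _ (by simp)))
      have h2 := h (-b.coord i) (Finset.mem_union_right _
        (Finset.mem_image_of_mem (fun i => -b.coord i) (Finset.mem_univ i)))
      simp only [LinearMap.neg_apply, Module.Basis.coord_apply] at h1 h2
      simp only [map_zero, Finsupp.coe_zero, Pi.zero_apply]
      linarith
  | insert v S _ ih =>
    obtain ⟨L, hL⟩ := ih
    -- Elimination of `t` from the inequalities `l (x - t • v) ≥ 0`: those with `l v ≥ 0` survive at
    -- `t = 0`, and each pair of opposite signs at `v` contributes its positive combination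
    -- vanishing at `v`.
    refine ⟨(L.filter fun l => 0 ≤ l v) ∪ ((L ×ˢ L).filter fun p => 0 < p.1 v ∧ p.2 v < 0).image
      fun p => p.1 v • p.2 - p.2 v • p.1, fun x => ?_⟩
    have hx : x ∈ Submodule.span {c : ℝ // 0 ≤ c} (insert v S : Finset V) ↔
        ∃ t : ℝ, 0 ≤ t ∧ ∀ l ∈ L, 0 ≤ l x - t * l v := by
      rw [Finset.coe_insert, Submodule.span_insert, Submodule.mem_sup]
      constructor
      · rintro ⟨y, hy, z, hz, rfl⟩
        obtain ⟨t, rfl⟩ := Submodule.mem_span_singleton.mp hy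
        refine ⟨t, t.2, fun l hl => ?_⟩
        have h1 := (hL z).mp hz l hl
        have h2 : l (t • v) = t.1 * l v := l.map_smul t.1 v
        rw [map_add, h2]
        linarith
      · rintro ⟨t, ht, h⟩
        refine ⟨(⟨t, ht⟩ : {c : ℝ // 0 ≤ c}) • v,
          Submodule.mem_span_singleton.mpr ⟨_, rfl⟩, x - t • v, (hL _).mpr fun l hl => ?_, ?_⟩
        · rw [map_sub, map_smul]
          exact h l hl
        · change t • v + (x - t • v) = x
          abel
    rw [hx]
    constructor
    · rintro ⟨t, ht, h⟩ l hl
      rcases Finset.mem_union.mp hl with hl | hl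
      · rw [Finset.mem_filter] at hl
        have := h l hl.1
        have := mul_nonneg ht hl.2
        linarith
      · obtain ⟨⟨l1, l2⟩, hp, rfl⟩ := Finset.mem_image.mp hl
        simp only [Finset.mem_filter, Finset.mem_product] at hp
        obtain ⟨⟨m1, m2⟩, p1, p2⟩ := hp
        have e1 := mul_nonneg p1.le (h l2 m2)
        have e2 := mul_nonneg (neg_pos.mpr p2).le (h l1 m1)
        simp only [LinearMap.sub_apply, LinearMap.smul_apply, smul_eq_mul]
        nlinarith
    · intro h
      refine fourierMotzkin L (fun l => l x) (fun l => l v) (fun l hl hv => ?_)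
        (fun l hl l' hl' h1 h2 => ?_)
      · exact h l (Finset.mem_union_left _ (Finset.mem_filter.mpr ⟨hl, hv⟩))
      · exact h _ (Finset.mem_union_right _ (Finset.mem_image.mpr
          ⟨(l, l'), Finset.mem_filter.mpr ⟨Finset.mem_product.mpr ⟨hl, hl'⟩, h1, h2⟩, rfl⟩))

/-- A cone contains a vector at which finitely many given functionals, none of which vanishes on
the cone, are all different from zero. -/
theorem exists_forall_apply_ne_zero (C : PointedCone ℝ V) {ι : Type*} (s : Finset ι)
    (f : ι → Module.Dual ℝ V) (h : ∀ i ∈ s, ∃ x ∈ C, f i x ≠ 0) :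
    ∃ u ∈ C, ∀ i ∈ s, f i u ≠ 0 := by
  classical
  induction s using Finset.induction_on with
  | empty => exact ⟨0, zero_mem _, by simp⟩
  | insert j s _ ih =>
    obtain ⟨u, hu, hu'⟩ := ih fun i hi => h i (Finset.mem_insert_of_mem hi)
    obtain ⟨x, hx, hx'⟩ := h j (Finset.mem_insert_self j s)
    -- Where `f i x ≠ 0`, only one value of `t` annihilates `f i (u + t • x)`. Where `f i x = 0`,
    -- the value at `u` remains.
    obtain ⟨t, ht, hts⟩ : ∃ t ∈ Set.Ioi (0 : ℝ),
        t ∉ (insert j s).image fun i => -(f i u) / f i x :=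
      (Set.Ioi_infinite (0 : ℝ)).exists_notMem_finset _
    refine ⟨u + t • x, add_mem hu (PointedCone.smul_mem C (le_of_lt ht) hx), fun i hi h0 => ?_⟩
    rw [map_add, map_smul, smul_eq_mul] at h0
    by_cases hix : f i x = 0
    · rcases Finset.mem_insert.mp hi with rfl | hi
      · exact hx' hix
      · rw [hix, mul_zero, add_zero] at h0
        exact hu' i hi h0
    · refine hts (Finset.mem_image.mpr ⟨i, hi, ?_⟩)
      field_simp
      linarith

theorem exists_forall_nonneg_add_mul {ι : Type*} (s : Finset ι) (a b : ι → ℝ) :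
    ∃ N : ℝ, 0 ≤ N ∧ ∀ i ∈ s, 0 < b i → 0 ≤ a i + N * b i := by
  classical
  obtain ⟨N, hN⟩ := ((insert 0 (s.image fun i => -(a i) / b i)) : Finset ℝ).bddAbove
  refine ⟨N, hN (by simp), fun i hi hb => ?_⟩
  have : -(a i) / b i ≤ N := hN (by
    simp only [Finset.coe_insert, Finset.coe_image]
    exact Or.inr ⟨i, hi, rfl⟩)
  rw [div_le_iff₀ hb] at this
  linarith

end Halfspaces

/-! ### Facets: their linear forms, and faces as intersections of facets -/

section Facets

variable {V : Type u} [AddCommGroup V] [Module ℝ V] {Δ : Fan V}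

instance : Finite Δ.Cone := Δ.finite

theorem exists_dual_of_not_le (σ : Δ.Cone) {W : Submodule ℝ V} (hW : ¬ σ.lin ≤ W) :
    ∃ f : Module.Dual ℝ V, (∀ x ∈ W, f x = 0) ∧ ∃ x ∈ σ.1, f x ≠ 0 := by
  obtain ⟨x, hx, hxW⟩ : ∃ x ∈ σ.1, x ∉ W := by
    by_contra! h
    exact hW (Submodule.span_le.mpr h)
  obtain ⟨f, hf, hfW⟩ := Submodule.exists_le_ker_of_notMem hxW
  exact ⟨f, hfW, x, hx, hf⟩

/-- The face of a cone cut out by a nonnegative functional. -/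
theorem exists_cone_inf_ker (σ : Δ.Cone) (l : Module.Dual ℝ V) (hl : ∀ x ∈ σ.1, 0 ≤ l x) :
    ∃ ρ : Δ.Cone, ρ ≤ σ ∧ ∀ x ∈ σ.1, x ∈ ρ.1 ↔ l x = 0 := by
  let ρ : PointedCone ℝ V := σ.1 ⊓ PointedCone.ofSubmodule (LinearMap.ker l)
  have hρ : ρ.IsFaceOf σ.1 := by
    refine ⟨inf_le_left, ?_⟩
    intro x y a hx hy ha hxy
    refine ⟨hx, ?_⟩
    have h1 : l (a • x + y) = 0 := hxy.2
    have h2 := hl x hx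
    have h3 := hl y hy
    rw [map_add, map_smul, smul_eq_mul] at h1
    have h4 := mul_nonneg ha.le h2
    have h5 : a * l x = 0 := by linarith
    exact (mul_eq_zero.mp h5).resolve_left ha.ne'
  exact ⟨⟨ρ, Δ.face_mem _ σ.2 _ hρ⟩, fun _ hx => hx.1, fun x hx => ⟨fun h => h.2, fun h => ⟨hx, h⟩⟩⟩

variable [FiniteDimensional ℝ V]

/-- A linear form on `V`, nonnegative on the cone `σ`, whose restriction to `V_σ` has kernel `V_τ`,
for a facet `τ` of `σ`. -/
def IsFacet.form {τ σ : Δ.Cone} (hτ : IsFacet τ σ) : Module.Dual ℝ V :=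
  (LinearMap.exists_extend hτ.nonempty_facetNormal.some.form).choose

theorem IsFacet.form_coe {τ σ : Δ.Cone} (hτ : IsFacet τ σ) (x : σ.lin) :
    hτ.form x = hτ.nonempty_facetNormal.some.form x :=
  LinearMap.congr_fun (LinearMap.exists_extend hτ.nonempty_facetNormal.some.form).choose_spec x

theorem IsFacet.form_eq_zero_iff {τ σ : Δ.Cone} (hτ : IsFacet τ σ) {x : V} (hx : x ∈ σ.lin) :
    hτ.form x = 0 ↔ x ∈ τ.lin := by
  rw [hτ.form_coe ⟨x, hx⟩]
  exact hτ.nonempty_facetNormal.some.ker_form _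

theorem IsFacet.exists_form_eq_one {τ σ : Δ.Cone} (hτ : IsFacet τ σ) :
    ∃ n ∈ σ.1, hτ.form n = 1 :=
  ⟨_, hτ.nonempty_facetNormal.some.vec_mem, by
    rw [hτ.form_coe]; exact hτ.nonempty_facetNormal.some.form_vec⟩

theorem IsFacet.form_eq_zero_iff_mem {τ σ : Δ.Cone} (hτ : IsFacet τ σ) {x : V} (hx : x ∈ σ.1) :
    hτ.form x = 0 ↔ x ∈ τ.1 :=
  (hτ.form_eq_zero_iff (σ.subset_lin hx)).trans
    ⟨Fan.Cone.mem_of_mem_lin hτ.le hx, fun h => τ.subset_lin h⟩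

/-- A negative value at `x` could be cancelled by adding a positive multiple of some `n ∈ σ` with
value `1`. The sum would lie in `τ`, so `x` would too because `τ` is a face; but the form is zero on
`τ`. -/
theorem IsFacet.form_nonneg {τ σ : Δ.Cone} (hτ : IsFacet τ σ) {x : V} (hx : x ∈ σ.1) :
    0 ≤ hτ.form x := by
  by_contra! hneg
  obtain ⟨n, hn, hn1⟩ := hτ.exists_form_eq_one
  have hn' : (-hτ.form x) • n ∈ σ.1 := PointedCone.smul_mem σ.1 (by linarith) hn
  have h0 : hτ.form (x + (-hτ.form x) • n) = 0 := by
    rw [map_add, map_smul, hn1]; simp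
  have hm := (hτ.form_eq_zero_iff_mem (add_mem hx hn')).mp h0
  have := (Fan.Cone.isFaceOf hτ.le).mem_of_add_mem_left hx hn' hm
  rw [(hτ.form_eq_zero_iff_mem hx).mpr this] at hneg
  exact lt_irrefl _ hneg

theorem IsFacet.exists_apply_eq_apply_mul_form {τ σ : Δ.Cone} (hτ : IsFacet τ σ)
    (f : Module.Dual ℝ V) (h0 : ∀ x ∈ τ.lin, f x = 0) :
    ∃ n ∈ σ.1, ∀ x ∈ σ.lin, f x = f n * hτ.form x := by
  obtain ⟨n, hn, hn1⟩ := hτ.exists_form_eq_one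
  refine ⟨n, hn, fun x hx => ?_⟩
  have h1 : x - hτ.form x • n ∈ σ.lin :=
    sub_mem hx (Submodule.smul_mem _ _ (σ.subset_lin hn))
  have h2 : hτ.form (x - hτ.form x • n) = 0 := by
    rw [map_sub, map_smul, hn1]; simp
  have h3 := h0 _ ((hτ.form_eq_zero_iff h1).mp h2)
  rw [map_sub, map_smul, smul_eq_mul] at h3
  linarith

/-- A cone is the intersection of the half-spaces defined by its facets. -/
theorem mem_of_forall_form_nonneg {σ : Δ.Cone} {w : V} (hw : w ∈ σ.lin)
    (h : ∀ (τ : Δ.Cone) (hτ : IsFacet τ σ), 0 ≤ hτ.form w) : w ∈ σ.1 := by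
  classical
  have := Fintype.ofFinite Δ.Cone
  by_contra hwσ
  obtain ⟨L, hL⟩ := exists_halfspaces_of_fg (Δ.polyhedral _ σ.2)
  -- The vector `u` will be chosen outside every `V_ρ + ℝ w` that does not contain `V_σ`. The
  -- segment from `u` to `w` then cannot leave `σ` through a face of codimension at least two.
  let W : Δ.Cone → Submodule ℝ V := fun ρ => ρ.lin ⊔ Submodule.span ℝ {w}
  have hsel : ∀ ρ : Δ.Cone, ∃ f : Module.Dual ℝ V, ¬ σ.lin ≤ W ρ →
      (∀ x ∈ W ρ, f x = 0) ∧ ∃ x ∈ σ.1, f x ≠ 0 := fun ρ => by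
    by_cases hρ : σ.lin ≤ W ρ
    · exact ⟨0, fun h => absurd hρ h⟩
    · obtain ⟨f, hf⟩ := exists_dual_of_not_le σ hρ
      exact ⟨f, fun _ => hf⟩
  choose g hg using hsel
  let G : Module.Dual ℝ V ⊕ Δ.Cone → Module.Dual ℝ V := Sum.elim id g
  obtain ⟨u, hu, hune⟩ := exists_forall_apply_ne_zero σ.1
    ((L.filter fun l => ∃ x ∈ σ.1, l x ≠ 0).disjSum
      (Finset.univ.filter fun ρ => ¬ σ.lin ≤ W ρ)) G (by
    rintro (l | ρ) hi
    · exact (Finset.mem_filter.mp (Finset.inl_mem_disjSum.mp hi)).2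
    · exact (hg ρ (Finset.mem_filter.mp (Finset.inr_mem_disjSum.mp hi)).2).2)
  have hL0 : ∀ l ∈ L, ∀ x ∈ σ.1, 0 ≤ l x := fun l hl x hx => (hL x).mp hx l hl
  have hupos : ∀ l ∈ L, (∃ x ∈ σ.1, l x ≠ 0) → 0 < l u := fun l hl hx =>
    lt_of_le_of_ne (hL0 l hl u hu) (Ne.symm (hune (Sum.inl l)
      (Finset.inl_mem_disjSum.mpr (Finset.mem_filter.mpr ⟨hl, hx⟩))))
  have huW : ∀ ρ, ¬ σ.lin ≤ W ρ → u ∉ W ρ := fun ρ hρ hmem =>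
    hune (Sum.inr ρ) (Finset.inr_mem_disjSum.mpr (Finset.mem_filter.mpr ⟨by simp, hρ⟩))
      ((hg ρ hρ).1 u hmem)
  have hnv : ∀ l ∈ L, l w < 0 → 0 < l u := fun l hl hlw => by
    refine hupos l hl ?_
    by_contra! hc
    have : σ.lin ≤ LinearMap.ker l := Submodule.span_le.mpr hc
    exact hlw.ne (this hw)
  -- the exit point of the segment from `u` to `w`
  have hne : (L.filter fun l => l w < 0).Nonempty := by
    by_contra hne
    rw [Finset.not_nonempty_iff_eq_empty, Finset.filter_eq_empty_iff] at hne
    exact hwσ ((hL w).mpr fun l hl => not_lt.mp (hne hl))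
  obtain ⟨l0, hl0, hmin⟩ := Finset.exists_min_image _ (fun l => l u / (l u - l w)) hne
  rw [Finset.mem_filter] at hl0
  have hu0 := hnv l0 hl0.1 hl0.2
  set t := l0 u / (l0 u - l0 w) with ht
  have hden : 0 < l0 u - l0 w := by linarith [hl0.2]
  have ht0 : 0 < t := div_pos hu0 hden
  have ht1 : t < 1 := by rw [ht, div_lt_one hden]; linarith [hl0.2]
  have htl : t * (l0 u - l0 w) = l0 u := div_mul_cancel₀ _ hden.ne'
  let p := (1 - t) • u + t • w
  have hlp : ∀ l : Module.Dual ℝ V, l p = (1 - t) * l u + t * l w := fun l => by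
    simp only [p, map_add, map_smul, smul_eq_mul]
  have hp0 : l0 p = 0 := by rw [hlp]; linarith
  have hpσ : p ∈ σ.1 := by
    refine (hL p).mpr fun l hl => ?_
    rw [hlp]
    by_cases hlw : l w < 0
    · have h1 := hmin l (Finset.mem_filter.mpr ⟨hl, hlw⟩)
      have h2 := hnv l hl hlw
      rw [le_div_iff₀ (by linarith)] at h1
      linarith
    · push Not at hlw
      have := mul_nonneg ht0.le hlw
      have := mul_nonneg (sub_pos.mpr ht1).le (hL0 l hl u hu)
      linarith
  obtain ⟨ρ, hρσ, hρ⟩ := exists_cone_inf_ker σ l0 (hL0 l0 hl0.1)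
  have hpρ : p ∈ ρ.1 := (hρ p hpσ).mpr hp0
  have huρ : u ∉ ρ.1 := fun hmem => hu0.ne' ((hρ u hu).mp hmem)
  have hlt : ρ < σ := lt_of_le_of_ne hρσ (by rintro rfl; exact huρ hu)
  -- If `ρ` is a facet, its form is positive at `u`, zero at `p` and nonnegative at `w`, although
  -- `p` lies strictly between them. Otherwise `V_ρ + ℝ w` is too small to contain `V_σ`, yet `u` is
  -- a combination of `p ∈ ρ` and `w`.
  by_cases hd : Module.finrank ℝ ρ.lin + 1 = Module.finrank ℝ σ.lin
  · have hf : IsFacet ρ σ := ⟨hρσ, hd⟩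
    have h1 := hlp hf.form
    rw [(hf.form_eq_zero_iff_mem hpσ).mpr hpρ] at h1
    have h2 : 0 < hf.form u := lt_of_le_of_ne (hf.form_nonneg hu)
      (fun h => huρ ((hf.form_eq_zero_iff_mem hu).mp h.symm))
    have h3 := mul_nonneg ht0.le (h ρ hf)
    have h4 := mul_pos (sub_pos.mpr ht1) h2
    linarith
  · have hlt' := Fan.Cone.finrank_lt hlt
    have hnle : ¬ σ.lin ≤ W ρ := fun hle => by
      have h1 := Submodule.finrank_mono hle
      have h2 := Submodule.finrank_add_le_finrank_add_finrank ρ.lin (Submodule.span ℝ {w})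
      have h3 : Module.finrank ℝ (Submodule.span ℝ {w}) ≤ 1 :=
        (finrank_span_le_card ({w} : Set V)).trans (by simp)
      change _ ≤ Module.finrank ℝ (ρ.lin ⊔ Submodule.span ℝ {w} : Submodule ℝ V) at h1
      omega
    refine huW ρ hnle ?_
    have hu' : u = (1 - t)⁻¹ • (p - t • w) := by
      have : p - t • w = (1 - t) • u := by simp only [p]; abel
      rw [this, smul_smul, inv_mul_cancel₀ (sub_pos.mpr ht1).ne', one_smul]
    rw [hu']
    refine Submodule.smul_mem _ _ (sub_mem ?_ (Submodule.smul_mem _ _ ?_))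
    · exact Submodule.mem_sup_left (ρ.subset_lin hpρ)
    · exact Submodule.mem_sup_right (Submodule.mem_span_singleton_self w)

/-- A vector of `ρ` at which the facets of `σ` not containing `ρ` are positive. -/
theorem exists_mem_forall_form_pos {ρ σ : Δ.Cone} (h : ρ ≤ σ) :
    ∃ p ∈ ρ.1, ∀ (τ : Δ.Cone) (hτ : IsFacet τ σ), ¬ ρ ≤ τ → 0 < hτ.form p := by
  classical
  have := Fintype.ofFinite Δ.Cone
  let f : Δ.Cone → Module.Dual ℝ V := fun τ => if hτ : IsFacet τ σ then hτ.form else 0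
  obtain ⟨p, hp, hp'⟩ := exists_forall_apply_ne_zero ρ.1
    (Finset.univ.filter fun τ => IsFacet τ σ ∧ ¬ ρ ≤ τ) f (fun τ hτ => by
      simp only [Finset.mem_filter, Finset.mem_univ, true_and] at hτ
      obtain ⟨hτ, hρ⟩ := hτ
      obtain ⟨x, hx, hxτ⟩ := Set.not_subset.mp hρ
      refine ⟨x, hx, ?_⟩
      simp only [f, dif_pos hτ]
      exact fun h0 => hxτ ((hτ.form_eq_zero_iff_mem (h hx)).mp h0))
  refine ⟨p, hp, fun τ hτ hρ => lt_of_le_of_ne (hτ.form_nonneg (h hp)) (Ne.symm ?_)⟩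
  simpa [f, hτ] using hp' τ (by simp [hτ, hρ])

/-- A face is the intersection of the facets containing it. If `p ∈ ρ` is positive for all other
facets and `x ∈ ζ`, then `N p - x` satisfies every facet inequality of `σ` for large `N`. Since `x +
(N p - x) ∈ ρ` and `ρ` is a face, `x ∈ ρ`. -/
theorem le_of_forall_facet {ρ ζ σ : Δ.Cone} (h1 : ρ ≤ ζ) (h2 : ζ ≤ σ)
    (h : ∀ τ : Δ.Cone, IsFacet τ σ → ρ ≤ τ → ζ ≤ τ) : ζ ≤ ρ := by
  classical
  have := Fintype.ofFinite Δ.Cone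
  obtain ⟨p, hp, hpos⟩ := exists_mem_forall_form_pos (h1.trans h2)
  intro x hx
  let f : Δ.Cone → Module.Dual ℝ V := fun τ => if hτ : IsFacet τ σ then hτ.form else 0
  obtain ⟨N, hN, hN'⟩ := exists_forall_nonneg_add_mul Finset.univ
    (fun τ => -f τ x) (fun τ => f τ p)
  have hNp : N • p ∈ ρ.1 := PointedCone.smul_mem ρ.1 hN hp
  have hmem : N • p - x ∈ σ.1 := by
    refine mem_of_forall_form_nonneg (sub_mem (Submodule.smul_mem _ _
      (σ.subset_lin (h2 (h1 hp)))) (σ.subset_lin (h2 hx))) fun τ hτ => ?_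
    rw [map_sub, map_smul, smul_eq_mul]
    by_cases hρ : ρ ≤ τ
    · rw [(hτ.form_eq_zero_iff_mem (h2 hx)).mpr (h τ hτ hρ hx),
        (hτ.form_eq_zero_iff_mem (h2 (h1 hp))).mpr (hρ hp)]
      simp
    · have := hN' τ (by simp) (by simpa [f, hτ] using hpos τ hτ hρ)
      simp only [f, dif_pos hτ] at this
      linarith
  refine (Fan.Cone.isFaceOf (h1.trans h2)).mem_of_add_mem_left (h2 hx) hmem ?_
  simpa using hNp

theorem exists_isFacet_of_lt {ρ σ : Δ.Cone} (h : ρ < σ) : ∃ τ : Δ.Cone, IsFacet τ σ ∧ ρ ≤ τ := by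
  by_contra! hc
  exact h.not_ge (le_of_forall_facet h.le le_rfl fun τ hτ hρ => absurd hρ (hc τ hτ))

/-- If `η` is a facet of `τ` and `τ` one of `σ`, this supplies the neighbour of `τ` across `η`. -/
theorem exists_other_facet {η τ σ : Δ.Cone} (hη : η < τ) (hτ : τ ≤ σ) :
    ∃ τ' : Δ.Cone, IsFacet τ' σ ∧ η ≤ τ' ∧ ¬ τ ≤ τ' := by
  by_contra! hc
  exact hη.not_ge (le_of_forall_facet hη.le hτ fun τ' hτ' h => hc τ' hτ' h)

theorem nonempty_facetChain {τ σ : Δ.Cone} (h : τ ≤ σ) : Nonempty (FacetChain Δ σ τ) := by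
  induction hn : Module.finrank ℝ σ.lin using Nat.strong_induction_on generalizing σ with
  | _ n ih =>
    rcases h.eq_or_lt with rfl | hlt
    · exact ⟨.refl _⟩
    · obtain ⟨ρ, hρ, hle⟩ := exists_isFacet_of_lt hlt
      obtain ⟨c⟩ := ih _ (hn ▸ Fan.Cone.finrank_lt hρ.lt) hle rfl
      exact ⟨.step hρ c⟩

/-- If a functional that is nonnegative on `τ` and zero on its face `ρ` is negative at `w`, then so
is the form of some facet of `τ` that contains `ρ`. -/
theorem exists_facet_form_neg {ρ τ : Δ.Cone} (h : ρ ≤ τ) (f : Module.Dual ℝ V)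
    (hf : ∀ x ∈ τ.1, 0 ≤ f x) (h0 : ∀ x ∈ ρ.1, f x = 0) {w : V} (hw : w ∈ τ.lin) (hfw : f w < 0) :
    ∃ (η : Δ.Cone) (hη : IsFacet η τ), ρ ≤ η ∧ hη.form w < 0 := by
  classical
  have := Fintype.ofFinite Δ.Cone
  by_contra! hc
  obtain ⟨p, hp, hpos⟩ := exists_mem_forall_form_pos h
  let g : Δ.Cone → Module.Dual ℝ V := fun η => if hη : IsFacet η τ then hη.form else 0
  obtain ⟨N, hN, hN'⟩ := exists_forall_nonneg_add_mul Finset.univ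
    (fun η => g η w) (fun η => g η p)
  -- If no facet through `ρ` had a negative form at `w`, a large multiple of `p ∈ ρ` would repair
  -- the other inequalities without changing the value of `f`.
  have hmem : w + N • p ∈ τ.1 := by
    refine mem_of_forall_form_nonneg (add_mem hw (Submodule.smul_mem _ _
      (τ.subset_lin (h hp)))) fun η hη => ?_
    rw [map_add, map_smul, smul_eq_mul]
    by_cases hρ : ρ ≤ η
    · have := hc η hη hρ
      rwa [(hη.form_eq_zero_iff_mem (h hp)).mpr (hρ hp), mul_zero, add_zero]
    · have := hN' η (by simp) (by simpa [g, hη] using hpos η hη hρ)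
      simpa only [g, dif_pos hη] using this
  have := hf _ hmem
  rw [map_add, map_smul, h0 p hp, smul_zero, add_zero] at this
  exact this.not_gt hfw

theorem IsFacet.not_le {τ τ' σ : Δ.Cone} (h : IsFacet τ σ) (h' : IsFacet τ' σ) (hne : τ' ≠ τ) :
    ¬ τ ≤ τ' := fun hle => hne (h.eq_of_le_of_lt hle h'.lt)

/-! ### Shellings -/

/-- The set of the facets of `σ` that are visible from a vector of `V_σ` in general position. -/
def IsVisible (σ : Δ.Cone) (S : Set Δ.Cone) : Prop :=
  ∃ w ∈ σ.lin, (∀ (τ : Δ.Cone) (hτ : IsFacet τ σ), hτ.form w ≠ 0) ∧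
    S = {τ | ∃ hτ : IsFacet τ σ, hτ.form w < 0}

/-- The facets of `τ` that are contained in a facet `τ'` of `σ` with `s τ' < s τ`. -/
def initialFacets (σ : Δ.Cone) (s : Δ.Cone → ℝ) (τ : Δ.Cone) : Set Δ.Cone :=
  {η | IsFacet η τ ∧ ∃ τ' : Δ.Cone, IsFacet τ' σ ∧ η ≤ τ' ∧ s τ' < s τ}

/-- The function `s` orders the facets of `σ` in such a way that the intersection of each facet `τ`
with the union of its predecessors is the visible part of the boundary of `τ` from some point. -/
structure IsShelling (σ : Δ.Cone) (s : Δ.Cone → ℝ) : Prop where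
  inj : ∀ τ τ' : Δ.Cone, IsFacet τ σ → IsFacet τ' σ → s τ = s τ' → τ = τ'
  isVisible : ∀ τ : Δ.Cone, IsFacet τ σ → IsVisible τ (initialFacets σ s τ)
  pure : ∀ ρ τ τ' : Δ.Cone, IsFacet τ σ → IsFacet τ' σ → s τ' < s τ → ρ ≤ τ → ρ ≤ τ' →
    ∃ η ∈ initialFacets σ s τ, ρ ≤ η

/-- The line shelling of Bruggesser and Mani. For generic `u ∈ σ`, the line `w - t u` meets the
hyperplane of `τ` at time `s τ = f_τ(w) / f_τ(u)`, in a point `q τ`. Since `f_τ'(q τ) = f_τ'(u) (s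
τ' - s τ)` with `f_τ'(u) > 0`, a facet `τ'` precedes `τ` exactly if its form is negative at `q τ`;
this is compared with the form of a common facet `η` on `V_τ`. The facets visible from `w` itself
are those crossed at negative times. -/
theorem IsVisible.exists_isShelling {σ : Δ.Cone} {S : Set Δ.Cone} (hS : IsVisible σ S) :
    ∃ s : Δ.Cone → ℝ, IsShelling σ s ∧ S = {τ | IsFacet τ σ ∧ s τ < 0} := by
  classical
  have := Fintype.ofFinite Δ.Cone
  obtain ⟨w, hw, hw0, rfl⟩ := hS
  let f : Δ.Cone → Module.Dual ℝ V := fun τ => if hτ : IsFacet τ σ then hτ.form else 0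
  have hfe : ∀ (τ : Δ.Cone) (hτ : IsFacet τ σ), f τ = hτ.form := fun τ hτ => dif_pos hτ
  -- The diagonal entries force `f_τ(u) ≠ 0`; the others keep the crossing times of different facets
  -- apart.
  let G : Δ.Cone × Δ.Cone → Module.Dual ℝ V := fun p =>
    if p.1 = p.2 then f p.1 else f p.1 w • f p.2 - f p.2 w • f p.1
  obtain ⟨u, hu, hune⟩ := exists_forall_apply_ne_zero σ.1
    (Finset.univ.filter fun p : Δ.Cone × Δ.Cone => IsFacet p.1 σ ∧ IsFacet p.2 σ) G (by
    rintro ⟨τ, τ'⟩ hp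
    simp only [Finset.mem_filter, Finset.mem_univ, true_and] at hp
    by_cases he : τ = τ'
    · subst he
      obtain ⟨n, hn, hn1⟩ := hp.1.exists_form_eq_one
      refine ⟨n, hn, ?_⟩
      simp only [G, if_true, hfe τ hp.1, hn1]
      exact one_ne_zero
    · obtain ⟨x, hx, hx'⟩ := Set.not_subset.mp (hp.1.not_le hp.2 (Ne.symm he))
      have hxσ := hp.1.le hx
      refine ⟨x, hxσ, ?_⟩
      simp only [G, if_neg he, LinearMap.sub_apply, LinearMap.smul_apply, smul_eq_mul,
        hfe τ hp.1, hfe τ' hp.2]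
      rw [(hp.1.form_eq_zero_iff_mem hxσ).mpr hx, mul_zero, sub_zero]
      exact mul_ne_zero (hw0 τ hp.1) fun h => hx' ((hp.2.form_eq_zero_iff_mem hxσ).mp h))
  have hupos : ∀ (τ : Δ.Cone) (hτ : IsFacet τ σ), 0 < f τ u := fun τ hτ => by
    have := hune (τ, τ) (by simp [hτ])
    simp only [G, if_true] at this
    refine lt_of_le_of_ne ?_ this.symm
    rw [hfe τ hτ]
    exact hτ.form_nonneg hu
  let s : Δ.Cone → ℝ := fun τ => f τ w / f τ u
  have hinj : ∀ τ τ' : Δ.Cone, IsFacet τ σ → IsFacet τ' σ → s τ = s τ' → τ = τ' := by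
    intro τ τ' hτ hτ' he
    by_contra hne
    have := hune (τ, τ') (by simp [hτ, hτ'])
    simp only [G, if_neg hne, LinearMap.sub_apply, LinearMap.smul_apply, smul_eq_mul] at this
    rw [div_eq_div_iff (hupos τ hτ).ne' (hupos τ' hτ').ne'] at he
    exact this (by linarith)
  -- the point at which the ray crosses the hyperplane of `τ`
  let q : Δ.Cone → V := fun τ => w - s τ • u
  have hq : ∀ τ, IsFacet τ σ → q τ ∈ τ.lin := fun τ hτ => by
    refine (hτ.form_eq_zero_iff (sub_mem hw (Submodule.smul_mem _ _ (σ.subset_lin hu)))).mp ?_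
    have := (hupos τ hτ).ne'
    rw [map_sub, map_smul, smul_eq_mul, ← hfe τ hτ]
    simp only [s]
    field_simp
    ring
  have hfq : ∀ τ τ' : Δ.Cone, IsFacet τ' σ → f τ' (q τ) = f τ' u * (s τ' - s τ) := by
    intro τ τ' hτ'
    have := (hupos τ' hτ').ne'
    simp only [q, map_sub, map_smul, smul_eq_mul, mul_sub]
    simp only [s]
    field_simp
  -- On `V_τ` the form of `τ'` vanishes on the hyperplane `V_η`, so it is a multiple of the form of
  -- `η`. The factor is nonnegative by evaluation in `τ`, and it is not zero because `τ` is not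
  -- contained in `τ'`.
  have hcmp : ∀ (η τ τ' : Δ.Cone) (hη : IsFacet η τ), IsFacet τ σ → IsFacet τ' σ → τ' ≠ τ →
      η ≤ τ' → ∃ c : ℝ, 0 < c ∧ f τ' (q τ) = c * hη.form (q τ) := by
    intro η τ τ' hη hτ hτ' hne hle
    obtain ⟨n, hn, hc⟩ := hη.exists_apply_eq_apply_mul_form (f τ')
      (fun x hx => by
        rw [hfe τ' hτ']
        exact (hτ'.form_eq_zero_iff (Fan.Cone.lin_mono (hle.trans hτ'.le) hx)).mpr
          (Fan.Cone.lin_mono hle hx))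
    have hn0 : 0 ≤ f τ' n := by rw [hfe τ' hτ']; exact hτ'.form_nonneg (hτ.le hn)
    refine ⟨f τ' n, lt_of_le_of_ne hn0 fun h0 => ?_, hc _ (hq τ hτ)⟩
    refine hτ.not_le hτ' hne fun x hx => ?_
    have := hc x (τ.subset_lin hx)
    rw [← h0, zero_mul, hfe τ' hτ'] at this
    exact (hτ'.form_eq_zero_iff_mem (hτ.le hx)).mp this
  have hneg : ∀ (η τ : Δ.Cone) (hη : IsFacet η τ), IsFacet τ σ → 
      (hη.form (q τ) ≠ 0 ∧ (hη.form (q τ) < 0 ↔ η ∈ initialFacets σ s τ)) := by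
    intro η τ hη hτ
    have key : ∀ τ' : Δ.Cone, IsFacet τ' σ → τ' ≠ τ → η ≤ τ' → hη.form (q τ) ≠ 0 ∧
        (hη.form (q τ) < 0 ↔ s τ' < s τ) := by
      intro τ' hτ' hne hle
      obtain ⟨c, hc, he⟩ := hcmp η τ τ' hη hτ hτ' hne hle
      rw [hfq τ τ' hτ'] at he
      have hu' := hupos τ' hτ'
      refine ⟨fun h0 => ?_, ?_⟩
      · rw [h0, mul_zero, mul_eq_zero, or_iff_right hu'.ne', sub_eq_zero] at he
        exact hne (hinj τ' τ hτ' hτ he)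
      · constructor
        · intro h
          have h2 : f τ' u * (s τ' - s τ) < 0 := he ▸ mul_neg_of_pos_of_neg hc h
          have := (pos_iff_neg_of_mul_neg h2).mp hu'
          linarith
        · intro h
          have h2 : c * hη.form (q τ) < 0 := he ▸ mul_neg_of_pos_of_neg hu' (by linarith)
          exact (pos_iff_neg_of_mul_neg h2).mp hc
    obtain ⟨τ', hτ', hle, hnle⟩ := exists_other_facet hη.lt hτ.le
    have hne : τ' ≠ τ := by rintro rfl; exact hnle le_rfl
    refine ⟨(key τ' hτ' hne hle).1, fun h => ⟨hη, τ', hτ', hle, (key τ' hτ' hne hle).2.mp h⟩, ?_⟩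
    rintro ⟨_, τ'', hτ'', hle'', hs⟩
    exact (key τ'' hτ'' (by rintro rfl; exact lt_irrefl _ hs) hle'').2.mpr hs
  refine ⟨s, ⟨hinj, fun τ hτ => ⟨q τ, hq τ hτ, fun η hη => (hneg η τ hη hτ).1, ?_⟩, ?_⟩, ?_⟩
  · ext η
    exact ⟨fun h => ⟨h.1, (hneg η τ h.1 hτ).2.mpr h⟩, fun ⟨hη, h⟩ => (hneg η τ hη hτ).2.mp h⟩
  · intro ρ τ τ' hτ hτ' hs h h'
    obtain ⟨η, hη, hρη, hlt⟩ := exists_facet_form_neg h (f τ')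
      (fun x hx => by rw [hfe τ' hτ']; exact hτ'.form_nonneg (hτ.le hx))
      (fun x hx => by
        rw [hfe τ' hτ']; exact (hτ'.form_eq_zero_iff_mem (hτ.le (h hx))).mpr (h' hx))
      (hq τ hτ) (by
        rw [hfq τ τ' hτ']
        exact mul_neg_of_pos_of_neg (hupos τ' hτ') (by linarith))
    exact ⟨η, (hneg η τ hη hτ).2.mp hlt, hρη⟩
  · ext τ
    constructor
    · rintro ⟨hτ, h⟩
      exact ⟨hτ, div_neg_of_neg_of_pos (by rwa [hfe τ hτ]) (hupos τ hτ)⟩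
    · rintro ⟨hτ, h⟩
      refine ⟨hτ, ?_⟩
      have h2 := hupos τ hτ
      rw [← hfe τ hτ]
      by_contra! h3
      exact h.not_ge (div_nonneg h3 h2.le)

/-- The viewpoint is the negative of a vector of `σ` at which all facet forms are positive. Thus
statements about visible parts cover the full boundary. -/
theorem isVisible_facets (σ : Δ.Cone) : IsVisible σ {τ | IsFacet τ σ} := by
  obtain ⟨p, hp, hpos⟩ := exists_mem_forall_form_pos (le_refl σ)
  refine ⟨-p, neg_mem (σ.subset_lin hp), fun τ hτ => ?_, ?_⟩
  · have := hpos τ hτ hτ.lt.not_ge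
    rw [map_neg]
    linarith
  · ext τ
    refine ⟨fun hτ => ⟨hτ, ?_⟩, fun h => h.1⟩
    have := hpos τ hτ hτ.lt.not_ge
    rw [map_neg]
    linarith

/-- The facets of `σ` that precede `τ`. -/
def facetsBefore (σ : Δ.Cone) (s : Δ.Cone → ℝ) (τ : Δ.Cone) : Set Δ.Cone :=
  {τ' | IsFacet τ' σ ∧ s τ' < s τ}

/-- Remove the facet with the largest value of `s`: what remains is again an initial segment, namely
the set of its predecessors. -/
theorem IsShelling.induction {σ : Δ.Cone} {s : Δ.Cone → ℝ} (hs : IsShelling σ s)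
    {p : Set Δ.Cone → Prop} (empty : p ∅)
    (step : ∀ τ, IsFacet τ σ → p (facetsBefore σ s τ) → p (insert τ (facetsBefore σ s τ)))
    (c : ℝ) : p {τ | IsFacet τ σ ∧ s τ < c} := by
  induction hn : {τ : Δ.Cone | IsFacet τ σ ∧ s τ < c}.ncard using Nat.strong_induction_on
    generalizing c with
  | _ n ih =>
    rcases Set.eq_empty_or_nonempty {τ : Δ.Cone | IsFacet τ σ ∧ s τ < c} with h | h
    · rw [h]; exact empty
    · obtain ⟨τ, ⟨hτ, hτc⟩, hmax⟩ := Set.exists_max_image _ s (Set.toFinite _) h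
      have he : {τ : Δ.Cone | IsFacet τ σ ∧ s τ < c} = insert τ (facetsBefore σ s τ) := by
        ext τ'
        constructor
        · intro h'
          rcases (hmax τ' h').lt_or_eq with h1 | h1
          · exact Or.inr ⟨h'.1, h1⟩
          · exact Or.inl (hs.inj _ _ h'.1 hτ h1)
        · rintro (rfl | h')
          · exact ⟨hτ, hτc⟩
          · exact ⟨h'.1, h'.2.trans hτc⟩
      rw [he]
      refine step τ hτ (ih _ ?_ (s τ) rfl)
      rw [← hn, he]
      refine Set.ncard_lt_ncard ?_ (Set.toFinite _)
      exact Set.ssubset_insert fun h' => lt_irrefl _ h'.2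

theorem exists_isShelling (σ : Δ.Cone) :
    ∃ s : Δ.Cone → ℝ, IsShelling σ s ∧ ∀ τ, IsFacet τ σ → s τ < 0 :=
  let ⟨s, hs, h⟩ := (isVisible_facets σ).exists_isShelling
  ⟨s, hs, fun τ hτ => ((Set.ext_iff.mp h τ).mp hτ).2⟩

end Facets

/-! ### Internal gradings -/

section Grading

variable {M : Type*} [AddCommGroup M] {S : Type*} [SetLike S M] [AddSubgroupClass S M]

/-- The homogeneous component of degree `k` for an internal grading. -/
def component {gr : ℤ → S} (h : DirectSum.IsInternal gr) (k : ℤ) : M →+ M :=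
  (AddSubgroupClass.subtype (gr k)).comp ((DFinsupp.evalAddMonoidHom k).comp
    (AddEquiv.ofBijective (DirectSum.coeAddMonoidHom gr) h).symm.toAddMonoidHom)

theorem component_mem {gr : ℤ → S} (h : DirectSum.IsInternal gr) (k : ℤ) (x : M) :
    component h k x ∈ gr k :=
  SetLike.coe_mem _

theorem component_coe {gr : ℤ → S} (h : DirectSum.IsInternal gr) (k : ℤ)
    (y : DirectSum ℤ fun i => gr i) :
    component h k (DirectSum.coeAddMonoidHom gr y) = y k := by
  have : (AddEquiv.ofBijective (DirectSum.coeAddMonoidHom gr) h).symm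
      (DirectSum.coeAddMonoidHom gr y) = y :=
    (AddEquiv.ofBijective (DirectSum.coeAddMonoidHom gr) h).symm_apply_apply y
  change ((AddEquiv.ofBijective (DirectSum.coeAddMonoidHom gr) h).symm
      (DirectSum.coeAddMonoidHom gr y) k : M) = y k
  rw [this]

theorem component_of_mem {gr : ℤ → S} (h : DirectSum.IsInternal gr) {k : ℤ} {x : M}
    (hx : x ∈ gr k) : component h k x = x := by
  classical
  have := component_coe h k (DirectSum.of (fun i => gr i) k ⟨x, hx⟩)
  rwa [DirectSum.coeAddMonoidHom_of, DirectSum.of_eq_same] at this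

theorem component_of_mem_ne {gr : ℤ → S} (h : DirectSum.IsInternal gr) {j k : ℤ} {x : M}
    (hx : x ∈ gr j) (hjk : j ≠ k) : component h k x = 0 := by
  classical
  have := component_coe h k (DirectSum.of (fun i => gr i) j ⟨x, hx⟩)
  rwa [DirectSum.coeAddMonoidHom_of, DirectSum.of_eq_of_ne _ _ _ hjk.symm, ZeroMemClass.coe_zero]
    at this

theorem exists_sum_component {gr : ℤ → S} (h : DirectSum.IsInternal gr) (x : M) :
    ∃ s : Finset ℤ, x = ∑ k ∈ s, component h k x := by
  classical
  obtain ⟨y, rfl⟩ := h.2 x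
  refine ⟨DFinsupp.support y, ?_⟩
  simp only [component_coe]
  exact DirectSum.coeAddMonoidHom_eq_dfinsuppSum _ y

/-- Induction on homogeneous elements. -/
theorem homogeneous_induction {gr : ℤ → S} (h : DirectSum.IsInternal gr) {p : M → Prop}
    (zero : p 0) (add : ∀ x y, p x → p y → p (x + y)) (mem : ∀ k, ∀ x ∈ gr k, p x) (x : M) :
    p x := by
  classical
  obtain ⟨s, hs⟩ := exists_sum_component h x
  rw [hs]
  exact Finset.sum_induction _ p add zero fun k _ => mem k _ (component_mem h k x)

/-- The maps `c k` recover the components of a sum, which makes the sum direct; the closure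
hypothesis says that it is everything. -/
theorem isInternal_of_component {gr : ℤ → S} (c : ℤ → M →+ M)
    (h1 : ∀ k, ∀ x ∈ gr k, c k x = x) (h2 : ∀ j k, j ≠ k → ∀ x ∈ gr j, c k x = 0)
    (h3 : ∀ x, x ∈ AddSubgroup.closure {y | ∃ k, y ∈ gr k}) :
    DirectSum.IsInternal gr := by
  classical
  have key : ∀ k (y : DirectSum ℤ fun i => gr i),
      c k (DirectSum.coeAddMonoidHom gr y) = y k := by
    intro k y
    induction y using DirectSum.induction_on with
    | zero => simp
    | of j x =>
      rw [DirectSum.coeAddMonoidHom_of]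
      by_cases hjk : j = k
      · subst hjk
        rw [h1 j _ x.2, DirectSum.of_eq_same]
      · rw [h2 j k hjk _ x.2, DirectSum.of_eq_of_ne _ _ _ (Ne.symm hjk), ZeroMemClass.coe_zero]
    | add x y hx hy => rw [map_add, map_add, hx, hy, DirectSum.add_apply]; rfl
  constructor
  · refine (injective_iff_map_eq_zero _).mpr fun y hy => ?_
    ext k
    rw [← key, hy, map_zero]
    rfl
  · intro x
    refine (AddSubgroup.closure_le (DirectSum.coeAddMonoidHom gr).range).mpr ?_ (h3 x)
    rintro y ⟨k, hk⟩
    exact ⟨DirectSum.of (fun i => gr i) k ⟨y, hk⟩, DirectSum.coeAddMonoidHom_of _ _ _⟩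

theorem component_map {M' S' : Type*} [AddCommGroup M'] [SetLike S' M'] [AddSubgroupClass S' M']
    {gr : ℤ → S} (h : DirectSum.IsInternal gr) {gr' : ℤ → S'} (h' : DirectSum.IsInternal gr')
    (f : M →+ M') (d : ℤ) (hf : ∀ k, ∀ x ∈ gr k, f x ∈ gr' (k + d)) (k : ℤ) (x : M) :
    component h' (k + d) (f x) = f (component h k x) := by
  induction x using homogeneous_induction h with
  | zero => simp
  | add x y hx hy => simp only [map_add, hx, hy]
  | mem j x hx =>
    by_cases hjk : j = k
    · subst hjk
      rw [component_of_mem h hx, component_of_mem h' (hf j x hx)]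
    · rw [component_of_mem_ne h hx hjk, map_zero,
        component_of_mem_ne h' (hf j x hx) (by omega)]

theorem component_map_of_degree_zero {M' S' : Type*} [AddCommGroup M'] [SetLike S' M']
    [AddSubgroupClass S' M'] {gr : ℤ → S} (h : DirectSum.IsInternal gr) {gr' : ℤ → S'}
    (h' : DirectSum.IsInternal gr') (f : M →+ M') (hf : ∀ k, ∀ x ∈ gr k, f x ∈ gr' k) (k : ℤ)
    (x : M) : component h' k (f x) = f (component h k x) := by
  have := component_map h h' f 0 (fun k x hx => by simpa using hf k x hx) k x
  rwa [add_zero] at this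

end Grading

/-! ### Polynomials on linear subspaces -/

section Polynomials

variable {V : Type u} [AddCommGroup V] [Module ℝ V]

/-- The space of linear forms in `S(U^*)`. -/
abbrev linForms (U : Submodule ℝ V) : Submodule ℝ (Poly U) :=
  LinearMap.range (SymmetricAlgebra.ι ℝ (Module.Dual ℝ U))

theorem mem_polyGr_of_mem_pow {U : Submodule ℝ V} {m : ℕ} {k : ℤ} (hk : 2 * (m : ℤ) = k)
    {a : Poly U} (ha : a ∈ linForms U ^ m) : a ∈ polyGr U k :=
  Submodule.mem_iSup_of_mem m (Submodule.mem_iSup_of_mem hk ha)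

theorem polyGr_eq_pow (U : Submodule ℝ V) {m : ℕ} {k : ℤ} (hk : 2 * (m : ℤ) = k) :
    polyGr U k = linForms U ^ m := by
  refine le_antisymm (iSup₂_le fun m' hm' => ?_) fun a ha => mem_polyGr_of_mem_pow hk ha
  obtain rfl : m' = m := by omega
  exact le_rfl

theorem polyGr_induction {U : Submodule ℝ V} {k : ℤ} {a : Poly U} (ha : a ∈ polyGr U k) :
    a = 0 ∨ ∃ m : ℕ, 2 * (m : ℤ) = k ∧ a ∈ linForms U ^ m := by
  by_cases h : ∃ m : ℕ, 2 * (m : ℤ) = k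
  · obtain ⟨m, hm⟩ := h
    exact Or.inr ⟨m, hm, polyGr_eq_pow U hm ▸ ha⟩
  · left
    have : polyGr U k = ⊥ := by
      refine le_bot_iff.mp (iSup₂_le fun m hm => absurd ⟨m, hm⟩ h)
    rwa [this] at ha

theorem ι_mem_polyGr {U : Submodule ℝ V} (l : Module.Dual ℝ U) :
    SymmetricAlgebra.ι ℝ _ l ∈ polyGr U 2 :=
  mem_polyGr_of_mem_pow (m := 1) (by norm_num) (by rw [pow_one]; exact ⟨l, rfl⟩)

theorem mul_mem_polyGr {U : Submodule ℝ V} {i j : ℤ} {a b : Poly U} (ha : a ∈ polyGr U i)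
    (hb : b ∈ polyGr U j) : a * b ∈ polyGr U (i + j) := by
  rcases polyGr_induction ha with rfl | ⟨m, hm, ha⟩
  · rw [zero_mul]; exact zero_mem _
  rcases polyGr_induction hb with rfl | ⟨n, hn, hb⟩
  · rw [mul_zero]; exact zero_mem _
  refine mem_polyGr_of_mem_pow (m := m + n) (by push_cast; omega) ?_
  rw [pow_add]
  exact Submodule.mul_mem_mul ha hb

theorem polyRes_mem_polyGr {U' U : Submodule ℝ V} (h : U' ≤ U) {k : ℤ} {a : Poly U}
    (ha : a ∈ polyGr U k) : polyRes h a ∈ polyGr U' k := by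
  rcases polyGr_induction ha with rfl | ⟨m, hm, ha⟩
  · rw [map_zero]; exact zero_mem _
  refine mem_polyGr_of_mem_pow hm ?_
  have h1 : (linForms U).map (polyRes h).toLinearMap ≤ linForms U' := by
    rintro _ ⟨_, ⟨l, rfl⟩, rfl⟩
    exact ⟨_, (polyRes_ι h l).symm⟩
  have h2 := Submodule.mem_map_of_mem (f := (polyRes h).toLinearMap) ha
  rw [Submodule.map_pow] at h2
  exact pow_le_pow_left' h1 m h2

/-- The algebra homomorphism sending a form `a` of degree `m` to `a X^m`. -/
def homogenize (U : Submodule ℝ V) : Poly U →ₐ[ℝ] Polynomial (Poly U) :=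
  SymmetricAlgebra.lift
    ((LinearMap.mulRight ℝ Polynomial.X).comp
      ((Polynomial.CAlgHom (R := ℝ) (A := Poly U)).toLinearMap.comp (SymmetricAlgebra.ι ℝ _)))

theorem homogenize_of_mem_pow {U : Submodule ℝ V} {m : ℕ} {a : Poly U} (ha : a ∈ linForms U ^ m) :
    homogenize U a = Polynomial.C a * Polynomial.X ^ m := by
  induction m generalizing a with
  | zero =>
    rw [pow_zero] at ha
    obtain ⟨r, rfl⟩ := Submodule.mem_one.mp ha
    rw [AlgHom.commutes, pow_zero, mul_one]
    rfl
  | succ m ih =>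
    rw [pow_succ] at ha
    induction ha using Submodule.mul_induction_on' with
    | mem_mul_mem x hx y hy =>
      obtain ⟨l, rfl⟩ := hy
      have h1 : homogenize U (SymmetricAlgebra.ι ℝ _ l) =
          Polynomial.C (SymmetricAlgebra.ι ℝ _ l) * Polynomial.X := by
        simp [homogenize]
      rw [map_mul, ih hx, h1, map_mul]
      ring
    | add x _ y _ hx hy => rw [map_add, map_add, hx, hy, add_mul]

theorem mem_closure_polyGr {U : Submodule ℝ V} (a : Poly U) :
    a ∈ AddSubgroup.closure {y | ∃ k, y ∈ polyGr U k} := by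
  have key : ∀ a ∈ ⨆ k, polyGr U k, a ∈ AddSubgroup.closure {y | ∃ k, y ∈ polyGr U k} := by
    intro a ha
    induction ha using Submodule.iSup_induction' with
    | zero => exact zero_mem _
    | add x y _ _ hx hy => exact add_mem hx hy
    | mem k x hx => exact AddSubgroup.subset_closure ⟨k, hx⟩
  refine key a ?_
  induction a using SymmetricAlgebra.induction with
  | algebraMap r =>
    refine Submodule.mem_iSup_of_mem 0 (mem_polyGr_of_mem_pow (m := 0) (by norm_num) ?_)
    rw [pow_zero]
    exact Submodule.mem_one.mpr ⟨r, rfl⟩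
  | ι l => exact Submodule.mem_iSup_of_mem 2 (ι_mem_polyGr l)
  | mul a b ha hb =>
    induction ha using Submodule.iSup_induction' with
    | zero => rw [zero_mul]; exact zero_mem _
    | add x y _ _ hx hy => rw [add_mul]; exact add_mem hx hy
    | mem i x hx =>
      induction hb using Submodule.iSup_induction' with
      | zero => rw [mul_zero]; exact zero_mem _
      | add y z _ _ hy hz => rw [mul_add]; exact add_mem hy hz
      | mem j y hy => exact Submodule.mem_iSup_of_mem (i + j) (mul_mem_polyGr hx hy)
  | add a b ha hb => exact add_mem ha hb

/-- The coefficient of `X ^ m` in the homogenization is the projector to degree `2m`. The condition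
on `k` is needed since `(k / 2).toNat` would confuse negative or odd degrees with others. -/
theorem isInternal_polyGr (U : Submodule ℝ V) : DirectSum.IsInternal (polyGr U) := by
  refine isInternal_of_component (fun k => if 0 ≤ k ∧ k % 2 = 0 then
    ((Polynomial.lcoeff (Poly U) (k / 2).toNat).toAddMonoidHom.comp
      (homogenize U : Poly U →+ Polynomial (Poly U))) else 0) ?_ ?_ mem_closure_polyGr
  · intro k x hx
    rcases polyGr_induction hx with rfl | ⟨m, rfl, hm⟩
    · rw [map_zero]
    · rw [if_pos (by omega)]
      change (homogenize U x).coeff _ = x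
      rw [homogenize_of_mem_pow hm, Polynomial.coeff_C_mul_X_pow, if_pos (by omega)]
  · intro j k hjk x hx
    rcases polyGr_induction hx with rfl | ⟨m, rfl, hm⟩
    · rw [map_zero]
    · split_ifs with h
      · change (homogenize U x).coeff _ = 0
        rw [homogenize_of_mem_pow hm, Polynomial.coeff_C_mul_X_pow, if_neg (by omega)]
      · rfl

/-- The value of a polynomial at the origin. -/
abbrev evalZero (U : Submodule ℝ V) : Poly U →ₐ[ℝ] ℝ := SymmetricAlgebra.algebraMapInv

theorem component_zero_poly {U : Submodule ℝ V} (a : Poly U) :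
    component (isInternal_polyGr U) 0 a = algebraMap ℝ _ (evalZero U a) := by
  induction a using homogeneous_induction (isInternal_polyGr U) with
  | zero => simp
  | add x y hx hy => rw [map_add, hx, hy, map_add, map_add]
  | mem k x hx =>
    rcases polyGr_induction hx with rfl | ⟨m, rfl, hm⟩
    · simp
    rcases m with _ | m
    · rw [component_of_mem _ (by simpa using hx)]
      rw [pow_zero] at hm
      obtain ⟨r, rfl⟩ := Submodule.mem_one.mp hm
      rw [AlgHom.commutes]
      rfl
    · rw [component_of_mem_ne _ hx (by omega)]
      have : evalZero U x = 0 := by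
        rw [pow_succ] at hm
        clear hx
        induction hm using Submodule.mul_induction_on' with
        | mem_mul_mem x hx y hy =>
          obtain ⟨l, rfl⟩ := hy
          rw [map_mul, SymmetricAlgebra.algebraMapInv_ι, mul_zero]
        | add x _ y _ hx hy => rw [map_add, hx, hy, add_zero]
      rw [this, map_zero]

/-- The polynomials on `U` that vanish on a hyperplane are the multiples of its equation. -/
theorem polyRes_eq_zero_iff_dvd {U' U : Submodule ℝ V} (h : U' ≤ U) (l : Module.Dual ℝ U)
    (hl : ∀ v : U, l v = 0 ↔ (v : V) ∈ U') (n : U) (hn : l n = 1) (a : Poly U) :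
    polyRes h a = 0 ↔ SymmetricAlgebra.ι ℝ _ l ∣ a := by
  constructor
  · intro ha
    -- The projection along `n` induces a map `sec` back from `S(U'^*)`, and `sec ∘ polyRes` sends a
    -- linear form `f` to `f - f(n) l`, hence is the identity modulo `l`.
    let p : U →ₗ[ℝ] U' := LinearMap.codRestrict U' (U.subtype ∘ₗ (LinearMap.id - l.smulRight n))
      fun v => (hl _).mp (by simp [hn])
    let sec : Poly U' →ₐ[ℝ] Poly U :=
      SymmetricAlgebra.lift (SymmetricAlgebra.ι ℝ (Module.Dual ℝ U) ∘ₗ p.dualMap)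
    let I : Ideal (Poly U) := Ideal.span {SymmetricAlgebra.ι ℝ _ l}
    have key : (Ideal.Quotient.mkₐ ℝ I).comp (sec.comp (polyRes h)) = Ideal.Quotient.mkₐ ℝ I := by
      apply SymmetricAlgebra.algHom_ext
      refine LinearMap.ext fun f => ?_
      change Ideal.Quotient.mk I (sec (polyRes h (SymmetricAlgebra.ι ℝ _ f))) =
        Ideal.Quotient.mk I (SymmetricAlgebra.ι ℝ _ f)
      rw [polyRes_ι, Ideal.Quotient.mk_eq_mk_iff_sub_mem]
      have h1 : sec (SymmetricAlgebra.ι ℝ _ ((Submodule.inclusion h).dualMap f)) =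
          SymmetricAlgebra.ι ℝ _ (f - f n • l) := by
        rw [SymmetricAlgebra.lift_ι_apply, LinearMap.comp_apply]
        congr 1
        ext v
        have : Submodule.inclusion h (p v) = v - l v • n := rfl
        simp only [LinearMap.dualMap_apply, this, map_sub, map_smul, LinearMap.sub_apply,
          LinearMap.smul_apply, smul_eq_mul]
        ring
      rw [h1, map_sub, map_smul, sub_sub_cancel_left, ← smul_neg]
      rw [Algebra.smul_def]
      exact I.mul_mem_left _ (neg_mem (Ideal.subset_span rfl))
    have := AlgHom.congr_fun key a
    simp only [AlgHom.comp_apply, ha, map_zero] at this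
    exact Ideal.mem_span_singleton.mp (Ideal.Quotient.eq_zero_iff_mem.mp this.symm)
  · rintro ⟨b, rfl⟩
    have : (Submodule.inclusion h).dualMap l = 0 := by
      ext v
      exact (hl _).mpr v.2
    rw [map_mul, polyRes_ι, this, map_zero, zero_mul]

theorem ι_ne_zero {U : Submodule ℝ V} {l : Module.Dual ℝ U} (hl : l ≠ 0) :
    SymmetricAlgebra.ι ℝ _ l ≠ 0 := by
  intro h
  obtain ⟨v, hv⟩ : ∃ v, l v ≠ 0 := by
    by_contra! hc
    exact hl (LinearMap.ext hc)
  have : SymmetricAlgebra.lift (Module.Dual.eval ℝ U v) (SymmetricAlgebra.ι ℝ _ l) = 0 := by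
    rw [h, map_zero]
  rw [SymmetricAlgebra.lift_ι_apply] at this
  exact hv this

theorem FacetNormal.dvd_iff {Δ : Fan V} {τ σ : Δ.Cone} (h : τ ≤ σ) (N : FacetNormal τ σ)
    (a : Poly σ.lin) :
    polyRes (Fan.Cone.lin_mono h) a = 0 ↔ SymmetricAlgebra.ι ℝ _ N.form ∣ a :=
  polyRes_eq_zero_iff_dvd _ N.form N.ker_form N.vec N.form_vec a

theorem FacetNormal.ι_form_ne_zero {Δ : Fan V} {τ σ : Δ.Cone} (N : FacetNormal τ σ) :
    SymmetricAlgebra.ι ℝ _ N.form ≠ 0 :=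
  ι_ne_zero fun h => by simpa [h] using N.form_vec

theorem polyRes_form_of_le {Δ : Fan V} {γ τ σ : Δ.Cone} (h : γ ≤ τ) (hτ : τ ≤ σ)
    (N : FacetNormal τ σ) :
    polyRes (Fan.Cone.lin_mono (h.trans hτ)) (SymmetricAlgebra.ι ℝ (Module.Dual ℝ σ.lin) N.form) =
      0 := by
  rw [← polyRes_polyRes (Fan.Cone.lin_mono hτ) (Fan.Cone.lin_mono h), ConeSystem.polyRes_form hτ,
    map_zero]

end Polynomials

/-! ### Modules along the quotient by a non-zero-divisor -/

section Quotient

variable {A : Type*} [CommRing A]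

/-- A linear map all of whose values are divisible by `h` can be divided by `h`. -/
theorem exists_linearMap_smul_eq {X Y : Type*} [AddCommGroup X] [Module A X] [AddCommGroup Y]
    [Module A Y] {h : A} (hY : Function.Injective fun y : Y => h • y) (g : X →ₗ[A] Y)
    (hg : ∀ x, ∃ y, h • y = g x) : ∃ g' : X →ₗ[A] Y, ∀ x, h • g' x = g x := by
  choose g' hg' using hg
  refine ⟨⟨⟨g', fun x y => hY ?_⟩, fun a x => hY ?_⟩, hg'⟩
  · simp only [smul_add, hg', map_add]
  · simp only [RingHom.id_apply, smul_comm h a, hg', map_smul]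

variable {P : Type*} [AddCommGroup P] [Module A P]

/-- If `K` contains `h P`, an extension of `f` can only be `p ↦ f(h p) / h`; divisibility is what
makes this possible. -/
theorem exists_extension_of_dvd [IsDomain A] {h : A} (hh : h ≠ 0) {K : Type*} [AddCommGroup K]
    [Module A K] (j : K →ₗ[A] P) (m : P →ₗ[A] K) (hm : ∀ k, m (j k) = h • k) (f : K →ₗ[A] A)
    (hf : ∀ p, h ∣ f (m p)) : ∃ f' : P →ₗ[A] A, ∀ k, f' (j k) = f k := by
  have hinj : Function.Injective fun y : A => h • y := fun a b hab => mul_left_cancel₀ hh hab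
  obtain ⟨f', hf'⟩ := exists_linearMap_smul_eq hinj (f ∘ₗ m)
    fun p => (hf p).imp fun b hb => hb.symm
  refine ⟨f', fun k => hinj ?_⟩
  change h • f' (j k) = h • f k
  rw [hf', LinearMap.comp_apply, hm, map_smul]

variable {B : Type*} [CommRing B] [Algebra A B] {N : Type*} [AddCommGroup N] [Module B N]

/-- The connecting map for `Hom(-, A)`, made explicit: lift `d ∘ π` to `D : P → A` by projectivity.
As `π` is zero on `K`, `D` maps `K` into `h A`; put `e = D / h`, so that `e(h p) = D(p)`. -/
theorem exists_functional_of_quotient [IsDomain A] [Module.Projective A P] {h : A} (hh : h ≠ 0)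
    (hsurj : Function.Surjective (algebraMap A B)) (hker : ∀ a, algebraMap A B a = 0 ↔ h ∣ a)
    {K : Type*} [AddCommGroup K] [Module A K] (j : K →ₗ[A] P) (m : P →ₗ[A] K)
    (hm : ∀ p, j (m p) = h • p) (π : P →+ N)
    (hπ : ∀ a p, π (a • p) = algebraMap A B a • π p) (hj : ∀ k, π (j k) = 0) (d : N →ₗ[B] B) :
    ∃ e : K →ₗ[A] A, ∀ p, algebraMap A B (e (m p)) = d (π p) := by
  have hinj : Function.Injective fun y : A => h • y := fun a b hab => mul_left_cancel₀ hh hab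
  let dπ : P →ₗ[A] B := ⟨⟨fun p => d (π p), fun p q => by simp⟩, fun a p => by
    simp [hπ, Algebra.smul_def]⟩
  obtain ⟨D, hD⟩ := Module.projective_lifting_property (Algebra.linearMap A B) dπ hsurj
  have hD' : ∀ p, algebraMap A B (D p) = d (π p) := fun p => LinearMap.congr_fun hD p
  obtain ⟨e, he⟩ := exists_linearMap_smul_eq hinj (D ∘ₗ j) fun k => by
    have : h ∣ D (j k) := (hker _).mp (by rw [hD', hj, map_zero])
    exact this.imp fun b hb => hb.symm
  refine ⟨e, fun p => ?_⟩
  have : e (m p) = D p := hinj (by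
    change h • e (m p) = h • D p
    rw [he, LinearMap.comp_apply, hm, map_smul])
  rw [this, hD']

/-- The kernel of a surjection from a finitely generated projective module to a projective module
over the quotient by a non-zero-divisor is finitely generated and projective. -/
theorem finite_projective_ker_of_quotient [IsDomain A] [Module.Finite A P] [Module.Projective A P]
    [Module.Projective B N] {h : A} (hh : h ≠ 0)
    (hsurj : Function.Surjective (algebraMap A B)) (hker : ∀ a, algebraMap A B a = 0 ↔ h ∣ a)
    {K : Type*} [AddCommGroup K] [Module A K] (j : K →ₗ[A] P) (hjinj : Function.Injective j)
    (π : P →+ N) (hπ : ∀ a p, π (a • p) = algebraMap A B a • π p)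
    (hπs : Function.Surjective π) (hj : ∀ p, π p = 0 ↔ ∃ k, j k = p) :
    Module.Finite A K ∧ Module.Projective A K := by
  have hPinj : Function.Injective fun y : P => h • y := by
    have : Module.IsTorsionFree A P := inferInstance
    exact this.isSMulRegular (IsRegular.of_ne_zero hh)
  obtain ⟨s, hs⟩ := Module.projective_def'.mp (inferInstance : Module.Projective B N)
  let sπ : P →ₗ[A] (N →₀ B) := ⟨⟨fun p => s (π p), fun p q => by simp⟩, fun a p => by
    ext n
    simp [hπ, Algebra.smul_def]⟩
  let red : (N →₀ A) →ₗ[A] (N →₀ B) := Finsupp.mapRange.linearMap (Algebra.linearMap A B)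
  have hred : Function.Surjective red :=
    Finsupp.mapRange_surjective _ (map_zero _) hsurj
  obtain ⟨t, ht⟩ := Module.projective_lifting_property red sπ hred
  obtain ⟨v, hv⟩ := hπs.hasRightInverse
  -- A section of the free cover of `N` over `B`, lifted to `A`, gives an endomorphism `e` of `P`
  -- with `π ∘ e = π` that carries the kernel of `π` into `h P`.
  let e : P →ₗ[A] P := Finsupp.linearCombination A v ∘ₗ t
  have hlc : ∀ x : N →₀ A, π (Finsupp.linearCombination A v x) =
      Finsupp.linearCombination B (id : N → N) (red x) := by
    intro x
    induction x using Finsupp.induction_linear with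
    | zero => simp
    | add x y hx hy => simp only [map_add, hx, hy]
    | single n a =>
      simp [red, hπ, hv n, Finsupp.mapRange.linearMap_apply]
  have hπe : ∀ p, π (e p) = π p := fun p => by
    have h1 : red (t p) = s (π p) := LinearMap.congr_fun ht p
    rw [LinearMap.comp_apply, hlc, h1]
    exact LinearMap.congr_fun hs (π p)
  have hej : ∀ k, ∃ q, h • q = (e ∘ₗ j) k := fun k => by
    have h1 : red (t (j k)) = 0 := by
      have : red (t (j k)) = s (π (j k)) := LinearMap.congr_fun ht (j k)
      rw [this, (hj _).mpr ⟨k, rfl⟩, map_zero]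
    have h2 : ∀ n, h ∣ t (j k) n := fun n => (hker _).mp (DFunLike.congr_fun h1 n)
    choose b hb using h2
    refine ⟨∑ n ∈ (t (j k)).support, b n • v n, ?_⟩
    rw [LinearMap.comp_apply, LinearMap.comp_apply, Finsupp.linearCombination_apply,
      Finsupp.sum, Finset.smul_sum]
    exact Finset.sum_congr rfl fun n _ => by rw [hb n, smul_smul]
  obtain ⟨q, hq⟩ := exists_linearMap_smul_eq hPinj (e ∘ₗ j) hej
  -- The map `(p, p') ↦ p - e p + h p'` takes values in the kernel of `π`. It is split by `k ↦ (k, q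
  -- k)`, because `h q = e` on the kernel; so the kernel is a direct summand of `P × P`.
  let θ : P × P →ₗ[A] P := (LinearMap.id - e).coprod (h • LinearMap.id)
  have hθ : ∀ x, θ x ∈ LinearMap.range j := fun x => by
    refine (hj _).mp ?_
    have h0 : algebraMap A B h = 0 := (hker h).mpr dvd_rfl
    simp only [θ, LinearMap.coprod_apply, LinearMap.sub_apply, LinearMap.id_apply,
      LinearMap.smul_apply, map_add, map_sub, hπe, sub_self, hπ, h0, zero_smul, add_zero]
  let J := LinearEquiv.ofInjective j hjinj
  let Θ : P × P →ₗ[A] K := J.symm.toLinearMap ∘ₗ θ.codRestrict _ hθ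
  let Q : K →ₗ[A] P × P := j.prod q
  have hΘQ : Θ ∘ₗ Q = LinearMap.id := by
    ext k
    apply hjinj
    have h1 : ∀ y, j (J.symm y) = y := fun y => congrArg Subtype.val (J.apply_symm_apply y)
    change j (J.symm _) = j k
    rw [h1]
    change j k - e (j k) + h • q k = j k
    rw [hq]
    exact sub_add_cancel (j k) (e (j k))
  refine ⟨Module.Finite.of_surjective Θ fun k => ⟨Q k, LinearMap.congr_fun hΘQ k⟩, ?_⟩
  exact Module.Projective.of_split Q Θ hΘQ

end Quotient

/-! ### Graded projective modules -/

section GradedFree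

variable {V : Type u} [AddCommGroup V] [Module ℝ V] {U : Submodule ℝ V}
  {M : Type*} [AddCommGroup M] [Module (Poly U) M] {gr : ℤ → AddSubgroup M}

theorem exists_homogeneous_generators (hgr : DirectSum.IsInternal gr) (K : Submodule (Poly U) M)
    (hK : ∀ k, ∀ x ∈ K, component hgr k x ∈ K) (hfin : K.FG) :
    ∃ (n : ℕ) (x : Fin n → M) (d : Fin n → ℤ), (∀ i, x i ∈ gr (d i)) ∧
      Submodule.span (Poly U) (Set.range x) = K := by
  classical
  obtain ⟨s, rfl⟩ := hfin
  choose t ht using exists_sum_component hgr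
  let I := Σ y : s, t y.1
  let e := Fintype.equivFin I
  refine ⟨_, fun i => component hgr (e.symm i).2.1 (e.symm i).1.1, fun i => (e.symm i).2.1,
    fun i => component_mem _ _ _, le_antisymm ?_ ?_⟩
  · rw [Submodule.span_le]
    rintro _ ⟨i, rfl⟩
    exact hK _ _ (Submodule.subset_span (e.symm i).1.2)
  · rw [Submodule.span_le]
    intro y hy
    change y ∈ Submodule.span _ _
    rw [ht y]
    refine sum_mem fun k hk => Submodule.subset_span ⟨e ⟨⟨y, hy⟩, ⟨k, hk⟩⟩, ?_⟩
    exact congrArg (fun z : I => component hgr z.2.1 z.1.1) (e.symm_apply_apply _)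

/-- A finitely generated projective homogeneous submodule of a graded module has a basis of
homogeneous elements. -/
theorem exists_homogeneous_basis (hgr : DirectSum.IsInternal gr)
    (hsmul : ∀ (i j : ℤ) (a : Poly U) (x : M), a ∈ polyGr U i → x ∈ gr j → a • x ∈ gr (i + j))
    (K : Submodule (Poly U) M) (hK : ∀ k, ∀ x ∈ K, component hgr k x ∈ K)
    [Module.Finite (Poly U) K] [Module.Projective (Poly U) K] :
    ∃ (n : ℕ) (b : Module.Basis (Fin n) (Poly U) K) (d : Fin n → ℤ),
      ∀ i, (b i : M) ∈ gr (d i) := by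
  classical
  let p : ℕ → Prop := fun n => ∃ (x : Fin n → M) (d : Fin n → ℤ), (∀ i, x i ∈ gr (d i)) ∧
    Submodule.span (Poly U) (Set.range x) = K
  have hex : ∃ n, p n :=
    exists_homogeneous_generators hgr K hK (Module.Finite.iff_fg.mp inferInstance)
  obtain ⟨n, hn, hmin⟩ : ∃ n, p n ∧ ∀ m < n, ¬ p m :=
    ⟨Nat.find hex, Nat.find_spec hex, fun m => Nat.find_min hex⟩
  obtain ⟨x, d, hx, hspan⟩ := hn
  -- the coefficients of a relation vanish at the origin
  have hrel : ∀ a : Fin n → Poly U, ∑ i, a i • x i = 0 → ∀ j, evalZero U (a j) = 0 := by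
    intro a ha j
    by_contra hne
    -- In the degree of `x j` the coefficient of `x j` is the constant term of `a j`. If it is not
    -- zero, `x j` is a combination of the other generators, against the minimality of `n`.
    have hcomp : ∑ i, component (isInternal_polyGr U) (d j - d i) (a i) • x i = 0 := by
      have h1 := congrArg (component hgr (d j)) ha
      rw [map_zero, map_sum] at h1
      rw [← h1]
      refine Finset.sum_congr rfl fun i _ => ?_
      have h2 := component_map (isInternal_polyGr U) hgr
        ((smulAddHom (Poly U) M).flip (x i)) (d i)
        (fun k b hb => hsmul k (d i) b (x i) hb (hx i)) (d j - d i) (a i)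
      rw [sub_add_cancel] at h2
      exact h2.symm
    obtain ⟨m, hm⟩ : ∃ m, n = m + 1 := ⟨n - 1, by have := j.pos; omega⟩
    subst hm
    refine hmin m (Nat.lt_succ_self m) ⟨x ∘ j.succAbove, d ∘ j.succAbove, fun i => hx _, ?_⟩
    refine le_antisymm (hspan ▸ Submodule.span_mono (Set.range_comp_subset_range _ _)) ?_
    rw [← hspan, Submodule.span_le]
    rintro _ ⟨i, rfl⟩
    have hmem : ∀ i', x (j.succAbove i') ∈
        Submodule.span (Poly U) (Set.range (x ∘ j.succAbove)) :=
      fun i' => Submodule.subset_span ⟨i', rfl⟩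
    by_cases hij : i = j
    · subst hij
      rw [Fin.sum_univ_succAbove _ i, sub_self, component_zero_poly] at hcomp
      have h1 : algebraMap ℝ (Poly U) (evalZero U (a i)) • x i ∈
          Submodule.span (Poly U) (Set.range (x ∘ i.succAbove)) := by
        rw [eq_neg_of_add_eq_zero_left hcomp]
        exact neg_mem (sum_mem fun i' _ => Submodule.smul_mem _ _ (hmem i'))
      have h2 := Submodule.smul_mem _ (algebraMap ℝ (Poly U) (evalZero U (a i))⁻¹) h1
      rwa [smul_smul, ← map_mul, inv_mul_cancel₀ hne, map_one, one_smul] at h2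
    · obtain ⟨i', rfl⟩ := Fin.exists_succAbove_eq hij
      exact hmem i'
  have hxK : ∀ i, x i ∈ K := fun i => hspan ▸ Submodule.subset_span ⟨i, rfl⟩
  let π : (Fin n → Poly U) →ₗ[Poly U] K := Fintype.linearCombination (Poly U) fun i => ⟨x i, hxK i⟩
  have hπ : ∀ a, (π a : M) = ∑ i, a i • x i := fun a => by
    simp [π, Fintype.linearCombination_apply]
  have hsurj : Function.Surjective π := by
    rintro ⟨y, hy⟩
    rw [← hspan] at hy
    obtain ⟨c, hc⟩ := (Submodule.mem_span_range_iff_exists_fun _).mp hy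
    exact ⟨c, Subtype.ext ((hπ c).trans hc)⟩
  obtain ⟨s, hs⟩ := Module.projective_lifting_property π LinearMap.id hsurj
  have hs' : ∀ y, π (s y) = y := fun y => LinearMap.congr_fun hs y
  let e : (Fin n → Poly U) →ₗ[Poly U] (Fin n → Poly U) := s ∘ₗ π
  let E := LinearMap.toMatrix' e
  -- The columns of `1 - E` are relations, so they vanish at the origin. Hence `E` has nonzero
  -- determinant, while `E` kills every relation; the minimal generators are therefore independent.
  have hE : (evalZero U).mapMatrix E = 1 := by
    ext i j
    have h1 : π (Pi.single j 1 - e (Pi.single j 1)) = 0 := by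
      rw [map_sub, LinearMap.comp_apply, hs', sub_self]
    have h2 := hrel (Pi.single j 1 - e (Pi.single j 1)) (by rw [← hπ, h1]; rfl) i
    rw [Pi.sub_apply, map_sub, sub_eq_zero] at h2
    have h3 : E i j = e (Pi.single j 1) i := LinearMap.toMatrix'_apply e i j
    rw [AlgHom.mapMatrix_apply, Matrix.map_apply, h3, ← h2,
      Matrix.one_apply, Pi.single_apply]
    split_ifs <;> simp
  have hdet : E.det ≠ 0 := fun h => by
    have h1 := AlgHom.map_det (evalZero U) E
    rw [h, hE, Matrix.det_one, map_zero] at h1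
    exact zero_ne_one h1
  have hinj : Function.Injective π := by
    refine (injective_iff_map_eq_zero _).mpr fun v hv => ?_
    refine Matrix.eq_zero_of_mulVec_eq_zero hdet ?_
    rw [LinearMap.toMatrix'_mulVec, LinearMap.comp_apply, hv, map_zero]
  have hbij : Function.Bijective π := ⟨hinj, hsurj⟩
  let b : Module.Basis (Fin n) (Poly U) K :=
    Module.Basis.ofEquivFun (LinearEquiv.ofBijective π hbij).symm
  refine ⟨n, b, d, fun i => ?_⟩
  have : (b i : M) = x i := by
    have h1 : b i = π (Pi.single i 1) := by
      simp only [b, Module.Basis.coe_ofEquivFun]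
      rfl
    rw [h1, hπ, Finset.sum_eq_single i]
    · simp
    · intro j _ hj
      simp [hj]
    · simp
  rw [this]
  exact hx i

end GradedFree

/-! ### Sections vanishing on a set of facets -/

/-- A linear form on `V_σ` with kernel `V_τ`, and a vector of `σ` at which it is `1`. -/
abbrev IsFacet.normal {V : Type u} [AddCommGroup V] [Module ℝ V] [FiniteDimensional ℝ V]
    {Δ : Fan V} {τ σ : Δ.Cone} (hτ : IsFacet τ σ) : FacetNormal τ σ :=
  hτ.nonempty_facetNormal.some

namespace ConeSystem

variable {V : Type u} [AddCommGroup V] [Module ℝ V] {Δ : Fan V} {F : ConeSystem.{u, w} Δ}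

/-- The sections over `⟨σ⟩` that vanish on the faces of `σ` that belong to `S`. -/
def facetSections (F : ConeSystem.{u, w} Δ) (σ : Δ.Cone) (S : Set Δ.Cone) :
    Submodule (Poly σ.lin) (F.M σ) where
  carrier := {x | ∀ (τ : Δ.Cone) (h : τ ≤ σ), τ ∈ S → F.res h x = 0}
  zero_mem' := fun τ h _ => map_zero _
  add_mem' := fun {x y} hx hy τ h hτ => by rw [map_add, hx τ h hτ, hy τ h hτ, add_zero]
  smul_mem' := fun a x hx τ h hτ => by rw [F.res_smul, hx τ h hτ, smul_zero]

theorem facetSections_anti {σ : Δ.Cone} {S T : Set Δ.Cone} (h : S ⊆ T) :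
    F.facetSections σ T ≤ F.facetSections σ S :=
  fun _ hx τ hτ hS => hx τ hτ (h hS)

theorem facetSections_empty (σ : Δ.Cone) : F.facetSections σ ∅ = ⊤ :=
  eq_top_iff.mpr fun _ _ _ _ h => h.elim

theorem res_mem_facetSections (hF : F.IsGradedSheaf) {τ σ : Δ.Cone} (h : τ ≤ σ) (s : Δ.Cone → ℝ)
    {x : F.M σ} (hx : x ∈ F.facetSections σ (facetsBefore σ s τ)) :
    F.res h x ∈ F.facetSections τ (initialFacets σ s τ) := by
  rintro η hη ⟨_, τ', hτ', hle, hs⟩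
  rw [hF.res_res, ← hF.res_res hτ'.le hle, hx τ' hτ'.le ⟨hτ', hs⟩, map_zero]

/-- The restriction to a facet of the sections that vanish on the preceding facets. -/
def facetSectionsRes (hF : F.IsPerverse) {τ σ : Δ.Cone} (hτ : IsFacet τ σ) (s : Δ.Cone → ℝ) :
    F.facetSections σ (facetsBefore σ s τ) →+ F.facetSections τ (initialFacets σ s τ) where
  toFun x := ⟨F.res hτ.le x.1, res_mem_facetSections hF.isGradedSheaf hτ.le s x.2⟩
  map_zero' := Subtype.ext (map_zero _)
  map_add' _ _ := Subtype.ext (map_add _ _ _)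

theorem facetSectionsRes_smul (hF : F.IsPerverse) {τ σ : Δ.Cone} (hτ : IsFacet τ σ)
    (s : Δ.Cone → ℝ) (a : Poly σ.lin) (x : F.facetSections σ (facetsBefore σ s τ)) :
    facetSectionsRes hF hτ s (a • x) =
      polyRes (Fan.Cone.lin_mono hτ.le) a • facetSectionsRes hF hτ s x :=
  Subtype.ext (F.res_smul _ _ _)

theorem facetSectionsRes_eq_zero_iff (hF : F.IsPerverse) {τ σ : Δ.Cone} (hτ : IsFacet τ σ)
    (s : Δ.Cone → ℝ) (x : F.facetSections σ (facetsBefore σ s τ)) :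
    facetSectionsRes hF hτ s x = 0 ↔ ∃ k, Submodule.inclusion
      (facetSections_anti (F := F) (Set.subset_insert τ (facetsBefore σ s τ))) k = x := by
  constructor
  · intro h
    refine ⟨⟨x.1, ?_⟩, rfl⟩
    rintro τ' hle (rfl | hτ')
    · exact congrArg Subtype.val h
    · exact x.2 τ' hle hτ'
  · rintro ⟨k, rfl⟩
    exact Subtype.ext (k.2 τ hτ.le (Set.mem_insert _ _))

variable [FiniteDimensional ℝ V]

theorem relSections_eq (hF : F.IsGradedSheaf) (σ : Δ.Cone) :
    F.relSections σ = F.facetSections σ {τ | IsFacet τ σ} := by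
  refine le_antisymm (fun x hx τ _ hτ => hx τ hτ.lt) fun x hx γ hγ => ?_
  obtain ⟨τ, hτ, hle⟩ := exists_isFacet_of_lt hγ
  rw [← hF.res_res hτ.le hle, hx τ hτ.le hτ, map_zero]

theorem relSections_le_facetSections (hF : F.IsGradedSheaf) {σ : Δ.Cone} {S : Set Δ.Cone}
    (hS : S ⊆ {τ | IsFacet τ σ}) : F.relSections σ ≤ F.facetSections σ S :=
  (relSections_eq hF σ).le.trans (facetSections_anti hS)

/-- A section over a facet that vanishes on the intersection with the preceding facets extends to a
section that vanishes on the preceding facets. -/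
theorem exists_lift_facetSections (hF : F.IsPerverse) {τ σ : Δ.Cone} {s : Δ.Cone → ℝ}
    (hs : IsShelling σ s) (hτ : IsFacet τ σ) {g : F.M τ}
    (hg : g ∈ F.facetSections τ (initialFacets σ s τ)) :
    ∃ g' ∈ F.facetSections σ (facetsBefore σ s τ), F.res hτ.le g' = g := by
  classical
  have hS := hF.isGradedSheaf
  let Λ : LowerSet Δ.Cone :=
    ⟨{γ | γ ≤ τ ∨ ∃ τ' ∈ facetsBefore σ s τ, γ ≤ τ'}, fun γ γ' h hγ =>
      hγ.imp (fun h1 => h.trans h1) fun ⟨τ', h1, h2⟩ => ⟨τ', h1, h.trans h2⟩⟩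
  -- The section is `g` on `⟨τ⟩` and zero elsewhere. It is compatible because, by `pure`, a face
  -- common to `τ` and an earlier facet lies in a facet of `τ` where `g` vanishes.
  let t : F.Sections Λ :=
    ⟨fun γ => if h : γ.1 ≤ τ then F.res h g else 0, by
      rintro ⟨γ, hγ⟩ ⟨γ', hγ'⟩ h
      by_cases h1 : γ ≤ τ
      · simp only [dif_pos h1, dif_pos (le_trans h h1), hS.res_res]
      · simp only [dif_neg h1, map_zero]
        by_cases h2 : γ' ≤ τ
        · rw [dif_pos h2]
          obtain ⟨τ', hτ', hle⟩ := hγ.resolve_left h1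
          obtain ⟨η, hη, hle'⟩ := hs.pure γ' τ τ' hτ hτ'.1 hτ'.2 h2 (le_trans h hle)
          rw [← hS.res_res hη.1.le hle', hg η hη.1.le hη, map_zero]
        · rw [dif_neg h2]⟩
  obtain ⟨t', ht'⟩ := hF.isFlabby _ t
  have key : ∀ (γ : Δ.Cone) (hγ : γ ∈ Λ) (hγσ : γ ≤ σ),
      F.res hγσ (t'.1 ⟨σ, trivial⟩) = if h : γ ≤ τ then F.res h g else 0 := by
    intro γ hγ hγσ
    rw [t'.2 ⟨σ, trivial⟩ ⟨γ, trivial⟩ hγσ]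
    exact congrFun (congrArg Subtype.val ht') ⟨γ, hγ⟩
  refine ⟨t'.1 ⟨σ, trivial⟩, fun τ' hle hτ' => ?_, ?_⟩
  · rw [key τ' (Or.inr ⟨τ', hτ', le_rfl⟩) hle, dif_neg]
    exact hτ'.1.not_le hτ (by rintro rfl; exact lt_irrefl _ hτ'.2)
  · rw [key τ (Or.inl le_rfl) hτ.le, dif_pos le_rfl, hS.res_self]

theorem facetSectionsRes_surjective (hF : F.IsPerverse) {τ σ : Δ.Cone} (hτ : IsFacet τ σ)
    {s : Δ.Cone → ℝ} (hs : IsShelling σ s) :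
    Function.Surjective (facetSectionsRes hF hτ s) := fun g =>
  let ⟨g', hg', h⟩ := exists_lift_facetSections hF hs hτ g.2
  ⟨⟨g', hg'⟩, Subtype.ext h⟩

/-- Adding `τ` to its predecessors replaces the module by the kernel of the surjective restriction
to `τ`, whose target is projective over `A_τ = A_σ/(h)`. -/
theorem finite_projective_of_isShelling (hF : F.IsPerverse) {σ : Δ.Cone} {s : Δ.Cone → ℝ}
    (hs : IsShelling σ s)
    (h : ∀ τ, IsFacet τ σ →
      Module.Projective (Poly τ.lin) (F.facetSections τ (initialFacets σ s τ))) (c : ℝ) :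
    Module.Finite (Poly σ.lin) (F.facetSections σ {τ | IsFacet τ σ ∧ s τ < c}) ∧
      Module.Projective (Poly σ.lin) (F.facetSections σ {τ | IsFacet τ σ ∧ s τ < c}) := by
  refine hs.induction (p := fun S => Module.Finite (Poly σ.lin) (F.facetSections σ S) ∧
    Module.Projective (Poly σ.lin) (F.facetSections σ S)) ?_ ?_ c
  · rw [facetSections_empty]
    have := hF.finite σ
    have := hF.free σ
    exact ⟨Module.Finite.equiv Submodule.topEquiv.symm,
      Module.Projective.of_equiv Submodule.topEquiv.symm⟩
  · rintro τ hτ ⟨h1, h2⟩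
    have h3 := h τ hτ
    let : Algebra (Poly σ.lin) (Poly τ.lin) :=
      (polyRes (Fan.Cone.lin_mono hτ.le)).toRingHom.toAlgebra
    exact finite_projective_ker_of_quotient (hτ.normal.ι_form_ne_zero)
      (polyRes_surjective (Fan.Cone.lin_mono hτ.le)) (hτ.normal.dvd_iff hτ.le)
      (Submodule.inclusion (facetSections_anti (Set.subset_insert _ _)))
      (Submodule.inclusion_injective _)
      (facetSectionsRes hF hτ s) (facetSectionsRes_smul hF hτ s)
      (facetSectionsRes_surjective hF hτ hs) (facetSectionsRes_eq_zero_iff hF hτ s)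

/-- The sections vanishing on the part of the boundary visible from some point form a finitely
generated projective module. -/
theorem finite_projective_facetSections (hF : F.IsPerverse) {σ : Δ.Cone} {S : Set Δ.Cone}
    (hS : IsVisible σ S) : Module.Finite (Poly σ.lin) (F.facetSections σ S) ∧
      Module.Projective (Poly σ.lin) (F.facetSections σ S) := by
  induction hn : Module.finrank ℝ σ.lin using Nat.strong_induction_on generalizing σ S with
  | _ n ih =>
    obtain ⟨s, hs, rfl⟩ := hS.exists_isShelling
    exact finite_projective_of_isShelling hF hs
      (fun τ hτ => (ih _ (hn ▸ Fan.Cone.finrank_lt hτ.lt) (hs.isVisible τ hτ) rfl).2) 0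

theorem finite_projective_relSections (hF : F.IsPerverse) (σ : Δ.Cone) :
    Module.Finite (Poly σ.lin) (F.relSections σ) ∧
      Module.Projective (Poly σ.lin) (F.relSections σ) := by
  rw [relSections_eq hF.isGradedSheaf]
  exact finite_projective_facetSections hF (isVisible_facets σ)

/-! ### Extending and lifting functionals -/

theorem phi_apply (hF : F.IsPerverse) {τ σ : Δ.Cone} (hτ : IsFacet τ σ) (N : FacetNormal τ σ)
    (f : F.HomRel σ) (g : F.relSections τ) {g' : F.M σ} (hg' : F.IsExtension hτ.le g.1 g') :
    phi hF hτ N f g = polyRes (Fan.Cone.lin_mono hτ.le) (f ⟨_, form_smul_mem hτ N hg'⟩) :=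
  value_unique hF hτ N f (exists_isExtension hF hτ g).choose_spec hg'

/-- Some nonzero polynomial multiplies all sections into the sections vanishing on the boundary. -/
theorem exists_smul_mem_relSections (F : ConeSystem.{u, w} Δ) (τ : Δ.Cone) :
    ∃ a : Poly τ.lin, a ≠ 0 ∧ ∀ x : F.M τ, a • x ∈ F.relSections τ := by
  classical
  have := Fintype.ofFinite Δ.Cone
  have h : ∀ γ : Δ.Cone, ∃ b : Poly τ.lin, b ≠ 0 ∧
      ∀ h : γ < τ, polyRes (Fan.Cone.lin_mono h.le) b = 0 := by
    intro γ
    by_cases hγ : γ < τ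
    · obtain ⟨η, hη, hle⟩ := exists_isFacet_of_lt hγ
      refine ⟨_, hη.normal.ι_form_ne_zero, fun _ => ?_⟩
      rw [← polyRes_polyRes (Fan.Cone.lin_mono hη.le) (Fan.Cone.lin_mono hle),
        polyRes_form hη.le, map_zero]
    · exact ⟨1, one_ne_zero, fun h => absurd h hγ⟩
  choose b hb hb' using h
  refine ⟨∏ γ, b γ, Finset.prod_ne_zero_iff.mpr fun γ _ => hb γ, fun x γ hγ => ?_⟩
  rw [F.res_smul, map_prod, Finset.prod_eq_zero (Finset.mem_univ γ) (hb' γ hγ), zero_smul]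

/-- Multiplication by an equation of a facet. -/
def formSMul {τ σ : Δ.Cone} (hτ : IsFacet τ σ) (S : Set Δ.Cone) :
    F.facetSections σ S →ₗ[Poly σ.lin] F.facetSections σ (insert τ S) :=
  (SymmetricAlgebra.ι ℝ _ hτ.normal.form • (F.facetSections σ S).subtype).codRestrict _ fun x => by
    rintro τ' hle hτ'
    change F.res hle (SymmetricAlgebra.ι ℝ _ hτ.normal.form • x.1) = 0
    rw [F.res_smul]
    rcases hτ' with rfl | hτ'
    · rw [polyRes_form hτ.le, zero_smul]
    · rw [x.2 τ' hle hτ', smul_zero]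

/-- The extension is `p ↦ f₁(h p) / h`, so `f₁(h p)` has to vanish on `τ`. After multiplication by a
suitable polynomial, `p` splits into an extension by zero of a section in `F_(τ, ∂τ)` and a section
in the domain of `f₁`. The first part contributes a value of `φ_h(f) = 0`, the second a multiple of
`h`. -/
theorem exists_extension_insert (hF : F.IsPerverse) {τ σ : Δ.Cone} (hτ : IsFacet τ σ)
    {S : Set Δ.Cone} (hS : S ⊆ {τ | IsFacet τ σ}) (hτS : τ ∉ S) (f : F.HomRel σ)
    (hf : phi hF hτ hτ.normal f = 0)
    (f₁ : F.facetSections σ (insert τ S) →ₗ[Poly σ.lin] Poly σ.lin)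
    (hf₁ : ∀ (x : F.relSections σ) (hx : x.1 ∈ F.facetSections σ (insert τ S)),
      f₁ ⟨x.1, hx⟩ = f x) :
    ∃ f₂ : F.facetSections σ S →ₗ[Poly σ.lin] Poly σ.lin,
      ∀ (x : F.relSections σ) (hx : x.1 ∈ F.facetSections σ S), f₂ ⟨x.1, hx⟩ = f x := by
  have hG := hF.isGradedSheaf
  set h : Poly σ.lin := SymmetricAlgebra.ι ℝ _ hτ.normal.form with hh
  have hins : insert τ S ⊆ {τ | IsFacet τ σ} := Set.insert_subset hτ hS
  let m := formSMul (F := F) hτ S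
  obtain ⟨f₂, hf₂⟩ := exists_extension_of_dvd hτ.normal.ι_form_ne_zero
    (Submodule.inclusion (facetSections_anti (Set.subset_insert τ S))) m
    (fun k => Subtype.ext rfl) f₁ (fun p => by
      rw [← hτ.normal.dvd_iff hτ.le]
      -- The factor `a` is nonzero on `τ` and `A_τ` is a domain, so it can be cancelled at the end.
      obtain ⟨a, ha, har⟩ := F.exists_smul_mem_relSections τ
      obtain ⟨a', rfl⟩ := polyRes_surjective (Fan.Cone.lin_mono hτ.le) a
      have hy : F.res hτ.le (a' • p.1) ∈ F.relSections τ := by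
        rw [F.res_smul]
        exact har _
      obtain ⟨g', hg'⟩ := exists_isExtension hF hτ ⟨_, hy⟩
      have hdiff : a' • p.1 - g' ∈ F.facetSections σ (insert τ S) := by
        rintro τ' hle (rfl | hτ')
        · rw [map_sub, hg'.res_eq, sub_self]
        · rw [map_sub, hg'.res_eq_zero τ' (hS hτ').lt
            ((hS hτ').not_le hτ (by rintro rfl; exact hτS hτ')), F.res_smul, p.2 τ' hle hτ',
            smul_zero, sub_zero]
      have hmem := form_smul_mem hτ hτ.normal hg'
      have h1 := congrArg (fun e => e ⟨_, hy⟩) hf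
      simp only [LinearMap.zero_apply] at h1
      rw [phi_apply hF hτ _ f _ hg'] at h1
      have h2 : a' • m p = ⟨_, relSections_le_facetSections hG hins hmem⟩ + h • ⟨_, hdiff⟩ := by
        apply Subtype.ext
        change a' • (h • p.1) = h • g' + h • (a' • p.1 - g')
        rw [smul_comm a' h, smul_sub, add_sub_cancel]
      have h3 := congrArg f₁ h2
      rw [map_smul, map_add, map_smul, hf₁ ⟨_, hmem⟩] at h3
      have h4 := congrArg (polyRes (Fan.Cone.lin_mono hτ.le)) h3
      rw [smul_eq_mul, smul_eq_mul, map_mul, map_add, map_mul, h1, hh, polyRes_form hτ.le,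
        zero_mul, add_zero] at h4
      exact (mul_eq_zero.mp h4).resolve_left ha)
  refine ⟨f₂, fun x hx => ?_⟩
  have hx' := relSections_le_facetSections hG hins x.2
  rw [← hf₁ x hx', ← hf₂]
  rfl

/-- A functional on `F_(σ, ∂σ)` whose restrictions to the facets outside of `S` are zero extends to
the sections that vanish on the facets in `S`. -/
theorem exists_extension_facetSections (hF : F.IsPerverse) {σ : Δ.Cone} {S : Set Δ.Cone}
    (hS : S ⊆ {τ | IsFacet τ σ}) (f : F.HomRel σ)
    (hf : ∀ (τ : Δ.Cone) (hτ : IsFacet τ σ), τ ∉ S → phi hF hτ hτ.normal f = 0) :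
    ∃ f' : F.facetSections σ S →ₗ[Poly σ.lin] Poly σ.lin,
      ∀ (x : F.relSections σ) (hx : x.1 ∈ F.facetSections σ S), f' ⟨x.1, hx⟩ = f x := by
  -- Here `T` is the set of facets on which sections no longer have to vanish. It grows from `∅`,
  -- where the domain is `F_(σ, ∂σ)`, to the complement of `S`.
  have key : ∀ T : Set Δ.Cone, T ⊆ {τ | IsFacet τ σ} → Disjoint T S →
      ∃ f' : F.facetSections σ ({τ | IsFacet τ σ} \ T) →ₗ[Poly σ.lin] Poly σ.lin,
        ∀ (x : F.relSections σ) (hx : x.1 ∈ F.facetSections σ ({τ | IsFacet τ σ} \ T)),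
          f' ⟨x.1, hx⟩ = f x := by
    intro T
    induction T, Set.toFinite T using Set.Finite.induction_on with
    | empty =>
      intro _ _
      refine ⟨f ∘ₗ Submodule.inclusion ?_, fun x hx => rfl⟩
      rw [Set.sdiff_empty, relSections_eq hF.isGradedSheaf]
    | @insert τ T hτT _ ih =>
      intro hT hTS
      rw [Set.insert_subset_iff] at hT
      rw [Set.disjoint_insert_left] at hTS
      have ih' := ih hT.2 hTS.2
      have he : {τ | IsFacet τ σ} \ T = insert τ ({τ | IsFacet τ σ} \ insert τ T) := by
        ext τ'
        simp only [Set.mem_sdiff, Set.mem_insert_iff, Set.mem_ofPred_eq]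
        constructor
        · rintro ⟨h1, h2⟩
          by_cases h3 : τ' = τ
          · exact Or.inl h3
          · exact Or.inr ⟨h1, by rintro (h | h); exacts [h3 h, h2 h]⟩
        · rintro (rfl | ⟨h1, h2⟩)
          · exact ⟨hT.1, hτT⟩
          · exact ⟨h1, fun h => h2 (Or.inr h)⟩
      rw [he] at ih'
      obtain ⟨f₁, hf₁⟩ := ih'
      exact exists_extension_insert hF hT.1 Set.sdiff_subset (fun h => h.2 (Or.inl rfl)) f
        (hf τ hT.1 hTS.1) f₁ hf₁
  have := key ({τ | IsFacet τ σ} \ S) Set.sdiff_subset Set.disjoint_sdiff_left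
  rwa [Set.sdiff_sdiff_cancel_left hS] at this

/-- One step of the construction of a functional with given restrictions to the facets, along a
shelling in descending order. -/
theorem exists_functional_facet (hF : F.IsPerverse) {τ σ : Δ.Cone} {s : Δ.Cone → ℝ}
    (hs : IsShelling σ s) (hτ : IsFacet τ σ) (d : F.HomRel τ)
    (hd : ∀ (η : Δ.Cone) (hη : IsFacet η τ), η ∉ initialFacets σ s τ →
      phi hF hη hη.normal d = 0) :
    ∃ e : F.HomRel σ, phi hF hτ hτ.normal e = d ∧
      ∀ (τ' : Δ.Cone) (hτ' : IsFacet τ' σ), s τ < s τ' → phi hF hτ' hτ'.normal e = 0 := by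
  have hG := hF.isGradedSheaf
  obtain ⟨d', hd'⟩ := exists_extension_facetSections hF (fun η hη => hη.1) d hd
  have hproj : Module.Projective (Poly σ.lin) (F.facetSections σ (facetsBefore σ s τ)) :=
    (finite_projective_of_isShelling hF hs
      (fun τ hτ => (finite_projective_facetSections hF (hs.isVisible τ hτ)).2) (s τ)).2
  let : Algebra (Poly σ.lin) (Poly τ.lin) :=
    (polyRes (Fan.Cone.lin_mono hτ.le)).toRingHom.toAlgebra
  set h : Poly σ.lin := SymmetricAlgebra.ι ℝ _ hτ.normal.form with hh
  have hins : insert τ (facetsBefore σ s τ) ⊆ {τ | IsFacet τ σ} :=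
    Set.insert_subset hτ fun τ' h => h.1
  let m : F.facetSections σ (facetsBefore σ s τ) →ₗ[Poly σ.lin]
      F.facetSections σ (insert τ (facetsBefore σ s τ)) := formSMul hτ _
  -- The extended functional `d'` on the quotient `F_S / F_{S ∪ τ}` is sent through the connecting
  -- map. The result satisfies `e(h p)|_τ = d'(p|_τ)`, which is the defining formula of `φ_h` when
  -- `p` extends a section by zero.
  obtain ⟨e, he⟩ := exists_functional_of_quotient hτ.normal.ι_form_ne_zero
    (polyRes_surjective (Fan.Cone.lin_mono hτ.le)) (hτ.normal.dvd_iff hτ.le)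
    (Submodule.inclusion (facetSections_anti (Set.subset_insert τ (facetsBefore σ s τ)))) m
    (fun p => Subtype.ext rfl) (facetSectionsRes hF hτ s) (facetSectionsRes_smul hF hτ s)
    (fun k => (facetSectionsRes_eq_zero_iff hF hτ s _).mpr ⟨k, rfl⟩) d'
  have hle := relSections_le_facetSections hG hins
  refine ⟨e ∘ₗ Submodule.inclusion hle, LinearMap.ext fun g => ?_, fun τ' hτ' hlt =>
    LinearMap.ext fun g => ?_⟩
  · obtain ⟨g', hg'⟩ := exists_isExtension hF hτ g
    rw [phi_apply hF hτ _ _ g hg']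
    have hmem : g' ∈ F.facetSections σ (facetsBefore σ s τ) := fun τ' _ hτ' =>
      hg'.res_eq_zero τ' hτ'.1.lt (hτ'.1.not_le hτ (by rintro rfl; exact lt_irrefl _ hτ'.2))
    have h1 := relSections_le_facetSections hG (S := initialFacets σ s τ) (fun η hη => hη.1) g.2
    refine (he ⟨g', hmem⟩).trans ?_
    rw [← hd' g h1]
    exact congrArg d' (Subtype.ext hg'.res_eq)
  · obtain ⟨g', hg'⟩ := exists_isExtension hF hτ' g
    rw [phi_apply hF hτ' _ _ g hg']
    have hmem : g' ∈ F.facetSections σ (insert τ (facetsBefore σ s τ)) := by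
      intro τ'' hle hτ''
      have hs'' : s τ'' < s τ' := by
        rcases hτ'' with rfl | h''
        · exact hlt
        · exact h''.2.trans hlt
      exact hg'.res_eq_zero τ'' (hins hτ'').lt
        ((hins hτ'').not_le hτ' (by rintro rfl; exact lt_irrefl _ hs''))
    -- For a later facet `τ'` the extension `g'` already lies in the domain of `e`, so the equation
    -- of `τ'` factors out of the value and dies on `τ'`.
    have h1 : (e ∘ₗ Submodule.inclusion hle) ⟨_, form_smul_mem hτ' hτ'.normal hg'⟩ =
        SymmetricAlgebra.ι ℝ _ hτ'.normal.form * e ⟨g', hmem⟩ := by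
      rw [← smul_eq_mul, ← map_smul]
      rfl
    rw [h1, map_mul, polyRes_form hτ'.le, zero_mul]
    rfl

/-- Functionals on the facets of `σ` that agree in codimension two are the restrictions of a
functional on `σ`, for restriction maps that are multiples of the maps `φ_h`. -/
theorem exists_functional_of_compatible (hF : F.IsPerverse)
    (ρ : ∀ {τ σ : Δ.Cone}, IsFacet τ σ → (F.HomRel σ →ₗ[ℝ] F.HomRel τ))
    (hρ : ∀ {τ σ : Δ.Cone} (hτ : IsFacet τ σ), ∃ κ : ℝ, κ ≠ 0 ∧ ρ hτ = κ • phi hF hτ hτ.normal)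
    (hcomm : ∀ {η τ τ' σ : Δ.Cone} (hη : IsFacet η τ) (hη' : IsFacet η τ') (hτ : IsFacet τ σ)
      (hτ' : IsFacet τ' σ) (f : F.HomRel σ), ρ hη (ρ hτ f) = ρ hη' (ρ hτ' f))
    {σ : Δ.Cone} (t : ∀ τ : Δ.Cone, IsFacet τ σ → F.HomRel τ)
    (ht : ∀ {η τ τ' : Δ.Cone} (hη : IsFacet η τ) (hη' : IsFacet η τ') (hτ : IsFacet τ σ)
      (hτ' : IsFacet τ' σ), ρ hη (t τ hτ) = ρ hη' (t τ' hτ')) :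
    ∃ f : F.HomRel σ, ∀ (τ : Δ.Cone) (hτ : IsFacet τ σ), ρ hτ f = t τ hτ := by
  obtain ⟨s, hs, hneg⟩ := exists_isShelling σ
  let p : Set Δ.Cone → Prop := fun T => ∃ f : F.HomRel σ, ∀ (τ : Δ.Cone) (hτ : IsFacet τ σ),
    τ ∉ T → ρ hτ f = t τ hτ
  -- Here `p T` says that some functional is correct outside `T`. Proving `p T → p ∅` by ascending
  -- induction amounts to correcting the facets in descending order, starting from the zero
  -- functional.
  have key := hs.induction (p := fun T => p T → p ∅) id (fun τ hτ ih ⟨f, hf⟩ => ih ?_) 0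
  · obtain ⟨f, hf⟩ := key ⟨0, fun τ hτ h => absurd ⟨hτ, hneg τ hτ⟩ h⟩
    exact ⟨f, fun τ hτ => hf τ hτ (Set.notMem_empty τ)⟩
  obtain ⟨κ, hκ, hκe⟩ := hρ hτ
  obtain ⟨e, he, he'⟩ := exists_functional_facet hF hs hτ (κ⁻¹ • (t τ hτ - ρ hτ f))
    fun η hη hηs => by
      -- The neighbour of `τ` across `η` comes later, since `η` is not an initial facet. The
      -- functional is already correct there, so by compatibility the error on `τ` restricts to zero
      -- on `η`.
      obtain ⟨τ', hτ', hle, hnle⟩ := exists_other_facet hη.lt hτ.le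
      have hne : τ' ≠ τ := by rintro rfl; exact hnle le_rfl
      have hlt : η < τ' := lt_of_le_of_ne hle (by
        rintro rfl
        exact hnle (hη.eq_of_le_of_lt le_rfl hη.lt ▸ (hτ'.eq_of_le_of_lt hη.le hτ.lt).le))
      have hη' : IsFacet η τ' := ⟨hle, by
        have h1 := hη.finrank_eq
        have h2 := hτ.finrank_eq
        have h3 := hτ'.finrank_eq
        omega⟩
      have hτ'T : τ' ∉ insert τ (facetsBefore σ s τ) := by
        rintro (h | h)
        · exact hne h
        · exact hηs ⟨hη, τ', hτ', hle, h.2⟩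
      obtain ⟨c, hc, hce⟩ := hρ hη
      have h0 : ρ hη (t τ hτ - ρ hτ f) = 0 := by
        rw [map_sub, hcomm hη hη' hτ hτ', hf τ' hτ' hτ'T, ht hη hη' hτ hτ', sub_self]
      rw [hce, LinearMap.smul_apply] at h0
      rw [map_smul, (smul_eq_zero.mp h0).resolve_left hc, smul_zero]
  refine ⟨f + e, fun τ' hτ' hτ'T => ?_⟩
  by_cases hττ : τ' = τ
  · subst hττ
    rw [map_add]
    nth_rewrite 2 [hκe]
    rw [LinearMap.smul_apply, he, smul_smul, mul_inv_cancel₀ hκ, one_smul, add_sub_cancel]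
  · obtain ⟨c, _, hce⟩ := hρ hτ'
    have hlt : s τ < s τ' := by
      refine lt_of_le_of_ne (not_lt.mp fun h => hτ'T ⟨hτ', h⟩) fun h => ?_
      exact hττ (hs.inj _ _ hτ hτ' h).symm
    have h0 : ρ hτ' e = 0 := by
      rw [hce, LinearMap.smul_apply, he' τ' hτ' hlt, smul_zero]
    rw [map_add, h0, add_zero]
    exact hf τ' hτ' (by rintro (h | h); exacts [hττ h, hτ'T h])

end ConeSystem

/-! ### Contraction of top-degree forms -/

section Forms

variable {V : Type u} [AddCommGroup V] [Module ℝ V]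

/-- The contraction `ω ↦ ω(n, ·, …, ·)|_{U'}` for forms of any degree. -/
def contractForm {U' U : Submodule ℝ V} (h : U' ≤ U) {k m : ℕ} (hd : k + 1 = m) (n : U)
    (ω : U [⋀^Fin m]→ₗ[ℝ] ℝ) : U' [⋀^Fin k]→ₗ[ℝ] ℝ :=
  (AlternatingMap.curryLeft (ω.domDomCongr (finCongr hd.symm)) n).compLinearMap
    (Submodule.inclusion h)

/-- Modulo `U''` one has `n₁ ≡ a v₂ + x v₁` and `n₂ ≡ b v₁ + y v₂`. As vectors of `U''` do not
contribute, both sides reduce to `a b ω(v₂, v₁, …)`; the sign is the antisymmetry of `ω`. -/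
theorem contractForm_contractForm_swap {U'' U₁ U₂ U : Submodule ℝ V} (h₁ : U₁ ≤ U) (h₂ : U₂ ≤ U)
    (k₁ : U'' ≤ U₁) (k₂ : U'' ≤ U₂) {r m₁ m₂ m : ℕ} (d₁ : r + 1 = m₁) (d₂ : r + 1 = m₂)
    (e₁ : m₁ + 1 = m) (e₂ : m₂ + 1 = m) (hr : Module.finrank ℝ U'' = r)
    [FiniteDimensional ℝ U''] (n₁ n₂ : U) (v₁ : U₁) (v₂ : U₂) (a b : ℝ) (x y : ℝ)
    (hn₁ : (n₁ : V) - a • (v₂ : V) - x • (v₁ : V) ∈ U'')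
    (hn₂ : (n₂ : V) - b • (v₁ : V) - y • (v₂ : V) ∈ U'') (ω : U [⋀^Fin m]→ₗ[ℝ] ℝ) :
    b • contractForm k₁ d₁ v₁ (contractForm h₁ e₁ n₁ ω) =
      -(a • contractForm k₂ d₂ v₂ (contractForm h₂ e₂ n₂ ω)) := by
  subst d₁
  subst d₂
  subst e₁
  ext v
  let i₁ := Submodule.inclusion h₁
  let i₂ := Submodule.inclusion h₂
  let v' : Fin r → U := fun i => Submodule.inclusion (k₁.trans h₁) (v i)
  let B : U → U → ℝ := fun p q => ω (Matrix.vecCons p (Matrix.vecCons q v'))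
  have hB₁ : contractForm k₁ rfl v₁ (contractForm h₁ rfl n₁ ω) v = B n₁ (i₁ v₁) := by
    simp only [contractForm, B, finCongr_refl, AlternatingMap.domDomCongr_refl,
      AlternatingMap.compLinearMap_apply, AlternatingMap.curryLeft_apply_apply]
    congr 1
    ext i
    refine Fin.cases rfl (fun j => ?_) i
    refine Fin.cases rfl (fun l => rfl) j
  have hB₂ : contractForm k₂ rfl v₂ (contractForm h₂ e₂ n₂ ω) v = B n₂ (i₂ v₂) := by
    simp only [contractForm, B, finCongr_refl, AlternatingMap.domDomCongr_refl,
      AlternatingMap.compLinearMap_apply, AlternatingMap.curryLeft_apply_apply]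
    congr 1
    ext i
    refine Fin.cases rfl (fun j => ?_) i
    refine Fin.cases rfl (fun l => rfl) j
  have hadd : ∀ p p' q, B (p + p') q = B p q + B p' q := fun p p' q =>
    ω.map_vecCons_add _ p p'
  have hsmul : ∀ (c : ℝ) p q, B (c • p) q = c * B p q := fun c p q =>
    ω.map_vecCons_smul _ c p
  have hself : ∀ p, B p p = 0 := fun p =>
    ω.map_eq_zero_of_eq _ (i := 0) (j := 1) rfl (by simp)
  have hswap : ∀ p q, B p q = -B q p := fun p q => by
    have := ω.map_swap (Matrix.vecCons q (Matrix.vecCons p v')) (i := 0) (j := 1) (by simp)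
    refine Eq.trans ?_ this
    change ω _ = ω _
    congr 1
    ext i
    refine Fin.cases ?_ (fun j => ?_) i
    · simp
    · refine Fin.cases ?_ (fun l => ?_) j
      · simp
      · rw [Function.comp_apply, Equiv.swap_apply_of_ne_of_ne]
        · rfl
        · exact Fin.succ_ne_zero _
        · intro h
          exact Fin.succ_ne_zero _ (Fin.succ_injective _ h)
  -- With `p`, there are `r + 1` arguments in the `r`-dimensional space `U''`, hence they are
  -- dependent.
  have hzero : ∀ (p q : U), (p : V) ∈ U'' → B p q = 0 := fun p q hp => by
    rw [hswap]
    let β := (ω.curryLeft q).compLinearMap (Submodule.inclusion (k₁.trans h₁))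
    have h1 : β (Matrix.vecCons ⟨p, hp⟩ v) = 0 := by
      refine AlternatingMap.map_linearDependent _ _ fun hli => ?_
      have := hli.fintype_card_le_finrank
      rw [Fintype.card_fin] at this
      omega
    have h2 : β (Matrix.vecCons ⟨p, hp⟩ v) = B q p := by
      simp only [β, B, AlternatingMap.compLinearMap_apply, AlternatingMap.curryLeft_apply_apply]
      congr 1
      ext i
      refine Fin.cases rfl (fun j => ?_) i
      refine Fin.cases rfl (fun l => rfl) j
    rw [← h2, h1, neg_zero]
  have e₁ : B n₁ (i₁ v₁) = a * B (i₂ v₂) (i₁ v₁) := by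
    have : n₁ = a • i₂ v₂ + x • i₁ v₁ + (n₁ - a • i₂ v₂ - x • i₁ v₁) := by abel
    rw [this, hadd, hadd, hsmul, hsmul, hself, hzero (n₁ - a • i₂ v₂ - x • i₁ v₁) _ hn₁]
    ring
  have e₂ : B n₂ (i₂ v₂) = b * B (i₁ v₁) (i₂ v₂) := by
    have : n₂ = b • i₁ v₁ + y • i₂ v₂ + (n₂ - b • i₁ v₁ - y • i₂ v₂) := by abel
    rw [this, hadd, hadd, hsmul, hsmul, hself, hzero (n₂ - b • i₁ v₁ - y • i₂ v₂) _ hn₂]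
    ring
  rw [AlternatingMap.neg_apply, AlternatingMap.smul_apply, AlternatingMap.smul_apply, hB₁, hB₂,
    e₁, e₂, hswap (i₁ v₁)]
  simp only [smul_eq_mul]
  ring

theorem exists_eq_smul_detDual [FiniteDimensional ℝ V] {U : Submodule ℝ V} {ω : DetDual U}
    (hω : ω ≠ 0) (ω' : DetDual U) : ∃ c : ℝ, ω' = c • ω := by
  let b := Module.finBasis ℝ U
  have h1 := ω.eq_smul_basis_det b
  have h2 := ω'.eq_smul_basis_det b
  have h3 : ω b ≠ 0 := fun h => hω (by rw [h1, h, zero_smul])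
  have h4 : b.det = (ω b)⁻¹ • ω := (eq_inv_smul_iff₀ h3).mpr h1.symm
  exact ⟨ω' b * (ω b)⁻¹, h2.trans (by rw [mul_smul, ← h4])⟩

/-- The vector `n` completes a basis of `U'` to a basis of `U`, and a top-degree form vanishing on a
basis is zero. -/
theorem contract_ne_zero [FiniteDimensional ℝ V] {U' U : Submodule ℝ V} (h : U' ≤ U)
    (hd : Module.finrank ℝ U' + 1 = Module.finrank ℝ U) {n : U} (hn : (n : V) ∉ U')
    {ω : DetDual U} (hω : ω ≠ 0) : contract h hd n ω ≠ 0 := by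
  intro h0
  let b := Module.finBasis ℝ U'
  let v : Fin (Module.finrank ℝ U' + 1) → U := Matrix.vecCons n fun i => Submodule.inclusion h (b i)
  have hv : LinearIndependent ℝ v := by
    refine linearIndependent_finCons.mpr ⟨?_, fun hmem => hn ?_⟩
    · exact b.linearIndependent.map' _ (Submodule.ker_inclusion _ _ h)
    · have : Submodule.span ℝ (Set.range fun i => Submodule.inclusion h (b i)) ≤
          U'.comap U.subtype := by
        rw [Submodule.span_le]
        rintro _ ⟨i, rfl⟩
        exact (b i).2
      exact this hmem
  let b' : Module.Basis (Fin (Module.finrank ℝ U' + 1)) ℝ U :=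
    basisOfLinearIndependentOfCardEqFinrank hv (by rw [Fintype.card_fin, hd])
  have h1 : (ω.domDomCongr (finCongr hd.symm)) b' = 0 := by
    have := DFunLike.congr_fun h0 fun i => b i
    rw [coe_basisOfLinearIndependentOfCardEqFinrank]
    exact this
  have h2 := (AlternatingMap.map_basis_eq_zero_iff b' (ω.domDomCongr (finCongr hd.symm))).mp h1
  exact hω ((AlternatingMap.domDomCongr_eq_zero_iff _ _).mp h2)

end Forms

/-! ### Transition signs and faces of codimension two -/

section Orientations

variable {V : Type u} [AddCommGroup V] [Module ℝ V] {Δ : Fan V}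

/-- A form on `V_σ` that is positive for the given orientation. -/
def posForm (o : ConeOrientations Δ) (σ : Δ.Cone) : DetDual σ.lin := (o σ).someVector

theorem posForm_ne_zero (o : ConeOrientations Δ) (σ : Δ.Cone) : posForm o σ ≠ 0 :=
  (o σ).someVector_ne_zero

theorem FacetNormal.vec_notMem {τ σ : Δ.Cone} (N : FacetNormal τ σ) : (N.vec : V) ∉ τ.lin :=
  fun h => by
    have := (N.ker_form N.vec).mpr h
    rw [N.form_vec] at this
    exact one_ne_zero this

theorem transitionSign_mul_self (o : ConeOrientations Δ) {τ σ : Δ.Cone} (hτ : IsFacet τ σ)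
    (N : FacetNormal τ σ) : transitionSign o hτ N * transitionSign o hτ N = 1 := by
  rw [transitionSign]
  split_ifs <;> norm_num

variable [FiniteDimensional ℝ V]

/-- The transition sign is defined so as to turn the contracted positive form into a positive one.
After trivializing the determinant lines by positive forms, only a positive scalar is left. -/
theorem exists_transitionSign_smul_contract (o : ConeOrientations Δ) {τ σ : Δ.Cone}
    (hτ : IsFacet τ σ) (N : FacetNormal τ σ) : ∃ κ : ℝ, 0 < κ ∧
      transitionSign o hτ N • contract (Fan.Cone.lin_mono hτ.le) hτ.finrank_eq N.vec (posForm o σ) =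
        κ • posForm o τ := by
  set C := contract (Fan.Cone.lin_mono hτ.le) hτ.finrank_eq N.vec
  obtain ⟨c, hc⟩ := exists_eq_smul_detDual (posForm_ne_zero o τ) (C (posForm o σ))
  have hC : C (posForm o σ) ≠ 0 := contract_ne_zero _ _ N.vec_notMem (posForm_ne_zero o σ)
  have hc0 : c ≠ 0 := by
    rintro rfl
    exact hC (by rw [hc, zero_smul])
  rcases lt_or_gt_of_ne hc0 with hneg | hpos
  · refine ⟨-c, by linarith, ?_⟩
    rw [transitionSign, if_neg, hc, smul_smul, neg_one_mul]
    rintro ⟨ω, h, h', h1, h2⟩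
    rw [← (o σ).someVector_ray, ray_eq_iff] at h1
    rw [← (o τ).someVector_ray, ray_eq_iff] at h2
    obtain ⟨r, hr, hr'⟩ := h1.exists_pos_right h (posForm_ne_zero o σ)
    obtain ⟨t, ht, ht'⟩ := h2.exists_pos_right h' (posForm_ne_zero o τ)
    have h3 : C ω = (r * c) • posForm o τ := by
      rw [mul_smul, ← hc, ← map_smul]
      exact congrArg C hr'
    have h4 : (r * c) • posForm o τ = t • posForm o τ := h3.symm.trans ht'
    have h5 := smul_left_injective ℝ (posForm_ne_zero o τ) h4
    have := mul_neg_of_pos_of_neg hr hneg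
    beta_reduce at h5
    linarith
  · refine ⟨c, hpos, ?_⟩
    rw [transitionSign, if_pos, one_smul, hc]
    refine ⟨posForm o σ, posForm_ne_zero o σ, hC, (o σ).someVector_ray, ?_⟩
    rw [← (o τ).someVector_ray, ray_eq_iff]
    change SameRay ℝ (C (posForm o σ)) (posForm o τ)
    rw [hc]
    exact SameRay.sameRay_pos_smul_left _ hpos

/-- The positive number by which contraction with the chosen normal vector differs from the positive
form of a facet. -/
def facetScale (o : ConeOrientations Δ) {τ σ : Δ.Cone} (hτ : IsFacet τ σ) : ℝ :=
  (exists_transitionSign_smul_contract o hτ hτ.normal).choose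

theorem facetScale_pos (o : ConeOrientations Δ) {τ σ : Δ.Cone} (hτ : IsFacet τ σ) :
    0 < facetScale o hτ :=
  (exists_transitionSign_smul_contract o hτ hτ.normal).choose_spec.1

theorem transitionSign_smul_contract (o : ConeOrientations Δ) {τ σ : Δ.Cone} (hτ : IsFacet τ σ) :
    transitionSign o hτ hτ.normal •
      contract (Fan.Cone.lin_mono hτ.le) hτ.finrank_eq hτ.normal.vec (posForm o σ) =
        facetScale o hτ • posForm o τ :=
  (exists_transitionSign_smul_contract o hτ hτ.normal).choose_spec.2

/-- On `V_τ` both forms vanish on the hyperplane `V_η`, neither is identically zero, and both are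
nonnegative on `τ`. -/
theorem exists_form_eq_mul_form {η τ τ' σ : Δ.Cone} (hη : IsFacet η τ) (hτ : IsFacet τ σ)
    (hτ' : IsFacet τ' σ) (hle : η ≤ τ') (hne : τ' ≠ τ) :
    ∃ c : ℝ, 0 < c ∧ ∀ x ∈ τ.lin, hη.form x = c * hτ'.form x := by
  obtain ⟨n, hn, hc⟩ := hη.exists_apply_eq_apply_mul_form hτ'.form
    (fun x hx => (hτ'.form_eq_zero_iff (Fan.Cone.lin_mono (hle.trans hτ'.le) hx)).mpr
      (Fan.Cone.lin_mono hle hx))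
  have hc1 : hτ'.form n ≠ 0 := by
    intro h0
    refine hτ.not_le hτ' hne fun x hx => ?_
    have := hc x (τ.subset_lin hx)
    rw [h0, zero_mul] at this
    exact (hτ'.form_eq_zero_iff_mem (hτ.le hx)).mp this
  refine ⟨(hτ'.form n)⁻¹, inv_pos.mpr (lt_of_le_of_ne (hτ'.form_nonneg (hτ.le hn)) hc1.symm),
    fun x hx => ?_⟩
  rw [hc x hx, inv_mul_cancel_left₀ hc1]

/-- A face of codimension two lies in at most two facets. -/
theorem eq_or_eq_of_isFacet {η τ τ' γ σ : Δ.Cone} (hη : IsFacet η τ) (hτ : IsFacet τ σ)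
    (hτ' : IsFacet τ' σ) (hγ : IsFacet γ σ) (hle' : η ≤ τ') (hle : η ≤ γ) (hne : τ' ≠ τ) :
    γ = τ ∨ γ = τ' := by
  by_contra! hγne
  obtain ⟨c, hc, hc'⟩ := exists_form_eq_mul_form hη hτ hτ' hle' hne
  obtain ⟨d, hd, hd'⟩ := exists_form_eq_mul_form hη hτ hγ hle hγne.1
  obtain ⟨n, hn, hα⟩ := hτ.exists_apply_eq_apply_mul_form (d • hγ.form - c • hτ'.form)
    (fun x hx => by
      have h1 := hc' x hx
      have h2 := hd' x hx
      simp only [LinearMap.sub_apply, LinearMap.smul_apply, smul_eq_mul]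
      linarith)
  simp only [LinearMap.sub_apply, LinearMap.smul_apply, smul_eq_mul] at hα
  -- The forms of `γ` and `τ'`, scaled by `d` and `c`, agree on `V_τ`, so on `V_σ` they differ by
  -- `α` times the form of `τ`. A point of `τ'` outside `γ` gives `α > 0`; a point of `γ` outside
  -- `τ` then gives a contradiction of signs.
  set α := d * hγ.form n - c * hτ'.form n
  obtain ⟨y, hy, hyγ⟩ := Set.not_subset.mp (hτ'.not_le hγ hγne.2)
  obtain ⟨z, hz, hzτ⟩ := Set.not_subset.mp (hγ.not_le hτ hγne.1.symm)
  have hyσ := hτ'.le hy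
  have hzσ := hγ.le hz
  have e1 := hα y (σ.subset_lin hyσ)
  have e2 := hα z (σ.subset_lin hzσ)
  rw [(hτ'.form_eq_zero_iff_mem hyσ).mpr hy] at e1
  rw [(hγ.form_eq_zero_iff_mem hzσ).mpr hz] at e2
  have p1 : 0 < hγ.form y := lt_of_le_of_ne (hγ.form_nonneg hyσ)
    fun h => hyγ ((hγ.form_eq_zero_iff_mem hyσ).mp h.symm)
  have p2 : 0 < hτ.form z := lt_of_le_of_ne (hτ.form_nonneg hzσ)
    fun h => hzτ ((hτ.form_eq_zero_iff_mem hzσ).mp h.symm)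
  have p3 := mul_pos hd p1
  have hαpos : 0 < α := by
    by_contra! h
    have := mul_nonpos_of_nonpos_of_nonneg h (hτ.form_nonneg hyσ)
    linarith
  have p4 := mul_pos hαpos p2
  have p5 := mul_nonneg hc.le (hτ'.form_nonneg hzσ)
  linarith

/-- The forms of `τ` and `τ'` are coordinates on `V_σ / V_η`. Expanding the normal vectors in these
coordinates gives the coefficients required by `contractForm_contractForm_swap`. -/
theorem contract_contract_swap {η τ τ' σ : Δ.Cone} (hη : IsFacet η τ) (hη' : IsFacet η τ')
    (hτ : IsFacet τ σ) (hτ' : IsFacet τ' σ) {a b : ℝ}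
    (hb : ∀ x ∈ τ.lin, hη.form x = b * hτ'.form x)
    (ha : ∀ x ∈ τ'.lin, hη'.form x = a * hτ.form x) (ω : DetDual σ.lin) :
    b • contract (Fan.Cone.lin_mono hη.le) hη.finrank_eq hη.normal.vec
        (contract (Fan.Cone.lin_mono hτ.le) hτ.finrank_eq hτ.normal.vec ω) =
      -(a • contract (Fan.Cone.lin_mono hη'.le) hη'.finrank_eq hη'.normal.vec
        (contract (Fan.Cone.lin_mono hτ'.le) hτ'.finrank_eq hτ'.normal.vec ω)) := by
  set n₁ := hτ.normal.vec
  set n₂ := hτ'.normal.vec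
  set v₁ := hη.normal.vec
  set v₂ := hη'.normal.vec
  have f₁ : hτ.form n₁ = 1 := (hτ.form_coe _).trans hτ.normal.form_vec
  have f₂ : hτ'.form n₂ = 1 := (hτ'.form_coe _).trans hτ'.normal.form_vec
  have g₁ : b * hτ'.form v₁ = 1 := by
    rw [← hb _ v₁.2]; exact (hη.form_coe _).trans hη.normal.form_vec
  have g₂ : a * hτ.form v₂ = 1 := by
    rw [← ha _ v₂.2]; exact (hη'.form_coe _).trans hη'.normal.form_vec
  have z₁ : hτ.form v₁ = 0 :=
    (hτ.form_eq_zero_iff (Fan.Cone.lin_mono hτ.le v₁.2)).mpr v₁.2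
  have z₂ : hτ'.form v₂ = 0 :=
    (hτ'.form_eq_zero_iff (Fan.Cone.lin_mono hτ'.le v₂.2)).mpr v₂.2
  have key : ∀ k ∈ σ.lin, hτ.form k = 0 → hτ'.form k = 0 → k ∈ η.lin := fun k hk h1 h2 => by
    have h3 := (hτ.form_eq_zero_iff hk).mp h1
    refine (hη.form_eq_zero_iff h3).mp ?_
    rw [hb k h3, h2, mul_zero]
  have m₁ : (v₁ : V) ∈ σ.lin := Fan.Cone.lin_mono hτ.le v₁.2
  have m₂ : (v₂ : V) ∈ σ.lin := Fan.Cone.lin_mono hτ'.le v₂.2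
  refine contractForm_contractForm_swap (Fan.Cone.lin_mono hτ.le) (Fan.Cone.lin_mono hτ'.le)
    (Fan.Cone.lin_mono hη.le) (Fan.Cone.lin_mono hη'.le) hη.finrank_eq hη'.finrank_eq
    hτ.finrank_eq hτ'.finrank_eq rfl n₁ n₂ v₁ v₂ a b (hτ'.form n₁ * b) (hτ.form n₂ * a) ?_ ?_ ω
  · refine key _ (sub_mem (sub_mem n₁.2 (Submodule.smul_mem _ _ m₂))
      (Submodule.smul_mem _ _ m₁)) ?_ ?_
    · simp only [map_sub, map_smul, smul_eq_mul, f₁, g₂, z₁]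
      ring
    · simp only [map_sub, map_smul, smul_eq_mul, z₂, mul_assoc, g₁]
      ring
  · refine key _ (sub_mem (sub_mem n₂.2 (Submodule.smul_mem _ _ m₁))
      (Submodule.smul_mem _ _ m₂)) ?_ ?_
    · simp only [map_sub, map_smul, smul_eq_mul, z₁, mul_assoc, g₂]
      ring
    · simp only [map_sub, map_smul, smul_eq_mul, f₂, g₁, z₂]
      ring

end Orientations

/-! ### Independence of the restriction maps of the chain of facets -/

namespace ConeSystem

variable {V : Type u} [AddCommGroup V] [Module ℝ V] [FiniteDimensional ℝ V] {Δ : Fan V}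
  {F : ConeSystem.{u, w} Δ}

/-- The restriction map for a facet in terms of functionals. -/
def facetRes (hF : F.IsPerverse) (o : ConeOrientations Δ) {τ σ : Δ.Cone} (hτ : IsFacet τ σ) :
    F.HomRel σ →ₗ[ℝ] F.HomRel τ :=
  facetScale o hτ • phi hF hτ hτ.normal

/-- The identification `Hom(F_(σ, ∂σ), A_σ) ≅ (DF)_σ` given by a positive form. -/
def stalkEquiv (F : ConeSystem.{u, w} Δ) (o : ConeOrientations Δ) (σ : Δ.Cone) :
    F.HomRel σ ≃ₗ[Poly σ.lin] F.DualStalk σ :=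
  let e : ℝ ≃ₗ[ℝ] DetDual σ.lin :=
    LinearEquiv.ofBijective (LinearMap.toSpanSingleton ℝ _ (posForm o σ))
      ⟨smul_left_injective ℝ (posForm_ne_zero o σ), fun ω =>
        let ⟨c, hc⟩ := exists_eq_smul_detDual (posForm_ne_zero o σ) ω
        ⟨c, hc.symm⟩⟩
  (TensorProduct.AlgebraTensorModule.rid ℝ (Poly σ.lin) (F.HomRel σ)).symm ≪≫ₗ
    TensorProduct.AlgebraTensorModule.congr (LinearEquiv.refl _ _) e

theorem stalkEquiv_apply (o : ConeOrientations Δ) (σ : Δ.Cone) (f : F.HomRel σ) :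
    F.stalkEquiv o σ f = f ⊗ₜ posForm o σ := by
  simp only [stalkEquiv, LinearEquiv.trans_apply,
    TensorProduct.AlgebraTensorModule.rid_symm_apply,
    TensorProduct.AlgebraTensorModule.congr_tmul, LinearEquiv.refl_apply]
  exact congrArg (fun ω => f ⊗ₜ[ℝ] ω) (one_smul ℝ (posForm o σ))

theorem dualFacetRes_stalkEquiv (hF : F.IsPerverse) (o : ConeOrientations Δ) {τ σ : Δ.Cone}
    (hτ : IsFacet τ σ) (f : F.HomRel σ) :
    dualFacetRes hF o hτ (F.stalkEquiv o σ f) = F.stalkEquiv o τ (facetRes hF o hτ f) := by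
  rw [stalkEquiv_apply, stalkEquiv_apply]
  simp only [dualFacetRes, facetRes, LinearMap.smul_apply, TensorProduct.map_tmul]
  rw [← TensorProduct.tmul_smul, transitionSign_smul_contract, TensorProduct.tmul_smul,
    TensorProduct.smul_tmul']

/-- Sections over two facets that extend the same section over a common facet extend to a section
that vanishes on the faces contained in neither of them. -/
theorem exists_isExtension_pair (hF : F.IsPerverse) {η τ τ' σ : Δ.Cone} (hη : IsFacet η τ)
    (hη' : IsFacet η τ') (hτ : IsFacet τ σ) (hτ' : IsFacet τ' σ) (hne : τ' ≠ τ) {g : F.M η}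
    (hg : g ∈ F.relSections η) {g₁ : F.M τ} {g₂ : F.M τ'}
    (h₁ : F.IsExtension hη.le g g₁) (h₂ : F.IsExtension hη'.le g g₂) :
    ∃ g' : F.M σ, F.res hτ.le g' = g₁ ∧ F.res hτ'.le g' = g₂ ∧
      ∀ (γ : Δ.Cone) (hγ : γ < σ), ¬ γ ≤ τ → ¬ γ ≤ τ' → F.res hγ.le g' = 0 := by
  classical
  have hS := hF.isGradedSheaf
  have hagree : ∀ (γ : Δ.Cone) (h : γ ≤ τ) (h' : γ ≤ τ'), F.res h g₁ = F.res h' g₂ := by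
    intro γ h h'
    by_cases hγ : γ ≤ η
    · rw [← hS.res_res hη.le hγ, ← hS.res_res hη'.le hγ, h₁.res_eq, h₂.res_eq]
    · rw [h₁.res_eq_zero γ (lt_of_le_of_ne h (by rintro rfl; exact hτ.not_le hτ' hne h')) hγ,
        h₂.res_eq_zero γ (lt_of_le_of_ne h' (by rintro rfl; exact hτ'.not_le hτ hne.symm h)) hγ]
  -- This is compatibility with zero on a face `γ` in neither facet. A common face `γ'` of `γ` and
  -- `ζ` cannot be `η`, as `γ` would be a third facet containing `η`. So `γ'` lies in `∂η`, where
  -- `g` vanishes, or outside `η`, where the extension vanishes.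
  have hvan : ∀ {ζ : Δ.Cone} (hζ : IsFacet η ζ) (hζσ : IsFacet ζ σ) (g₃ : F.M ζ)
      (_ : F.IsExtension hζ.le g g₃) {γ γ' : Δ.Cone} (_ : γ < σ) (_ : γ' ≤ γ) (_ : ¬ γ ≤ τ)
      (_ : ¬ γ ≤ τ') (_ : ¬ γ ≤ ζ) (h : γ' ≤ ζ), F.res h g₃ = 0 := by
    intro ζ hζ hζσ g₃ h₃ γ γ' hγ hle h1 h2 h3 h
    by_cases hγ' : γ' ≤ η
    · have hlt : γ' < η := by
        refine lt_of_le_of_ne hγ' ?_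
        rintro rfl
        have h4 := Fan.Cone.finrank_lt (lt_of_le_of_ne hle (by rintro rfl; exact h1 hη.le))
        have h5 := Fan.Cone.finrank_lt hγ
        have h6 := hη.finrank_eq
        have h7 := hτ.finrank_eq
        rcases eq_or_eq_of_isFacet hη hτ hτ' ⟨hγ.le, by omega⟩ hη'.le hle hne with rfl | rfl
        · exact h1 le_rfl
        · exact h2 le_rfl
      rw [← hS.res_res hζ.le hγ', h₃.res_eq, hg γ' hlt]
    · refine h₃.res_eq_zero γ' (lt_of_le_of_ne h ?_) hγ'
      rintro rfl
      exact h3 (hζσ.eq_of_le_of_lt hle hγ).le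
  let t : F.Sections (LowerSet.Iio σ) :=
    ⟨fun γ => if h : γ.1 ≤ τ then F.res h g₁ else if h : γ.1 ≤ τ' then F.res h g₂ else 0, by
      rintro ⟨γ, hγ⟩ ⟨γ', hγ'⟩ h
      change γ' ≤ γ at h
      by_cases h1 : γ ≤ τ
      · simp only [dif_pos h1, dif_pos (h.trans h1), hS.res_res]
      · by_cases h2 : γ ≤ τ'
        · simp only [dif_neg h1, dif_pos h2, dif_pos (h.trans h2), hS.res_res]
          split_ifs with h3
          · exact (hagree γ' h3 (h.trans h2)).symm
          · rfl
        · simp only [dif_neg h1, dif_neg h2, map_zero]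
          split_ifs with h3 h4
          · exact (hvan hη hτ g₁ h₁ hγ h h1 h2 h1 h3).symm
          · exact (hvan hη' hτ' g₂ h₂ hγ h h1 h2 h2 h4).symm
          · rfl⟩
  obtain ⟨t', ht'⟩ := hF.isFlabby _ t
  have key : ∀ (γ : Δ.Cone) (hγ : γ < σ), F.res hγ.le (t'.1 ⟨σ, trivial⟩) =
      if h : γ ≤ τ then F.res h g₁ else if h : γ ≤ τ' then F.res h g₂ else 0 := by
    intro γ hγ
    rw [t'.2 ⟨σ, trivial⟩ ⟨γ, trivial⟩ hγ.le]
    exact congrFun (congrArg Subtype.val ht') ⟨γ, hγ⟩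
  refine ⟨t'.1 ⟨σ, trivial⟩, ?_, ?_, fun γ hγ h h' => ?_⟩
  · rw [key τ hτ.lt, dif_pos le_rfl, hS.res_self]
  · rw [key τ' hτ'.lt, dif_neg (hτ'.not_le hτ hne.symm), dif_pos le_rfl, hS.res_self]
  · rw [key γ hγ, dif_neg h, dif_neg h']

/-- Since `c h_τ'` restricts to `h_η` on `V_τ`, the section `c h_τ' ĝ` over `⟨σ⟩` extends `h_η
ĝ|_τ`. The double restriction is thus computed from `h_τ h_τ' ĝ`, which is symmetric in the two
facets. -/
theorem phi_phi_apply (hF : F.IsPerverse) {η τ τ' σ : Δ.Cone} (hη : IsFacet η τ)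
    (hτ : IsFacet τ σ) (hτ' : IsFacet τ' σ) {c : ℝ}
    (hc : ∀ x ∈ τ.lin, hη.form x = c * hτ'.form x) (f : F.HomRel σ) (g : F.relSections η)
    {g' : F.M σ} (hg : F.IsExtension hη.le g.1 (F.res hτ.le g'))
    (hg' : ∀ (γ : Δ.Cone) (hγ : γ < σ), ¬ γ ≤ τ → ¬ γ ≤ τ' → F.res hγ.le g' = 0) :
    ∃ hmem : (SymmetricAlgebra.ι ℝ _ hτ.normal.form * SymmetricAlgebra.ι ℝ _ hτ'.normal.form) • g' ∈
        F.relSections σ,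
      phi hF hη hη.normal (phi hF hτ hτ.normal f) g =
        c • polyRes (Fan.Cone.lin_mono (hη.le.trans hτ.le)) (f ⟨_, hmem⟩) := by
  set a : Poly σ.lin := SymmetricAlgebra.ι ℝ _ hτ.normal.form with ha
  set b : Poly σ.lin := SymmetricAlgebra.ι ℝ _ hτ'.normal.form with hb
  set B : Poly σ.lin := algebraMap ℝ _ c * b with hB
  have hres : polyRes (Fan.Cone.lin_mono hτ.le) B = SymmetricAlgebra.ι ℝ _ hη.normal.form := by
    rw [hB, map_mul, AlgHom.commutes, hb, polyRes_ι, ← Algebra.smul_def, ← map_smul]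
    congr 1
    ext x
    have := hc x x.2
    rw [hη.form_coe, hτ'.form_coe ⟨x, Fan.Cone.lin_mono hτ.le x.2⟩] at this
    exact this.symm
  have hext : F.IsExtension hτ.le (SymmetricAlgebra.ι ℝ _ hη.normal.form • F.res hτ.le g')
      (B • g') := by
    refine ⟨by rw [F.res_smul, hres], fun γ hγ hle => ?_⟩
    rw [F.res_smul]
    by_cases h : γ ≤ τ'
    · rw [hB, map_mul, hb, polyRes_form_of_le h hτ'.le, mul_zero, zero_smul]
    · rw [hg' γ hγ hle h, smul_zero]
  have hmem₁ := form_smul_mem hτ hτ.normal hext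
  have hmem : (a * b) • g' ∈ F.relSections σ := by
    intro γ hγ
    rw [F.res_smul]
    by_cases h : γ ≤ τ
    · rw [map_mul, ha, polyRes_form_of_le h hτ.le, zero_mul, zero_smul]
    · by_cases h' : γ ≤ τ'
      · rw [map_mul, hb, polyRes_form_of_le h' hτ'.le, mul_zero, zero_smul]
      · rw [hg' γ hγ h h', smul_zero]
  refine ⟨hmem, ?_⟩
  have he : (⟨_, hmem₁⟩ : F.relSections σ) = algebraMap ℝ (Poly σ.lin) c • ⟨_, hmem⟩ := by
    apply Subtype.ext
    change a • B • g' = algebraMap ℝ (Poly σ.lin) c • (a * b) • g'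
    rw [smul_smul, smul_smul, hB]
    congr 1
    ring
  rw [phi_apply hF hη _ _ g hg,
    phi_apply hF hτ _ f ⟨_, form_smul_mem hη hη.normal hg⟩ hext, he, map_smul, smul_eq_mul, map_mul,
    AlgHom.commutes, map_mul, AlgHom.commutes, polyRes_polyRes, Algebra.smul_def]

/-- Both sides send `g` to `a b f(h_τ h_τ' ĝ)|_η`, where one extension `ĝ` serves both paths. -/
theorem smul_phi_phi_eq (hF : F.IsPerverse) {η τ τ' σ : Δ.Cone} (hη : IsFacet η τ)
    (hη' : IsFacet η τ') (hτ : IsFacet τ σ) (hτ' : IsFacet τ' σ) (hne : τ' ≠ τ) {a b : ℝ}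
    (hb : ∀ x ∈ τ.lin, hη.form x = b * hτ'.form x)
    (ha : ∀ x ∈ τ'.lin, hη'.form x = a * hτ.form x) (f : F.HomRel σ) :
    a • phi hF hη hη.normal (phi hF hτ hτ.normal f) =
      b • phi hF hη' hη'.normal (phi hF hτ' hτ'.normal f) := by
  ext g
  obtain ⟨g₁, h₁⟩ := exists_isExtension hF hη g
  obtain ⟨g₂, h₂⟩ := exists_isExtension hF hη' g
  obtain ⟨g', e₁, e₂, hg'⟩ := exists_isExtension_pair hF hη hη' hτ hτ' hne g.2 h₁ h₂
  obtain ⟨m₁, p₁⟩ := phi_phi_apply hF hη hτ hτ' hb f g (e₁.symm ▸ h₁) hg'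
  obtain ⟨m₂, p₂⟩ := phi_phi_apply hF hη' hτ' hτ ha f g (e₂.symm ▸ h₂)
    fun γ hγ h h' => hg' γ hγ h' h
  have hm : (⟨_, m₁⟩ : F.relSections σ) = ⟨_, m₂⟩ :=
    Subtype.ext (congrArg (fun p => p • g') (mul_comm _ _))
  rw [LinearMap.smul_apply, LinearMap.smul_apply, p₁, p₂, smul_smul, smul_smul, mul_comm a b, hm]

/-- The two restriction maps to a face of codimension two agree. -/
theorem facetRes_comm (hF : F.IsPerverse) (o : ConeOrientations Δ) {η τ τ' σ : Δ.Cone}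
    (hη : IsFacet η τ) (hη' : IsFacet η τ') (hτ : IsFacet τ σ) (hτ' : IsFacet τ' σ)
    (f : F.HomRel σ) :
    facetRes hF o hη (facetRes hF o hτ f) = facetRes hF o hη' (facetRes hF o hτ' f) := by
  by_cases hne : τ' = τ
  · subst hne
    rfl
  obtain ⟨b, hb, hb'⟩ := exists_form_eq_mul_form hη hτ hτ' hη'.le hne
  obtain ⟨a, ha, ha'⟩ := exists_form_eq_mul_form hη' hτ' hτ hη.le (Ne.symm hne)
  have hphi := smul_phi_phi_eq hF hη hη' hτ hτ' hne hb' ha' f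
  have hform := contract_contract_swap hη hη' hτ hτ' hb' ha' (posForm o σ)
  have hcomp : ∀ {ζ : Δ.Cone} (hζ : IsFacet η ζ) (hζσ : IsFacet ζ σ),
      ∃ s : ℝ, (s = 1 ∨ s = -1) ∧
      contract (Fan.Cone.lin_mono hζ.le) hζ.finrank_eq hζ.normal.vec
        (contract (Fan.Cone.lin_mono hζσ.le) hζσ.finrank_eq hζσ.normal.vec (posForm o σ)) =
          (s * (facetScale o hζ * facetScale o hζσ)) • posForm o η := by
    intro ζ hζ hζσ
    have h1 := transitionSign_mul_self o hζ hζ.normal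
    have h2 := transitionSign_mul_self o hζσ hζσ.normal
    have h3 := transitionSign_smul_contract o hζ
    have h4 := transitionSign_smul_contract o hζσ
    set s₁ := transitionSign o hζ hζ.normal
    set s₂ := transitionSign o hζσ hζσ.normal
    refine ⟨s₁ * s₂, mul_self_eq_one_iff.mp (by linear_combination h1 * (s₂ * s₂) + h2), ?_⟩
    have h5 : contract (Fan.Cone.lin_mono hζσ.le) hζσ.finrank_eq hζσ.normal.vec (posForm o σ) =
        (s₂ * facetScale o hζσ) • posForm o ζ := by
      rw [mul_smul, ← h4, smul_smul, h2, one_smul]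
    have h6 : contract (Fan.Cone.lin_mono hζ.le) hζ.finrank_eq hζ.normal.vec (posForm o ζ) =
        (s₁ * facetScale o hζ) • posForm o η := by
      rw [mul_smul, ← h3, smul_smul, h1, one_smul]
    rw [h5, map_smul, h6, smul_smul]
    congr 1
    ring
  obtain ⟨s, hs, e⟩ := hcomp hη hτ
  obtain ⟨s', hs', e'⟩ := hcomp hη' hτ'
  rw [e, e', smul_smul, smul_smul, ← neg_smul] at hform
  have hnum := smul_left_injective ℝ (posForm_ne_zero o η) hform
  beta_reduce at hnum
  have p := mul_pos (facetScale_pos o hη) (facetScale_pos o hτ)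
  have p' := mul_pos (facetScale_pos o hη') (facetScale_pos o hτ')
  have q := mul_pos hb p
  have q' := mul_pos ha p'
  -- The two sides agree up to sign by the anticommuting contractions, and both are positive. Thus
  -- the products of transition signs along the two paths are opposite.
  have hscale : b * (facetScale o hη * facetScale o hτ) =
      a * (facetScale o hη' * facetScale o hτ') := by
    rcases hs with rfl | rfl <;> rcases hs' with rfl | rfl <;> linarith
  simp only [facetRes, LinearMap.smul_apply, map_smul, smul_smul]
  refine smul_right_injective _ ha.ne' ?_
  change a • _ = a • _
  rw [smul_comm a, hphi, smul_smul, smul_smul]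
  congr 1
  linear_combination hscale

theorem dualFacetRes_comm (hF : F.IsPerverse) (o : ConeOrientations Δ) {η τ τ' σ : Δ.Cone}
    (hη : IsFacet η τ) (hη' : IsFacet η τ') (hτ : IsFacet τ σ) (hτ' : IsFacet τ' σ)
    (x : F.DualStalk σ) :
    dualFacetRes hF o hη (dualFacetRes hF o hτ x) =
      dualFacetRes hF o hη' (dualFacetRes hF o hτ' x) := by
  obtain ⟨f, rfl⟩ := (F.stalkEquiv o σ).surjective x
  simp only [dualFacetRes_stalkEquiv, facetRes_comm hF o hη hη' hτ hτ']

/-- The restriction map along a chain of facets does not depend on the chain. -/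
theorem dualChainRes_eq (hF : F.IsPerverse) (o : ConeOrientations Δ) {σ γ : Δ.Cone}
    (c c' : FacetChain Δ σ γ) (x : F.DualStalk σ) :
    dualChainRes hF o c x = dualChainRes hF o c' x := by
  suffices main : ∀ (n : ℕ) (σ γ : Δ.Cone) (c c' : FacetChain Δ σ γ) (x : F.DualStalk σ),
      Module.finrank ℝ σ.lin = n → dualChainRes hF o c x = dualChainRes hF o c' x from
    main _ σ γ c c' x rfl
  clear c c' x
  intro n
  induction n using Nat.strong_induction_on with
  | _ n ih =>
    intro σ γ c c' x hn
    obtain ⟨s, hs, -⟩ := exists_isShelling σ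
    -- The first facet of the later chain is moved down in the shelling. The target `γ` lies in `τ ∩
    -- τ'`, hence in a facet `η` of `τ` that is also a facet of an earlier `τ''`. Below `τ` the
    -- chain may be taken through `η`, and then `τ` is exchanged for `τ''`.
    have key : ∀ (τ : Δ.Cone) (hτ : IsFacet τ σ) (d : FacetChain Δ τ γ) (τ' : Δ.Cone)
        (hτ' : IsFacet τ' σ) (d' : FacetChain Δ τ' γ), s τ' ≤ s τ →
        dualChainRes hF o d (dualFacetRes hF o hτ x) =
          dualChainRes hF o d' (dualFacetRes hF o hτ' x) := by
      intro τ
      have : IsTrans Δ.Cone (InvImage (· < ·) s) := ⟨fun a b c h1 h2 => lt_trans h1 h2⟩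
      have : Std.Irrefl (InvImage (· < ·) s) := ⟨fun a h => lt_irrefl _ h⟩
      have hwf : WellFounded (InvImage (· < ·) s) := Finite.wellFounded_of_trans_of_irrefl _
      induction τ using hwf.induction with
      | _ τ ihs =>
        intro hτ d τ' hτ' d' hle
        have ihτ := fun (τ : Δ.Cone) (hτ : IsFacet τ σ) =>
          ih _ (hn ▸ Fan.Cone.finrank_lt hτ.lt) τ γ
        rcases hle.eq_or_lt with heq | hlt
        · obtain rfl := hs.inj _ _ hτ' hτ heq
          exact ihτ _ hτ d d' _ rfl
        · obtain ⟨η, ⟨hη, τ'', hτ'', hle'', hlt''⟩, hγη⟩ :=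
            hs.pure γ τ τ' hτ hτ' hlt d.le d'.le
          have hη'' : IsFacet η τ'' := ⟨hle'', by
            have h1 := hη.finrank_eq
            have h2 := hτ.finrank_eq
            have h3 := hτ''.finrank_eq
            omega⟩
          obtain ⟨e⟩ := nonempty_facetChain hγη
          have h1 : dualChainRes hF o d (dualFacetRes hF o hτ x) =
              dualChainRes hF o (.step hη'' e) (dualFacetRes hF o hτ'' x) := by
            rw [ihτ _ hτ d (.step hη e) _ rfl]
            simp only [dualChainRes, LinearMap.comp_apply]
            rw [dualFacetRes_comm hF o hη hη'' hτ hτ'']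
          rw [h1]
          rcases le_total (s τ') (s τ'') with h | h
          · exact ihs τ'' hlt'' hτ'' _ τ' hτ' d' h
          · exact (ihs τ' hlt hτ' d' τ'' hτ'' _ h).symm
    cases c with
    | refl _ =>
      cases c' with
      | refl _ => rfl
      | step h d => exact absurd h.lt d.le.not_gt
    | step h d =>
      cases c' with
      | refl _ => exact absurd h.lt d.le.not_gt
      | step h' d' =>
        simp only [dualChainRes, LinearMap.comp_apply]
        rcases le_total (s _) (s _) with hle | hle
        · exact (key _ h' d' _ h d hle).symm
        · exact key _ h d _ h' d' hle

end ConeSystem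

namespace ConeSystem

/-! ### The grading of the dual sheaf -/

section DualGrading

variable {V : Type u} [AddCommGroup V] [Module ℝ V] {Δ : Fan V} {F : ConeSystem.{u, w} Δ}

theorem component_mem_relSections (hF : F.IsGradedSheaf) {σ : Δ.Cone} (k : ℤ) {x : F.M σ}
    (hx : x ∈ F.relSections σ) : component (hF.isInternal σ) k x ∈ F.relSections σ := by
  intro τ hτ
  rw [← component_map_of_degree_zero (hF.isInternal σ) (hF.isInternal τ) (F.res hτ.le)
    (fun i x hx => hF.res_mem hτ.le i x hx), hx τ hτ, map_zero]

theorem IsExtension.component (hF : F.IsGradedSheaf) {τ σ : Δ.Cone} {h : τ ≤ σ} {g : F.M τ}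
    {g' : F.M σ} (hg : F.IsExtension h g g') {k : ℤ} (hk : g ∈ F.gr τ k) :
    F.IsExtension h g (component (hF.isInternal σ) k g') := by
  constructor
  · rw [← component_map_of_degree_zero (hF.isInternal σ) (hF.isInternal τ) (F.res h)
      (fun i x hx => hF.res_mem h i x hx), hg.res_eq, component_of_mem _ hk]
  · intro γ hγ hle
    rw [← component_map_of_degree_zero (hF.isInternal σ) (hF.isInternal γ) (F.res hγ.le)
      (fun i x hx => hF.res_mem hγ.le i x hx), hg.res_eq_zero γ hγ hle, map_zero]

theorem add_mem_homGr {σ : Δ.Cone} {j : ℤ} {f g : F.HomRel σ} (hf : f ∈ F.homGr σ j)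
    (hg : g ∈ F.homGr σ j) : f + g ∈ F.homGr σ j :=
  fun i x hx => add_mem (hf i x hx) (hg i x hx)

theorem smul_real_mem_homGr {σ : Δ.Cone} {j : ℤ} (c : ℝ) {f : F.HomRel σ}
    (hf : f ∈ F.homGr σ j) : c • f ∈ F.homGr σ j :=
  fun i x hx => Submodule.smul_mem _ c (hf i x hx)

theorem smul_mem_homGr {σ : Δ.Cone} {i j : ℤ} {a : Poly σ.lin} (ha : a ∈ polyGr σ.lin i)
    {f : F.HomRel σ} (hf : f ∈ F.homGr σ j) : a • f ∈ F.homGr σ (i + j) := fun k x hx => by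
  have := mul_mem_polyGr ha (hf k x hx)
  rwa [show i + (k + j) = k + (i + j) by ring] at this

/-- In a homogeneous basis the coordinates of an element of degree `k` are homogeneous, of degree `k
- d i`; so the degree of a functional can be read off on the basis. -/
theorem mem_homGr_of_basis (hF : F.IsPerverse) {σ : Δ.Cone} {n : ℕ}
    (b : Module.Basis (Fin n) (Poly σ.lin) (F.relSections σ)) {d : Fin n → ℤ}
    (hb : ∀ i, (b i : F.M σ) ∈ F.gr σ (d i)) {j : ℤ} {f : F.HomRel σ}
    (hf : ∀ i, f (b i) ∈ polyGr σ.lin (d i + j)) : f ∈ F.homGr σ j := by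
  have hG := hF.isGradedSheaf
  intro k x hx
  have hrepr : ∀ i, component (isInternal_polyGr σ.lin) (k - d i) (b.repr x i) = b.repr x i := by
    have h1 : ∑ i, component (isInternal_polyGr σ.lin) (k - d i) (b.repr x i) • b i = x := by
      apply Subtype.ext
      rw [← component_of_mem (hG.isInternal σ) hx]
      conv_rhs => rw [← b.sum_repr x]
      rw [AddSubmonoidClass.coe_finsetSum, AddSubmonoidClass.coe_finsetSum, map_sum]
      refine Finset.sum_congr rfl fun i _ => ?_
      have h2 := component_map (isInternal_polyGr σ.lin) (hG.isInternal σ)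
        ((smulAddHom (Poly σ.lin) (F.M σ)).flip (b i)) (d i)
        (fun l a ha => hG.smul_mem σ l (d i) a _ ha (hb i)) (k - d i) (b.repr x i)
      rw [sub_add_cancel] at h2
      exact h2.symm
    intro i
    conv_rhs => rw [← h1]
    rw [b.repr_sum_self]
  rw [← b.sum_repr x, map_sum]
  refine sum_mem fun i _ => ?_
  rw [map_smul, smul_eq_mul]
  have := mul_mem_polyGr (hrepr i ▸ component_mem (isInternal_polyGr σ.lin) (k - d i) (b.repr x i))
    (hf i)
  rwa [show k - d i + (d i + j) = k + j by ring] at this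

variable [FiniteDimensional ℝ V]

/-- For homogeneous `g` the extension may be replaced by its component in the degree of `g`; the
factor `h` adds `2`. This shift offsets the drop by `2` in the degree of the determinant line. -/
theorem phi_mem_homGr (hF : F.IsPerverse) {τ σ : Δ.Cone} (hτ : IsFacet τ σ) (N : FacetNormal τ σ)
    {j : ℤ} {f : F.HomRel σ} (hf : f ∈ F.homGr σ j) : phi hF hτ N f ∈ F.homGr τ (j + 2) := by
  have hG := hF.isGradedSheaf
  intro i g hg
  obtain ⟨g', hg'⟩ := exists_isExtension hF hτ g
  have hg'' := hg'.component hG hg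
  rw [phi_apply hF hτ N f g hg'']
  refine polyRes_mem_polyGr _ ?_
  have := hf _ ⟨_, form_smul_mem hτ N hg''⟩
    (hG.smul_mem σ 2 i _ _ (ι_mem_polyGr N.form) (component_mem (hG.isInternal σ) i g'))
  rwa [show 2 + i + j = i + (j + 2) by ring] at this

theorem facetRes_mem_homGr (hF : F.IsPerverse) (o : ConeOrientations Δ) {τ σ : Δ.Cone}
    (hτ : IsFacet τ σ) {j : ℤ} {f : F.HomRel σ} (hf : f ∈ F.homGr σ j) :
    facetRes hF o hτ f ∈ F.homGr τ (j + 2) :=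
  smul_real_mem_homGr _ (phi_mem_homGr hF hτ _ hf)

theorem mem_dualGr_iff (o : ConeOrientations Δ) {σ : Δ.Cone} {k : ℤ} (f : F.HomRel σ) :
    F.stalkEquiv o σ f ∈ F.dualGr σ k ↔
      f ∈ F.homGr σ (k - 2 * (Module.finrank ℝ σ.lin : ℤ)) := by
  constructor
  · intro h
    have key : ∀ z ∈ F.dualGr σ k, (F.stalkEquiv o σ).symm z ∈
        F.homGr σ (k - 2 * (Module.finrank ℝ σ.lin : ℤ)) := by
      intro z hz
      induction hz using AddSubgroup.closure_induction with
      | mem z hz =>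
        obtain ⟨f, hf, ω, rfl⟩ := hz
        obtain ⟨c, rfl⟩ := exists_eq_smul_detDual (posForm_ne_zero o σ) ω
        have : f ⊗ₜ[ℝ] (c • posForm o σ) = F.stalkEquiv o σ (c • f) := by
          rw [stalkEquiv_apply, TensorProduct.tmul_smul, TensorProduct.smul_tmul']
        rw [this, LinearEquiv.symm_apply_apply]
        exact smul_real_mem_homGr c hf
      | zero =>
        rw [map_zero]
        exact fun i x _ => zero_mem _
      | add x y _ _ hx hy =>
        rw [map_add]
        exact add_mem_homGr hx hy
      | neg x _ hx =>
        rw [map_neg]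
        exact fun i x hx' => neg_mem (hx i x hx')
    simpa using key _ h
  · intro h
    exact AddSubgroup.subset_closure ⟨f, h, posForm o σ, stalkEquiv_apply o σ f⟩

theorem exists_homogeneous_basis_relSections (hF : F.IsPerverse) (σ : Δ.Cone) :
    ∃ (n : ℕ) (b : Module.Basis (Fin n) (Poly σ.lin) (F.relSections σ)) (d : Fin n → ℤ),
      ∀ i, (b i : F.M σ) ∈ F.gr σ (d i) := by
  have hG := hF.isGradedSheaf
  obtain ⟨h1, h2⟩ := finite_projective_relSections hF σ
  exact exists_homogeneous_basis (hG.isInternal σ) (fun i j a x => hG.smul_mem σ i j a x) _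
    fun k x hx => component_mem_relSections hG k hx

theorem isInternal_of_component_equiv {M N : Type*} [AddCommGroup M] [AddCommGroup N]
    {gr : ℤ → AddSubgroup M} (E : N ≃+ M) (c : ℤ → N →+ N) (h1 : ∀ k f, E f ∈ gr k → c k f = f)
    (h2 : ∀ j k, j ≠ k → ∀ f, E f ∈ gr j → c k f = 0)
    (h3 : ∀ f, E f ∈ AddSubgroup.closure {y | ∃ k, y ∈ gr k}) : DirectSum.IsInternal gr := by
  refine isInternal_of_component (fun k => E.toAddMonoidHom.comp ((c k).comp E.symm.toAddMonoidHom))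
    (fun k x hx => ?_) (fun j k hjk x hx => ?_) fun x => ?_
  · obtain ⟨f, rfl⟩ := E.surjective x
    simp [h1 k f hx]
  · obtain ⟨f, rfl⟩ := E.surjective x
    simp [h2 j k hjk f hx]
  · obtain ⟨f, rfl⟩ := E.surjective x
    exact h3 f

/-- A finite homogeneous basis of `F_(σ, ∂σ)` identifies functionals with tuples of polynomials,
graded with shifts. Finiteness ensures that every functional is a finite sum of homogeneous ones. -/
theorem isInternal_dualGr (hF : F.IsPerverse) (o : ConeOrientations Δ) (σ : Δ.Cone) :
    DirectSum.IsInternal (F.dualGr σ) := by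
  obtain ⟨n, b, d, hb⟩ := exists_homogeneous_basis_relSections hF σ
  set D : ℤ := 2 * (Module.finrank ℝ σ.lin : ℤ) with hD
  -- the homogeneous components of a functional
  let c : ℤ → F.HomRel σ →+ F.HomRel σ := fun j =>
    ⟨⟨fun f => b.constr ℕ fun i => component (isInternal_polyGr σ.lin) (d i + j) (f (b i)),
      b.ext fun i => by simp⟩, fun f g => b.ext fun i => by simp⟩
  have hc : ∀ j f i, c j f (b i) = component (isInternal_polyGr σ.lin) (d i + j) (f (b i)) :=
    fun j f i => b.constr_basis _ _ _
  have hmem : ∀ {k : ℤ} {f : F.HomRel σ}, F.stalkEquiv o σ f ∈ F.dualGr σ k → ∀ i,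
      f (b i) ∈ polyGr σ.lin (d i + (k - D)) :=
    fun hf i => (mem_dualGr_iff o _).mp hf (d i) (b i) (hb i)
  refine isInternal_of_component_equiv (F.stalkEquiv o σ).toAddEquiv (fun k => c (k - D))
    (fun k f hf => b.ext fun i => ?_) (fun k k' hk f hf => b.ext fun i => ?_) fun f => ?_
  · rw [hc, component_of_mem _ (hmem hf i)]
  · rw [hc, component_of_mem_ne _ (hmem hf i) (by omega)]
    rfl
  · have hf : f = ∑ i, f (b i) • b.coord i := b.ext fun i => by
      rw [LinearMap.sum_apply, Finset.sum_eq_single i]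
      · simp
      · intro j _ hj
        simp [hj.symm]
      · simp
    change F.stalkEquiv o σ f ∈ _
    rw [hf, map_sum]
    refine sum_mem fun i _ => ?_
    have key : ∀ a ∈ AddSubgroup.closure {y | ∃ k, y ∈ polyGr σ.lin k},
        F.stalkEquiv o σ (a • b.coord i) ∈ AddSubgroup.closure {y | ∃ k, y ∈ F.dualGr σ k} := by
      intro a ha
      induction ha using AddSubgroup.closure_induction with
      | mem a ha =>
        obtain ⟨k, hk⟩ := ha
        refine AddSubgroup.subset_closure ⟨k - d i + D, (mem_dualGr_iff o _).mpr ?_⟩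
        refine mem_homGr_of_basis hF b hb fun j => ?_
        rw [LinearMap.smul_apply, b.coord_apply, b.repr_self, Finsupp.single_apply]
        split_ifs with h
        · subst h
          rw [smul_eq_mul, mul_one, add_sub_cancel_right, add_sub_cancel]
          exact hk
        · rw [smul_zero]
          exact zero_mem _
      | zero => rw [zero_smul, map_zero]; exact zero_mem _
      | add x y _ _ hx hy => rw [add_smul, map_add]; exact add_mem hx hy
      | neg x _ hx =>
        have h : -x • b.coord i = -(x • b.coord i) := neg_smul x (b.coord i)
        rw [h, map_neg]
        exact neg_mem hx
    exact key _ (mem_closure_polyGr _)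

theorem dualFacetRes_mem_dualGr (hF : F.IsPerverse) (o : ConeOrientations Δ) {τ σ : Δ.Cone}
    (hτ : IsFacet τ σ) {k : ℤ} {x : F.DualStalk σ} (hx : x ∈ F.dualGr σ k) :
    dualFacetRes hF o hτ x ∈ F.dualGr τ k := by
  obtain ⟨f, rfl⟩ := (F.stalkEquiv o σ).surjective x
  rw [dualFacetRes_stalkEquiv, mem_dualGr_iff]
  have := facetRes_mem_homGr hF o hτ ((mem_dualGr_iff o f).mp hx)
  rwa [show k - 2 * (Module.finrank ℝ σ.lin : ℤ) + 2 = k - 2 * (Module.finrank ℝ τ.lin : ℤ) by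
    rw [← hτ.finrank_eq]; push_cast; ring] at this

theorem dualChainRes_mem_dualGr (hF : F.IsPerverse) (o : ConeOrientations Δ) {τ σ : Δ.Cone}
    (c : FacetChain Δ σ τ) {k : ℤ} {x : F.DualStalk σ} (hx : x ∈ F.dualGr σ k) :
    dualChainRes hF o c x ∈ F.dualGr τ k := by
  induction c with
  | refl _ => exact hx
  | step h c ih => exact ih (dualFacetRes_mem_dualGr hF o h hx)

end DualGrading

/-! ### The dual sheaf is perverse -/

section Flabby

variable {V : Type u} [AddCommGroup V] [Module ℝ V] {Δ : Fan V}

/-- A sheaf is flabby if the sections over the boundary of each cone extend to the cone. -/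
theorem isFlabby_of_forall_cone {G : ConeSystem.{u, w} Δ}
    (hres : ∀ {γ τ σ : Δ.Cone} (h : τ ≤ σ) (h' : γ ≤ τ) (x : G.M σ),
      G.res h' (G.res h x) = G.res (h'.trans h) x)
    (hext : ∀ (σ : Δ.Cone) (s : G.Sections (LowerSet.Iio σ)),
      ∃ y : G.M σ, ∀ (γ : Δ.Cone) (hγ : γ < σ), G.res hγ.le y = s.1 ⟨γ, hγ⟩) : G.IsFlabby := by
  classical
  intro Λ
  induction hn : {σ : Δ.Cone | σ ∉ Λ}.ncard using Nat.strong_induction_on generalizing Λ with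
  | _ n ih =>
    intro s
    rcases Set.eq_empty_or_nonempty {σ : Δ.Cone | σ ∉ Λ} with he | hne
    · have hΛ : ∀ σ, σ ∈ Λ := fun σ => by
        by_contra h
        exact Set.eq_empty_iff_forall_notMem.mp he σ h
      exact ⟨⟨fun σ => s.1 ⟨σ.1, hΛ _⟩, fun σ τ h => s.2 ⟨σ.1, hΛ _⟩ ⟨τ.1, hΛ _⟩ h⟩, rfl⟩
    -- By minimality the boundary of `σ` lies in `Λ`, so `Λ ∪ {σ}` is a subfan with smaller
    -- complement.
    obtain ⟨σ, hσΛ, hmin⟩ := Set.Finite.exists_minimal (Set.toFinite _) hne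
    change σ ∉ Λ at hσΛ
    have hlt : ∀ γ, γ < σ → γ ∈ Λ := fun γ hγ => by
      by_contra h
      exact hγ.not_ge (hmin h hγ.le)
    let Λ' : LowerSet Δ.Cone := ⟨{γ | γ ∈ Λ ∨ γ = σ}, by
      rintro γ γ' h (hγ | rfl)
      · exact Or.inl (Λ.lower h hγ)
      · rcases h.eq_or_lt with rfl | h
        · exact Or.inr rfl
        · exact Or.inl (hlt _ h)⟩
    obtain ⟨y, hy⟩ := hext σ (s.restrict fun γ hγ => hlt γ hγ)
    let s' : G.Sections Λ' :=
      ⟨fun γ => if h : γ.1 ∈ Λ then s.1 ⟨γ.1, h⟩ else if h' : γ.1 ≤ σ then G.res h' y else 0, by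
        rintro ⟨γ, hγ⟩ ⟨γ', hγ'⟩ h
        change γ' ≤ γ at h
        by_cases h1 : γ ∈ Λ
        · have h2 : γ' ∈ Λ := Λ.lower h h1
          simp only [dif_pos h1, dif_pos h2]
          exact s.2 ⟨γ, h1⟩ ⟨γ', h2⟩ h
        · obtain rfl := hγ.resolve_left h1
          by_cases h2 : γ' ∈ Λ
          · simp only [dif_neg h1, dif_pos le_rfl, dif_pos h2, hres]
            exact hy γ' (lt_of_le_of_ne h (by rintro rfl; exact h1 h2))
          · simp only [dif_neg h1, dif_pos le_rfl, dif_neg h2, dif_pos h, hres]⟩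
    obtain ⟨t, ht⟩ := ih _ (by
      rw [← hn]
      refine Set.ncard_lt_ncard ?_ (Set.toFinite _)
      refine ⟨fun γ hγ h => hγ (Or.inl h), fun h => h hσΛ (Or.inr rfl)⟩) Λ' rfl s'
    refine ⟨t, Subtype.ext (funext fun γ => ?_)⟩
    have := congrFun (congrArg Subtype.val ht) ⟨γ.1, Or.inl γ.2⟩
    exact this.trans (dif_pos γ.2)

end Flabby

section Dual

variable {V : Type u} [AddCommGroup V] [Module ℝ V] [FiniteDimensional ℝ V] {Δ : Fan V}
  {F : ConeSystem.{u, w} Δ}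

theorem dual_res_eq (hF : F.IsPerverse) (o : ConeOrientations Δ) {σ τ : Δ.Cone} (h : τ ≤ σ)
    (c : FacetChain Δ σ τ) (x : F.DualStalk σ) : (dual hF o).res h x = dualChainRes hF o c x := by
  have hc : Nonempty (FacetChain Δ σ τ) := ⟨c⟩
  simp only [dual, dif_pos hc]
  exact dualChainRes_eq hF o _ c x

theorem dual_res_facet (hF : F.IsPerverse) (o : ConeOrientations Δ) {σ τ : Δ.Cone}
    (hτ : IsFacet τ σ) (x : F.DualStalk σ) :
    (dual hF o).res hτ.le x = dualFacetRes hF o hτ x :=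
  dual_res_eq hF o hτ.le (.step hτ (.refl _)) x

theorem exists_dualChainRes_eq_comp (hF : F.IsPerverse) (o : ConeOrientations Δ) {σ τ γ : Δ.Cone}
    (c : FacetChain Δ σ τ) (c' : FacetChain Δ τ γ) : ∃ c'' : FacetChain Δ σ γ,
      ∀ x, dualChainRes hF o c'' x = dualChainRes hF o c' (dualChainRes hF o c x) := by
  induction c with
  | refl _ => exact ⟨c', fun x => rfl⟩
  | step h c ih =>
    obtain ⟨d, hd⟩ := ih c'
    exact ⟨.step h d, fun x => hd _⟩

theorem isGradedSheaf_dual (hF : F.IsPerverse) (o : ConeOrientations Δ) :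
    (dual hF o).IsGradedSheaf where
  res_self σ x := dual_res_eq hF o le_rfl (.refl σ) x
  res_res {γ τ σ} h h' x := by
    obtain ⟨c⟩ := nonempty_facetChain h
    obtain ⟨c'⟩ := nonempty_facetChain h'
    obtain ⟨c'', hc''⟩ := exists_dualChainRes_eq_comp hF o c c'
    exact (congrArg ((dual hF o).res h') (dual_res_eq hF o h c x)).trans
      ((dual_res_eq hF o h' c' _).trans
        ((hc'' x).symm.trans (dual_res_eq hF o (h'.trans h) c'' x).symm))
  isInternal σ := isInternal_dualGr hF o σ
  smul_mem σ i j a x ha hx := by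
    obtain ⟨f, rfl⟩ := (F.stalkEquiv o σ).surjective x
    have hf := smul_mem_homGr ha ((mem_dualGr_iff o f).mp hx)
    rw [← add_sub_assoc, ← mem_dualGr_iff o, map_smul] at hf
    exact hf
  res_mem {τ σ} h i x hx := by
    obtain ⟨c⟩ := nonempty_facetChain h
    exact (congrArg (· ∈ F.dualGr τ i) (dual_res_eq hF o h c x)).mpr
      (dualChainRes_mem_dualGr hF o c hx)

/-- A section over `∂σ` is determined by its values on the facets of `σ`, and any two of these agree
on a common facet. Such a family of functionals comes from `σ`. -/
theorem isFlabby_dual (hF : F.IsPerverse) (o : ConeOrientations Δ) : (dual hF o).IsFlabby := by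
  have hD := isGradedSheaf_dual hF o
  refine isFlabby_of_forall_cone hD.res_res fun σ s => ?_
  let t : ∀ τ : Δ.Cone, IsFacet τ σ → F.HomRel τ := fun τ hτ =>
    (F.stalkEquiv o τ).symm (s.1 ⟨τ, hτ.lt⟩)
  have ht : ∀ (τ : Δ.Cone) (hτ : IsFacet τ σ), F.stalkEquiv o τ (t τ hτ) = s.1 ⟨τ, hτ.lt⟩ :=
    fun τ hτ => LinearEquiv.apply_symm_apply _ _
  have hstep : ∀ {η τ : Δ.Cone} (hη : IsFacet η τ) (hτ : IsFacet τ σ),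
      F.stalkEquiv o η (facetRes hF o hη (t τ hτ)) = s.1 ⟨η, hη.lt.trans hτ.lt⟩ := by
    intro η τ hη hτ
    exact (dualFacetRes_stalkEquiv hF o hη _).symm.trans
      ((congrArg (dualFacetRes hF o hη) (ht τ hτ)).trans ((dual_res_facet hF o hη _).symm.trans
        (s.2 ⟨τ, hτ.lt⟩ ⟨η, hη.lt.trans hτ.lt⟩ hη.le)))
  obtain ⟨f, hf⟩ := exists_functional_of_compatible hF (fun hτ => facetRes hF o hτ)
    (fun hτ => ⟨_, (facetScale_pos o hτ).ne', rfl⟩)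
    (fun hη hη' hτ hτ' f => facetRes_comm hF o hη hη' hτ hτ' f) t
    (fun hη hη' hτ hτ' => (F.stalkEquiv o _).injective ((hstep hη hτ).trans (hstep hη' hτ').symm))
  refine ⟨F.stalkEquiv o σ f, fun γ hγ => ?_⟩
  obtain ⟨τ, hτ, hle⟩ := exists_isFacet_of_lt hγ
  have h1 : (dual hF o).res hτ.le (F.stalkEquiv o σ f) = s.1 ⟨τ, hτ.lt⟩ :=
    (dual_res_facet hF o hτ _).trans ((dualFacetRes_stalkEquiv hF o hτ f).trans
      ((congrArg (F.stalkEquiv o τ) (hf τ hτ)).trans (ht τ hτ)))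
  exact (hD.res_res hτ.le hle _).symm.trans ((congrArg ((dual hF o).res hle) h1).trans
    (s.2 ⟨τ, hτ.lt⟩ ⟨γ, hγ⟩ hle))

/-- The dual of a perverse sheaf is perverse. -/
theorem isPerverse_dual (hF : F.IsPerverse) (o : ConeOrientations Δ) :
    (dual hF o).IsPerverse where
  isGradedSheaf := isGradedSheaf_dual hF o
  isFlabby := isFlabby_dual hF o
  finite σ := by
    obtain ⟨n, b, -⟩ := exists_homogeneous_basis_relSections hF σ
    have := Module.Finite.of_basis b
    have := Module.Free.of_basis b
    exact Module.Finite.equiv (F.stalkEquiv o σ)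
  free σ := by
    obtain ⟨n, b, -⟩ := exists_homogeneous_basis_relSections hF σ
    exact Module.Free.of_basis (b.dualBasis.map (F.stalkEquiv o σ))

end Dual

end ConeSystem

end FanDuality

end

theorem mainTheorem5 {V : Type*} [AddCommGroup V] [Module ℝ V] [FiniteDimensional ℝ V]
    (Δ : FanDuality.Fan V) (F : FanDuality.ConeSystem Δ) (hF : F.IsPerverse)
    (o : FanDuality.ConeOrientations Δ) :
    (∀ (σ τ : Δ.Cone) (h : τ ≤ σ), Nonempty (FanDuality.FacetChain Δ σ τ) ∧
      ∀ (c : FanDuality.FacetChain Δ σ τ) (x : F.DualStalk σ),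
        (FanDuality.ConeSystem.dual hF o).res h x = FanDuality.ConeSystem.dualChainRes hF o c x) ∧
    (FanDuality.ConeSystem.dual hF o).IsPerverse :=
  ⟨fun _ _ h => ⟨FanDuality.nonempty_facetChain h, fun c x =>
    FanDuality.ConeSystem.dual_res_eq hF o h c x⟩, FanDuality.ConeSystem.isPerverse_dual hF o⟩
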